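/- A (complete) \emph{deterministic real-time one-counter automaton} (DROCA) $\mathcal A=(Q,\Sigma,q_0,\delta_0,\delta_1,F)$ has a finite set $Q$ of $|\mathcal A|=|Q|$ states, an initial state $q_0\in Q$, final states $F\subseteq Q$ and total transition functions $\delta_0:Q\times\Sigma\to Q\times\{0,+1\}$ (used when the counter is $0$) and $\delta_1:Q\times\Sigma\to Q\times\{0,+1,-1\}$ (used when the counter is positive). Its run starts in $q_0$ with counter-value $0$; a word is accepted if its run ends in $F$, and $\mathrm{ce}_{\mathcal A}(w)$ denotes the counter-value reached on reading $w$. A \emph{visible alphabet} is a finite alphabet $\Sigma$ in which every letter has a prescribed counter-action at counter-value $0$ and a prescribed counter-action at positive counter-values; a \emph{visibly one-counter automaton} (VOCA) over it is a DROCA over $\Sigma$ in which every transition performs the counter-action prescribed for its letter. A \emph{learner} knows the visible alphabet $\Sigma$, but not the VOCA $\mathcal A$ over it, and may ask: \begin{itemize} \item \emph{membership queries}: is the word $w$ in $L(\mathcal A)$? \item \emph{minimal synchronous-equivalence queries}: for a DROCA $\mathcal C$ over $\Sigma$, the teacher answers \emph{yes} if $L(\mathcal C)=L(\mathcal A)$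 and $\mathrm{ce}_{\mathcal C}(w)=\mathrm{ce}_{\mathcal A}(w)$ for all $w\in\Sigma^*$, and otherwise returns any shortest word $z$ on which acceptance or the counter-value differs between $\mathcal C$ and $\mathcal A$; \item \emph{SAT-solver calls}: for a propositional formula in conjunctive normal form, the solver returns any satisfying assignment, or reports that there is none. \end{itemize} Counter-value queries are not available. \textbf{Corollary.} There is a single deterministic learner such that for every visible alphabet $\Sigma$ and every VOCA $\mathcal A$ over $\Sigma$, whatever correct answers it is given, it halts with a minimal VOCA recognising $L(\mathcal A)$, i.e. a VOCA over $\Sigma$ with language $L(\mathcal A)$ and with the least number of states among all such VOCAs. It makes $\mathcal O(|\mathcal A|^3)$ SAT-solver calls and $\mathcal O(|\mathcal A|^3)$ minimal synchronous-equivalence queries, with absolute constants, and a number of membership queries that is polynomial in $|\mathcal A|$ and $|\Sigma|$; the running time of the learner itself, each query or call being answered by an oracle, is also polynomial in $|\mathcal A|$ and $|\Sigma|$. -/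

import Mathlib

/-! ## Deterministic real-time one-counter automata -/

/-- What a transition may do to the counter when the counter is zero. -/
inductive ZeroAction
  | stay
  | inc

/-- What a transition may do to the counter when the counter is positive. -/
inductive PosAction
  | dec
  | stay
  | inc

/-- The counter-value after performing the action at counter-value `0`. -/
def ZeroAction.result : ZeroAction → ℕ
  | .stay => 0
  | .inc => 1

/-- The counter-value after performing the action at the positive counter-value `n + 1`. -/
def PosAction.result (n : ℕ) : PosAction → ℕ
  | .dec => n
  | .stay => n + 1
  | .inc => n + 2

/-- A (complete) deterministic real-time one-counter automaton with state set `Q` over the input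
alphabet `α`. Finiteness of `Q` and `α` is required where the automata are used. -/
structure DROCA (Q α : Type*) where
  /-- the initial state -/
  init : Q
  /-- the transition function used at counter-value zero -/
  δ₀ : Q → α → Q × ZeroAction
  /-- the transition function used at positive counter-values -/
  δ₁ : Q → α → Q × PosAction
  /-- the characteristic function of the set of final states -/
  final : Q → Bool

namespace DROCA

variable {Q Q' α : Type*}

/-- One transition between configurations (pairs of a state and a counter-value). -/
def step (A : DROCA Q α) : Q × ℕ → α → Q × ℕ
  | (q, 0), a => ((A.δ₀ q a).1, (A.δ₀ q a).2.result)
  | (q, n + 1), a => ((A.δ₁ q a).1, (A.δ₁ q a).2.result n)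

/-- The configuration reached from the initial configuration on reading a word. -/
def run (A : DROCA Q α) (w : List α) : Q × ℕ :=
  w.foldl A.step (A.init, 0)

/-- The counter-effect of a word: the counter-value reached on reading it. -/
def ce (A : DROCA Q α) (w : List α) : ℕ := (A.run w).2

/-- The language of all words that lead to a final state. -/
def language (A : DROCA Q α) : Language α := {w | A.final (A.run w).1 = true}

/-- Two automata are equivalent if they recognise the same language. -/
def Equivalent (A : DROCA Q α) (B : DROCA Q' α) : Prop := A.language = B.language

/-- Two automata are counter-synchronised if every word has the same counter-effect in both. -/
def CounterSynchronised (A : DROCA Q α) (B : DROCA Q' α) : Prop := ∀ w, A.ce w = B.ce w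

/-- `z` witnesses that `A` and `C` are not both equivalent and counter-synchronised. -/
def IsCounterexample (A : DROCA Q α) (C : DROCA Q' α) (z : List α) : Prop :=
  ¬(z ∈ C.language ↔ z ∈ A.language) ∨ A.ce z ≠ C.ce z

/-- `z` is a counterexample of minimal length. -/
def IsMinimalCounterexample (A : DROCA Q α) (C : DROCA Q' α) (z : List α) : Prop :=
  A.IsCounterexample C z ∧ ∀ z', A.IsCounterexample C z' → z.length ≤ z'.length

end DROCA

/-- A visible alphabet: every letter determines its counter-action, at counter-value zero and at
positive counter-values. The usual alphabets of call, internal and return letters are the special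
case in which a call increments, an internal letter leaves the counter unchanged, and a return
decrements a positive counter and leaves the counter zero unchanged. -/
structure VisibleAlphabet (α : Type*) where
  zero : α → ZeroAction
  pos : α → PosAction

/-- `A` is a visibly one-counter automaton (VOCA) over the visible alphabet `c`: the counter-action
of each transition is the one that `c` prescribes for its letter. -/
def DROCA.IsVOCA {Q α : Type*} (c : VisibleAlphabet α) (A : DROCA Q α) : Prop :=
  ∀ q a, (A.δ₀ q a).2 = c.zero a ∧ (A.δ₁ q a).2 = c.pos a

/-- `B` is a minimal VOCA over `c` for the language of `A`: a VOCA that recognises this language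
with the least possible number of states. -/
def IsMinimalVOCAFor {Q Q' α : Type*} [Fintype Q'] (c : VisibleAlphabet α)
    (A : DROCA Q α) (B : DROCA Q' α) : Prop :=
  B.IsVOCA c ∧ B.Equivalent A ∧
    ∀ (n : ℕ) (B' : DROCA (Fin n) α), B'.IsVOCA c → B'.Equivalent A → Fintype.card Q' ≤ n

/-! ## A machine model with a step count

Programs compute on binary trees. Every elementary operation is charged one unit plus the size of
the tree that it is applied to, so running times agree with Turing machine times up to a
polynomial. -/

/-- Binary trees, the data of the machine model. -/
inductive Data
  | nil
  | cons (x y : Data)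

namespace Data

/-- The number of nodes. -/
def size : Data → ℕ
  | nil => 1
  | cons x y => x.size + y.size + 1

def hd : Data → Data
  | nil => nil
  | cons x _ => x

def tl : Data → Data
  | nil => nil
  | cons _ y => y

/-- Lists are nested to the right. -/
def ofList : List Data → Data
  | [] => nil
  | x :: l => cons x (ofList l)

/-- Natural numbers are written in unary. -/
def ofNat : ℕ → Data
  | 0 => nil
  | n + 1 => cons nil (ofNat n)

def ofBool : Bool → Data
  | false => ofNat 0
  | true => ofNat 1

def ofZeroAction : ZeroAction → Data
  | .stay => ofNat 0
  | .inc => ofNat 1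

def ofPosAction : PosAction → Data
  | .dec => ofNat 0
  | .stay => ofNat 1
  | .inc => ofNat 2

def ofWord {m : ℕ} (w : List (Fin m)) : Data :=
  ofList (w.map fun a => ofNat a)

/-- A visible alphabet is written as the list of the two counter-actions of each letter. -/
def ofAlphabet {m : ℕ} (c : VisibleAlphabet (Fin m)) : Data :=
  ofList (List.ofFn fun a => cons (ofZeroAction (c.zero a)) (ofPosAction (c.pos a)))

/-- An automaton is written as its initial state followed by, for each state, the bit that tells
whether it is final and the list of its transitions. -/
def ofDROCA {n m : ℕ} (A : DROCA (Fin n) (Fin m)) : Data :=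
  cons (ofNat A.init) (ofList (List.ofFn fun q => cons (ofBool (A.final q))
    (ofList (List.ofFn fun a => cons
      (cons (ofNat (A.δ₀ q a).1) (ofZeroAction (A.δ₀ q a).2))
      (cons (ofNat (A.δ₁ q a).1) (ofPosAction (A.δ₁ q a).2))))))

end Data

/-- Programs of the machine model: each one computes a partial function from trees to trees. -/
inductive Prog
  | nil
  | id
  | hd
  | tl
  | cons (p q : Prog)
  | comp (q p : Prog)
  | ite (c p q : Prog)
  | loop (p : Prog)

/-- `p.Runs x y t`: on input `x` the program `p` halts with output `y` in time `t`. The program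
`loop p` applies `p` as long as the head of the current tree is not `nil`. -/
inductive Prog.Runs : Prog → Data → Data → ℕ → Prop
  | nil (x : Data) : Runs .nil x .nil (x.size + 1)
  | id (x : Data) : Runs .id x x (x.size + 1)
  | hd (x : Data) : Runs .hd x x.hd (x.size + 1)
  | tl (x : Data) : Runs .tl x x.tl (x.size + 1)
  | cons {p q : Prog} {x y z : Data} {s t : ℕ} :
      Runs p x y s → Runs q x z t → Runs (.cons p q) x (.cons y z) (x.size + 1 + s + t)
  | comp {p q : Prog} {x y z : Data} {s t : ℕ} :
      Runs p x y s → Runs q y z t → Runs (.comp q p) x z (x.size + 1 + s + t)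
  | ite_true {c p q : Prog} {x b y : Data} {s t : ℕ} :
      Runs c x b s → b ≠ .nil → Runs p x y t → Runs (.ite c p q) x y (x.size + 1 + s + t)
  | ite_false {c p q : Prog} {x y : Data} {s t : ℕ} :
      Runs c x .nil s → Runs q x y t → Runs (.ite c p q) x y (x.size + 1 + s + t)
  | loop_done {p : Prog} {x : Data} :
      x.hd = .nil → Runs (.loop p) x x (x.size + 1)
  | loop_step {p : Prog} {x y z : Data} {s t : ℕ} :
      x.hd ≠ .nil → Runs p x y s → Runs (.loop p) y z t →
        Runs (.loop p) x z (x.size + 1 + s + t)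

/-! ## Learning with a teacher and a SAT solver -/

/-- A formula in conjunctive normal form with `n` variables: a list of clauses, each a list of
literals, where `(v, b)` is the literal that is true if the variable `v` has the value `b`. -/
abbrev CNFFormula (n : ℕ) := List (List (Fin n × Bool))

/-- The assignment `f` satisfies the formula `φ`. -/
def CNFFormula.SatisfiedBy {n : ℕ} (φ : CNFFormula n) (f : Fin n → Bool) : Prop :=
  ∀ C ∈ φ, ∃ l ∈ C, f l.1 = l.2

/-- What a learner over an alphabet of `m` letters may do next: ask the teacher a membership query
or a minimal synchronous-equivalence query, call the SAT solver, or halt with an automaton. -/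
inductive Request (m : ℕ)
  | membership (w : List (Fin m))
  | equivalence (n : ℕ) (C : DROCA (Fin n) (Fin m))
  | sat (n : ℕ) (φ : CNFFormula n)
  | halt (n : ℕ) (B : DROCA (Fin n) (Fin m))

/-- Requests as data. -/
def Request.toData {m : ℕ} : Request m → Data
  | membership w => .cons (.ofNat 0) (.ofWord w)
  | equivalence _ C => .cons (.ofNat 1) (.ofDROCA C)
  | sat n φ => .cons (.ofNat 2) (.cons (.ofNat n)
      (.ofList (φ.map fun C => .ofList (C.map fun l => .cons (.ofNat l.1) (.ofBool l.2)))))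
  | halt _ B => .cons (.ofNat 3) (.ofDROCA B)

open Classical in
/-- The answer to a membership query. -/
noncomputable def membershipAnswer {Q α : Type*} (A : DROCA Q α) (w : List α) : Data :=
  .ofBool (decide (w ∈ A.language))

/-- The possible answers to a minimal synchronous-equivalence query: *yes* if the automata are
counter-synchronised and equivalent, and any counterexample of minimal length otherwise. -/
inductive EquivalenceAnswer {Q : Type*} {n m : ℕ} (A : DROCA Q (Fin m))
    (C : DROCA (Fin n) (Fin m)) : Data → Prop
  | yes : C.CounterSynchronised A → C.Equivalent A → EquivalenceAnswer A C .nil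
  | no (z : List (Fin m)) : A.IsMinimalCounterexample C z →
      EquivalenceAnswer A C (.cons .nil (.ofWord z))

/-- The possible answers of the SAT solver: *unsatisfiable* if the formula has no satisfying
assignment, and any satisfying assignment, as the list of its values, otherwise. -/
inductive SatAnswer {n : ℕ} (φ : CNFFormula n) : Data → Prop
  | unsat : (∀ f, ¬ φ.SatisfiedBy f) → SatAnswer φ .nil
  | sat (f : Fin n → Bool) : φ.SatisfiedBy f →
      SatAnswer φ (.cons .nil (.ofList (List.ofFn fun v => .ofBool (f v))))

/-- The learner is a program `p` that works in rounds. In each round it is run on a tree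
`cons a s`, where `a` is the answer to its last request and `s` is the memory that it has kept, and
it must halt with a tree `cons r s'`, where `r` is its next request and `s'` its new memory.

`p.LearnsFrom c A x M E S T` says that from the tree `x` on, whatever correct answers are given, the
learner ends up halting with a minimal VOCA over `c` for the language of `A`, after at most `M`
membership queries, at most `E` minimal synchronous-equivalence queries and at most `S` calls of
the SAT solver, and its running time, summed over all rounds, is at most `T`. -/
inductive Prog.LearnsFrom (p : Prog) {Q : Type*} {m : ℕ} (c : VisibleAlphabet (Fin m))
    (A : DROCA Q (Fin m)) : Data → ℕ → ℕ → ℕ → ℕ → Prop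
  | halt {x s : Data} {n M E S T t : ℕ} (B : DROCA (Fin n) (Fin m)) :
      p.Runs x (.cons (Request.halt n B).toData s) t → t ≤ T →
      IsMinimalVOCAFor c A B →
      LearnsFrom p c A x M E S T
  | membership {x s : Data} {M E S T t : ℕ} (w : List (Fin m)) :
      p.Runs x (.cons (Request.membership w).toData s) t →
      LearnsFrom p c A (.cons (membershipAnswer A w) s) M E S T →
      LearnsFrom p c A x (M + 1) E S (t + T)
  | equivalence {x s : Data} {n M E S T t : ℕ} (C : DROCA (Fin n) (Fin m)) :
      p.Runs x (.cons (Request.equivalence n C).toData s) t →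
      (∀ a, EquivalenceAnswer A C a → LearnsFrom p c A (.cons a s) M E S T) →
      LearnsFrom p c A x M (E + 1) S (t + T)
  | sat {x s : Data} {n M E S T t : ℕ} (φ : CNFFormula n) :
      p.Runs x (.cons (Request.sat n φ).toData s) t →
      (∀ a, SatAnswer φ a → LearnsFrom p c A (.cons a s) M E S T) →
      LearnsFrom p c A x M E (S + 1) (t + T)

/-- The learner starts with empty memory and is told the visible alphabet only. -/
def Prog.Learns (p : Prog) {Q : Type*} {m : ℕ} (c : VisibleAlphabet (Fin m))
    (A : DROCA Q (Fin m)) (M E S T : ℕ) : Prop :=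
  p.LearnsFrom c A (.cons (.ofAlphabet c) .nil) M E S T

/-! ## Polynomially bounded functions -/

/-! The learner keeps a guess `k` that never exceeds the number of states of any VOCA for the
language, and it halts only with a `k`-state candidate that has passed an equivalence query. So the
answer is minimal for free, and all the work lies in bounding the number of iterations. Two VOCAs
over one visible alphabet are always counter-synchronised, hence a counterexample is simply a word
on which acceptance differs.

The main tool is `DROCA.height_le_of_minimal`: a shortest word that separates VOCAs with `q` and
`q'` states stays at or below the height `q² + q'²`. Cut such a word at each positive level up to
its peak, at the last visit before the peak and the first return after it. The middle part never
goes below its level, so it acts in the same way on lower levels. Pasting the middle part of a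
higher level into the outer parts of a lower one gives a shorter word, on which the automata agree.
The differences of acceptance thus form a triangular matrix with nonzero diagonal that factors
through the pairs of states at the two ends of the middle part, and its rank bounds the number of
levels. Two consequences are used. A minimal counterexample to a `k`-state candidate that exceeds `H
= 2k²` proves that no `k`-state VOCA recognises the language (`not_equivalent_of_high`), and minimal
counterexamples have polynomial length.

Up to the height `H` an observation table with representatives `R` and suffixes `S` describes the
language. Distinct representatives reach distinct configurations, so there are at most `|Q|(H + 1) =
O(|Q|³)` of them, whatever the alphabet (`Table.length_le`). The SAT solver supplies a `k`-state
automaton `C` that agrees with a known automaton `D` on words of length less than `l`, where `D` is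
right about the target there. The formula is polynomial because it speaks of jointly reachable
tuples (length, height, state of `C`, state of `D`) instead of words. The automaton `E` follows the
table until the height `H` is exceeded and answers as `C` does from then on.

Every iteration raises `k`, `|R|` or `l`. Unsatisfiability or a high counterexample to `C` raises
`k`. Otherwise `C` fails on a low word `z`, and `E` is asked. A low counterexample to `E` forces a
new representative once its suffixes are in `S`. A high one of length at most `l` is also a shortest
counterexample to `C` and raises `k`. In the remaining cases `E` is right up to the length `l`, so
that it replaces `D` and `l` grows. If `R` does not grow then, the table was right about `z` and `C`
was not, so by `exists_short_of_ne` they differ on some low word of length `O(|R| + k(H + 1))`;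
since `C` and `E` are both right below `l`, this bounds `l` (`Resumes.succ_l`). Hence `k + |R| + l`
is `O(|Q|³)`, and an iteration costs one solver call and at most two equivalence queries.

For the running time, the learner is written as ordinary functions; `PT` is closed under enough
constructions that `fun_prop` finds the programs, and `Inv` bounds the data that each round is run
on. -/

/-- `t` is bounded by a polynomial in `s`. -/
def PolyLE {ι : Type*} (s t : ι → ℕ) : Prop := ∃ k, ∀ i, t i ≤ (s i + 2) ^ k

namespace PolyLE

variable {ι κ : Type*} {s t u : ι → ℕ}

theorem mono (h : PolyLE s u) (hle : ∀ i, t i ≤ u i) : PolyLE s t := by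
  obtain ⟨k, hk⟩ := h
  exact ⟨k, fun i => (hle i).trans (hk i)⟩

theorem add (ht : PolyLE s t) (hu : PolyLE s u) : PolyLE s fun i => t i + u i := by
  obtain ⟨j, hj⟩ := ht
  obtain ⟨k, hk⟩ := hu
  refine ⟨j + k + 1, fun i => ?_⟩
  have h1 : (s i + 2) ^ j ≤ (s i + 2) ^ (j + k) := Nat.pow_le_pow_right (by omega) (by omega)
  have h2 : (s i + 2) ^ k ≤ (s i + 2) ^ (j + k) := Nat.pow_le_pow_right (by omega) (by omega)
  have h3 : (s i + 2) ^ (j + k) * 2 ≤ (s i + 2) ^ (j + k) * (s i + 2) :=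
    Nat.mul_le_mul_left _ (by omega)
  have h4 := hj i
  have h5 := hk i
  show t i + u i ≤ _
  rw [pow_succ]
  omega

theorem mul (ht : PolyLE s t) (hu : PolyLE s u) : PolyLE s fun i => t i * u i := by
  obtain ⟨j, hj⟩ := ht
  obtain ⟨k, hk⟩ := hu
  refine ⟨j + k, fun i => ?_⟩
  rw [pow_add]
  exact Nat.mul_le_mul (hj i) (hk i)

theorem const (c : ℕ) : PolyLE s fun _ => c := by
  refine ⟨c, fun i => ?_⟩
  calc c ≤ 2 ^ c := Nat.lt_two_pow_self.le
    _ ≤ (s i + 2) ^ c := Nat.pow_le_pow_left (by omega) _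

theorem self : PolyLE s s := ⟨1, fun i => by rw [pow_one]; omega⟩

theorem pow (ht : PolyLE s t) (c : ℕ) : PolyLE s fun i => t i ^ c := by
  obtain ⟨j, hj⟩ := ht
  refine ⟨j * c, fun i => ?_⟩
  rw [pow_mul]
  exact Nat.pow_le_pow_left (hj i) _

theorem comp {s' t' : κ → ℕ} {f : ι → κ} (ht : PolyLE s' t') (hs : PolyLE s fun i => s' (f i)) :
    PolyLE s fun i => t' (f i) := by
  obtain ⟨k, hk⟩ := ht
  exact mono (pow (add hs (const 2)) k) fun i => hk (f i)

end PolyLE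

/-! ## Encodings -/

/-- Types whose elements are written as trees. -/
class Enc (α : Type) where
  enc : α → Data

open Enc

instance : Enc Data := ⟨fun x => x⟩
instance : Enc ℕ := ⟨Data.ofNat⟩
instance : Enc Bool := ⟨Data.ofBool⟩
instance : Enc Unit := ⟨fun _ => .nil⟩
instance {α β : Type} [Enc α] [Enc β] : Enc (α × β) := ⟨fun x => .cons (enc x.1) (enc x.2)⟩
instance {α : Type} [Enc α] : Enc (List α) := ⟨fun l => .ofList (l.map enc)⟩
instance {α : Type} [Enc α] : Enc (Option α) :=
  ⟨fun x => x.elim .nil fun y => .cons .nil (enc y)⟩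

/-- The size of the encoding. -/
def sz {α : Type} [Enc α] (x : α) : ℕ := (enc x).size

section Sizes

variable {α β : Type} [Enc α] [Enc β]

theorem Data.size_pos (x : Data) : 0 < x.size := by
  cases x <;> simp [Data.size]

theorem sz_pos (x : α) : 0 < sz x := Data.size_pos _

@[simp] theorem enc_pair (x : α × β) : enc x = .cons (enc x.1) (enc x.2) := rfl
@[simp] theorem enc_list_cons (x : α) (l : List α) : enc (x :: l) = .cons (enc x) (enc l) := rfl
@[simp] theorem enc_succ (n : ℕ) : enc (n + 1) = .cons .nil (enc n) := rfl
@[simp] theorem enc_true : enc true = .cons .nil .nil := rfl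
@[simp] theorem enc_false : enc false = .nil := rfl

@[simp] theorem sz_pair (x : α) (y : β) : sz (x, y) = sz x + sz y + 1 := rfl
@[simp] theorem sz_nil : sz ([] : List α) = 1 := rfl
@[simp] theorem sz_cons (x : α) (l : List α) : sz (x :: l) = sz x + sz l + 1 := rfl
@[simp] theorem sz_none : sz (none : Option α) = 1 := rfl
@[simp] theorem sz_some (x : α) : sz (some x) = 1 + sz x + 1 := rfl

@[simp] theorem sz_nat (n : ℕ) : sz n = 2 * n + 1 := by
  induction n with
  | zero => rfl
  | succ n ih =>
    have : sz (n + 1) = 1 + sz n + 1 := rfl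
    omega

theorem sz_bool (b : Bool) : sz b ≤ 3 := by cases b <;> simp [sz, Data.size]

theorem sz_append (l l' : List α) : sz (l ++ l') + 1 = sz l + sz l' := by
  induction l with
  | nil => simp [Nat.add_comm]
  | cons x l ih => simp; omega

theorem sz_reverse (l : List α) : sz l.reverse = sz l := by
  induction l with
  | nil => rfl
  | cons x l ih =>
    have := sz_append l.reverse [x]
    rw [List.reverse_cons, sz_cons]
    rw [sz_cons, sz_nil] at this
    omega

theorem length_le_sz (l : List α) : l.length < sz l := by
  induction l with
  | nil => simp
  | cons x l ih => have := sz_pos x; simp; omega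

theorem sz_le_of_mem {l : List α} {x : α} (h : x ∈ l) : sz x < sz l := by
  induction l with
  | nil => simp at h
  | cons y l ih =>
    rcases List.mem_cons.1 h with rfl | h
    · rw [sz_cons]; omega
    · have := ih h; rw [sz_cons]; omega

theorem sz_le_of_forall {l : List α} {b : ℕ} (h : ∀ x ∈ l, sz x ≤ b) :
    sz l ≤ l.length * (b + 1) + 1 := by
  induction l with
  | nil => simp
  | cons y l ih =>
    have h1 := ih fun x hx => h x (List.mem_cons_of_mem _ hx)
    have h2 := h y List.mem_cons_self
    simp only [sz_cons, List.length_cons, Nat.add_mul]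
    omega

theorem sz_le_append_left (l l' : List α) : sz l ≤ sz (l ++ l') := by
  have := sz_append l l'; have := sz_pos l'; omega

theorem sz_le_append_right (l l' : List α) : sz l' ≤ sz (l ++ l') := by
  have := sz_append l l'; have := sz_pos l; omega

/-- Unary numbers are lists of units, so recursion on numbers is a case of recursion on lists. -/
theorem enc_replicate (n : ℕ) : enc (List.replicate n ()) = enc n := by
  induction n with
  | zero => rfl
  | succ n ih => rw [List.replicate_succ, enc_list_cons, enc_succ, ih]; rfl

end Sizes

/-! ## Functions computed in polynomial time -/

/-- Each operation is charged for the tree it is applied to. Because of this, a time bound is also a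
bound on the output, and polynomial time is closed under composition. -/
theorem Prog.Runs.size_le {p : Prog} {x y : Data} {t : ℕ} (h : p.Runs x y t) : y.size ≤ t := by
  induction h with
  | nil x => have := x.size_pos; simp [Data.size]
  | id x => omega
  | hd x => cases x <;> simp [Data.hd, Data.size]; omega
  | tl x => cases x <;> simp [Data.tl, Data.size]; omega
  | cons _ _ ih1 ih2 => simp only [Data.size]; have := Data.size_pos; omega
  | comp => omega
  | ite_true => omega
  | ite_false => omega
  | loop_done => omega
  | loop_step => omega

/-- `f` is computed by a program in polynomial time. -/
@[fun_prop]
def PT {α β : Type} [Enc α] [Enc β] (f : α → β) : Prop :=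
  ∃ p : Prog, ∃ b : α → ℕ, PolyLE sz b ∧ ∀ a, ∃ t ≤ b a, p.Runs (enc a) (enc (f a)) t

/-- The measure `b` is bounded by a polynomial in the size of the argument. -/
abbrev SizeLE {α : Type} [Enc α] (b : α → ℕ) : Prop := PolyLE sz b

namespace PT

variable {α β γ δ : Type} [Enc α] [Enc β] [Enc γ] [Enc δ]

theorem size {f : α → β} (hf : PT f) : SizeLE fun a => sz (f a) := by
  obtain ⟨p, b, hb, h⟩ := hf
  refine hb.mono fun a => ?_
  obtain ⟨t, ht, hr⟩ := h a
  exact hr.size_le.trans ht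

/-- Programs see encodings only, so a function can be exchanged for any other with the same effect
on trees. This is how structures, lists and numbers inherit results about pairs. -/
theorem congr_enc {f : α → β} {g : γ → δ} (e : γ → α) (hf : PT f) (h1 : ∀ c, enc (e c) = enc c)
    (h2 : ∀ c, enc (f (e c)) = enc (g c)) : PT g := by
  obtain ⟨p, b, hb, h⟩ := hf
  refine ⟨p, fun c => b (e c), hb.comp (PolyLE.self.mono fun c => ?_), fun c => ?_⟩
  · simp [sz, h1]
  · simpa [h1, h2] using h (e c)

@[fun_prop]
theorem id : PT fun x : α => x :=
  ⟨.id, fun a => sz a + 1, .add .self (.const 1), fun _ => ⟨_, le_rfl, .id _⟩⟩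

theorem nil_const : PT fun _ : α => Data.nil :=
  ⟨.nil, fun a => sz a + 1, .add .self (.const 1), fun _ => ⟨_, le_rfl, .nil _⟩⟩

@[fun_prop]
theorem comp {f : β → γ} {g : α → β} (hf : PT f) (hg : PT g) : PT fun x => f (g x) := by
  have hs := hg.size
  obtain ⟨p, b, hb, h⟩ := hf
  obtain ⟨p', b', hb', h'⟩ := hg
  refine ⟨.comp p p', fun a => sz a + 1 + b' a + b (g a),
    .add (.add (.add .self (.const 1)) hb') (hb.comp hs), fun a => ?_⟩
  obtain ⟨t', ht', hr'⟩ := h' a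
  obtain ⟨t, ht, hr⟩ := h (g a)
  exact ⟨_, by simp only [sz]; omega, .comp hr' hr⟩

@[fun_prop]
theorem pair {f : α → β} {g : α → γ} (hf : PT f) (hg : PT g) : PT fun x => (f x, g x) := by
  obtain ⟨p, b, hb, h⟩ := hf
  obtain ⟨p', b', hb', h'⟩ := hg
  refine ⟨.cons p p', fun a => sz a + 1 + b a + b' a,
    .add (.add (.add .self (.const 1)) hb) hb', fun a => ?_⟩
  obtain ⟨t', ht', hr'⟩ := h' a
  obtain ⟨t, ht, hr⟩ := h a
  exact ⟨_, by simp only [sz]; omega, .cons hr hr'⟩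

@[fun_prop]
theorem const (c : β) : PT fun _ : α => c := by
  have key : ∀ d : Data, PT fun _ : α => d := by
    intro d
    induction d with
    | nil => exact nil_const
    | cons x y hx hy => exact (pair hx hy).congr_enc (fun a => a) (fun _ => rfl) fun _ => rfl
  exact (key (enc c)).congr_enc (fun a => a) (fun _ => rfl) fun _ => rfl

theorem data_hd : PT Data.hd :=
  ⟨.hd, fun a => sz a + 1, .add .self (.const 1), fun _ => ⟨_, le_rfl, .hd _⟩⟩

theorem data_tl : PT Data.tl :=
  ⟨.tl, fun a => sz a + 1, .add .self (.const 1), fun _ => ⟨_, le_rfl, .tl _⟩⟩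

theorem fst' : PT fun x : α × β => x.1 :=
  data_hd.congr_enc (fun x : α × β => enc x) (fun _ => rfl) fun _ => rfl

theorem snd' : PT fun x : α × β => x.2 :=
  data_tl.congr_enc (fun x : α × β => enc x) (fun _ => rfl) fun _ => rfl

@[fun_prop]
theorem fst {f : α → β × γ} (hf : PT f) : PT fun x => (f x).1 := fst'.comp hf

@[fun_prop]
theorem snd {f : α → β × γ} (hf : PT f) : PT fun x => (f x).2 := snd'.comp hf

@[fun_prop]
theorem toData {f : α → β} (hf : PT f) : PT fun x => enc (f x) :=
  hf.congr_enc (fun a => a) (fun _ => rfl) fun _ => rfl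

/-- Case distinction on whether a tree is a leaf. -/
theorem casesOn {β' : Type} [Enc β'] {o : α → δ} {f h : α → γ} {g : α × β × β' → γ} (ho : PT o)
    (hf : PT f) (hg : PT g)
    (H : ∀ x, enc (o x) = .nil ∧ h x = f x ∨
      ∃ y y', enc (o x) = .cons (enc y) (enc y') ∧ h x = g (x, y, y')) : PT h := by
  have h1 : PT fun x => (enc x, (enc (o x)).hd, (enc (o x)).tl) :=
    .pair (.toData .id) (.pair (data_hd.comp ho.toData) (data_tl.comp ho.toData))
  obtain ⟨pl, bl, hbl, hl'⟩ := ho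
  obtain ⟨pf, bf, hbf, hf⟩ := hf
  obtain ⟨ph, bh, hbh, hh⟩ := h1
  obtain ⟨pg, bg, hbg, hg⟩ := hg
  obtain ⟨kg, hkg⟩ := hbg
  refine ⟨.ite pl (.comp pg ph) pf, fun a => sz a + 1 + bl a + (bf a +
      (bh a + 1 + bh a + (bh a + 2) ^ kg)),
    .add (.add (.add .self (.const 1)) hbl) (.add hbf (.add (.add (.add hbh (.const 1)) hbh)
      (.pow (.add hbh (.const 2)) _))), fun a => ?_⟩
  obtain ⟨tl, htl, hrl⟩ := hl' a
  obtain ⟨th, hth, hrh⟩ := hh a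
  rcases H a with ⟨h1, h2⟩ | ⟨y, y', h1, h2⟩
  · obtain ⟨t, ht, hr⟩ := hf a
    rw [h1] at hrl
    rw [h2]
    exact ⟨_, by simp only [sz]; omega, .ite_false hrl hr⟩
  · obtain ⟨t, ht, hr⟩ := hg (a, y, y')
    rw [h1] at hrl
    rw [h2]
    have he : enc (enc a, (enc (o a)).hd, (enc (o a)).tl) = enc (a, y, y') := by rw [h1]; rfl
    dsimp only at hrh
    rw [he] at hrh
    -- The argument of the branch is itself the output of a run, so the time `th` bounds its size.
    -- The components `y`, `y'` exist in this case only and cannot appear in the bound.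
    have hs : sz (a, y, y') ≤ th := hrh.size_le
    have hle : bg (a, y, y') ≤ (bh a + 2) ^ kg :=
      (hkg _).trans (Nat.pow_le_pow_left (by omega) _)
    have hsa : sz a ≤ th := by simp only [sz_pair] at hs; omega
    refine ⟨_, ?_, .ite_true hrl (by simp) (.comp hrh hr)⟩
    simp only [sz] at *
    omega

@[fun_prop]
theorem cond {c : α → Bool} {f g : α → β} (hc : PT c) (hf : PT f) (hg : PT g) :
    PT fun x => bif c x then f x else g x := by
  refine casesOn (β := Unit) (β' := Unit) (g := fun p => f p.1) hc hg (hf.comp fst') fun x => ?_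
  cases h : c x
  · exact .inl ⟨rfl, rfl⟩
  · exact .inr ⟨(), (), rfl, rfl⟩

theorem list_casesOn {l : α → List β} {f : α → γ} {g : α → β → List β → γ} (hl : PT l) (hf : PT f)
    (hg : PT fun p : α × β × List β => g p.1 p.2.1 p.2.2) :
    PT fun x => (match l x with | [] => f x | y :: ys => g x y ys : γ) := by
  refine casesOn hl hf hg fun x => ?_
  cases h : l x with
  | nil => exact .inl ⟨rfl, rfl⟩
  | cons y ys => exact .inr ⟨y, ys, rfl, rfl⟩

theorem option_casesOn {l : α → Option β} {f : α → γ} {g : α → β → γ} (hl : PT l) (hf : PT f)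
    (hg : PT fun p : α × β => g p.1 p.2) :
    PT fun x => (match l x with | none => f x | some y => g x y : γ) := by
  refine casesOn (β := Unit) (g := fun p => g p.1 p.2.2) hl hf
    (hg.comp (g := fun p : α × Unit × β => (p.1, p.2.2)) (by fun_prop)) fun x => ?_
  cases h : l x with
  | none => exact .inl ⟨rfl, rfl⟩
  | some y => exact .inr ⟨(), y, rfl, rfl⟩

theorem nat_casesOn {l : α → ℕ} {f : α → γ} {g : α → ℕ → γ} (hl : PT l) (hf : PT f)
    (hg : PT fun p : α × ℕ => g p.1 p.2) :
    PT fun x => (match l x with | 0 => f x | y + 1 => g x y : γ) := by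
  refine casesOn (β := Unit) (g := fun p => g p.1 p.2.2) hl hf
    (hg.comp (g := fun p : α × Unit × ℕ => (p.1, p.2.2)) (by fun_prop)) fun x => ?_
  cases h : l x with
  | zero => exact .inl ⟨rfl, rfl⟩
  | succ y => exact .inr ⟨(), y, rfl, rfl⟩

@[fun_prop]
theorem list_cons {f : α → β} {g : α → List β} (hf : PT f) (hg : PT g) : PT fun x => f x :: g x :=
  (pair hf hg).congr_enc (fun a => a) (fun _ => rfl) fun _ => rfl

@[fun_prop]
theorem some {f : α → β} (hf : PT f) : PT fun x => some (f x) :=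
  (pair (const Data.nil) hf).congr_enc (fun a => a) (fun _ => rfl) fun _ => rfl

@[fun_prop]
theorem succ {f : α → ℕ} (hf : PT f) : PT fun x => f x + 1 :=
  (pair (const Data.nil) hf).congr_enc (fun a => a) (fun _ => rfl) fun _ => rfl

end PT

/-! ### Recursion on lists in polynomial time. -/

namespace PT

variable {α β γ δ : Type} [Enc α] [Enc β] [Enc γ] [Enc δ]

/-- The machine loops over the remaining list, the parameter and the accumulator. The bound `B` on
all intermediate accumulators is essential, since iterating a polynomial-time step can produce
exponentially large data. -/
theorem list_foldl {l : α → List β} {i : α → γ} {g : α → γ → β → γ} {B : α → ℕ} (hl : PT l)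
    (hi : PT i) (hg : PT fun p : α × γ × β => g p.1 p.2.1 p.2.2) (hB : SizeLE B)
    (hle : ∀ x l', l' <+: l x → sz (l'.foldl (g x) (i x)) ≤ B x) :
    PT fun x => (l x).foldl (g x) (i x) := by
  have h1 : PT fun x => (l x, x, i x) := by fun_prop
  have h2 : PT fun s : (β × List β) × α × γ => (s.1.2, s.2.1, g s.2.1 s.2.2 s.1.1) :=
    .pair (by fun_prop) (.pair (by fun_prop)
      (hg.comp (g := fun s : (β × List β) × α × γ => (s.2.1, s.2.2, s.1.1)) (by fun_prop)))
  have h3 : PT fun s : List β × α × γ => s.2.2 := by fun_prop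
  have hls := hl.size
  obtain ⟨p1, b1, hb1, h1⟩ := h1
  obtain ⟨p2, b2, ⟨k2, hk2⟩, h2⟩ := h2
  obtain ⟨p3, b3, ⟨k3, hk3⟩, h3⟩ := h3
  let σ : α → ℕ := fun x => sz (l x) + (sz x + B x) + 4
  have hσ : SizeLE σ := .add (.add hls (.add .self hB)) (.const 4)
  let τ : α → ℕ := fun x => σ x + 1 + (σ x + 2) ^ k2
  have hτ : SizeLE τ := .add (.add hσ (.const 1)) (.pow (.add hσ (.const 2)) _)
  have key : ∀ x (l₁ l₂ : List β), l₁ ++ l₂ = l x → ∃ t ≤ (l₂.length + 1) * τ x,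
      (Prog.loop p2).Runs (enc (l₂, x, l₁.foldl (g x) (i x)))
        (enc (([] : List β), x, (l x).foldl (g x) (i x))) t := by
    intro x l₁ l₂
    induction l₂ generalizing l₁ with
    | nil =>
      intro h
      rw [List.append_nil] at h
      have hs := hle x l₁ (by rw [h])
      rw [← h]
      refine ⟨_, ?_, .loop_done rfl⟩
      have : (enc (([] : List β), x, l₁.foldl (g x) (i x))).size
        = 1 + (sz x + sz (l₁.foldl (g x) (i x)) + 1) + 1 := rfl
      simp only [List.length_nil, this]
      simp only [τ, σ]
      omega
    | cons y ys ih =>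
      intro h
      have hs := hle x l₁ ⟨_, h⟩
      obtain ⟨t, ht, hr⟩ := ih (l₁ ++ [y]) (by simpa using h)
      obtain ⟨s, hs2, hr2⟩ := h2 ((y, ys), x, l₁.foldl (g x) (i x))
      have h5 : sz ((y, ys), x, l₁.foldl (g x) (i x)) ≤ σ x := by
        have h6 : sz (y :: ys) ≤ sz (l x) := by rw [← h]; exact sz_le_append_right _ _
        simp only [sz_pair, σ, sz_cons] at *
        omega
      have h7 := hk2 ((y, ys), x, l₁.foldl (g x) (i x))
      have h8 : (sz ((y, ys), x, l₁.foldl (g x) (i x)) + 2) ^ k2 ≤ (σ x + 2) ^ k2 :=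
        Nat.pow_le_pow_left (by omega) _
      refine ⟨_, ?_, .loop_step (by simp [Data.hd]) hr2 (by simpa using hr)⟩
      have h9 : (enc (y :: ys, x, l₁.foldl (g x) (i x))).size
        = sz ((y, ys), x, l₁.foldl (g x) (i x)) := rfl
      rw [h9, List.length_cons, Nat.add_mul _ 1, Nat.one_mul]
      have : σ x + 1 + (σ x + 2) ^ k2 = τ x := rfl
      omega
  refine ⟨.comp p3 (.comp (.loop p2) p1), fun x => sz x + 1 + (sz x + 1 + b1 x +
    (sz (l x) + 1) * τ x) + (σ x + 2) ^ k3,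
    .add (.add (.add .self (.const 1)) (.add (.add (.add .self (.const 1)) hb1)
      (.mul (.add hls (.const 1)) hτ))) (.pow (.add hσ (.const 2)) _), fun x => ?_⟩
  obtain ⟨t1, ht1, hr1⟩ := h1 x
  obtain ⟨t2, ht2, hr2⟩ := key x [] (l x) rfl
  obtain ⟨t3, ht3, hr3⟩ := h3 (([] : List β), x, (l x).foldl (g x) (i x))
  refine ⟨_, ?_, .comp (.comp hr1 hr2) hr3⟩
  have h5 : sz (([] : List β), x, (l x).foldl (g x) (i x)) ≤ σ x := by
    have h6 := hle x (l x) (List.prefix_refl _)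
    simp only [sz_pair, σ, sz_nil] at *
    omega
  have h7 := hk3 (([] : List β), x, (l x).foldl (g x) (i x))
  have h8 : (sz (([] : List β), x, (l x).foldl (g x) (i x)) + 2) ^ k3 ≤ (σ x + 2) ^ k3 :=
    Nat.pow_le_pow_left (by omega) _
  have h9 : ((l x).length + 1) * τ x ≤ (sz (l x) + 1) * τ x :=
    Nat.mul_le_mul_right _ (by have := length_le_sz (l x); omega)
  have h10 : (enc x).size = sz x := rfl
  dsimp only
  omega

@[fun_prop]
theorem list_reverse {l : α → List β} (hl : PT l) : PT fun x => (l x).reverse := by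
  have key : ∀ (l acc : List β), l.foldl (fun a y => y :: a) acc = l.reverse ++ acc := by
    intro l
    induction l with
    | nil => simp
    | cons y l ih => intro acc; simp [ih]
  have := list_foldl (g := fun _ a y => y :: a) (B := fun x => sz (l x)) hl (const ([] : List β))
    (by fun_prop) hl.size (fun x l' h => by
      obtain ⟨l'', h⟩ := h
      rw [key, List.append_nil, sz_reverse, ← h]
      exact sz_le_append_left _ _)
  simpa [key] using this

theorem list_foldr {l : α → List β} {i : α → γ} {g : α → β → γ → γ} {B : α → ℕ} (hl : PT l)
    (hi : PT i) (hg : PT fun p : α × β × γ => g p.1 p.2.1 p.2.2) (hB : SizeLE B)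
    (hle : ∀ x l', l' <:+ l x → sz (l'.foldr (g x) (i x)) ≤ B x) :
    PT fun x => (l x).foldr (g x) (i x) := by
  have := list_foldl (l := fun x => (l x).reverse) (g := fun x a y => g x y a) (B := B)
    (by fun_prop) hi (hg.comp (g := fun p : α × γ × β => (p.1, p.2.2, p.2.1)) (by fun_prop)) hB
    (fun x l' h => by
      have := hle x l'.reverse (List.reverse_prefix.1 (by simpa using h))
      simpa using this)
  simpa using this

/-- Recursion on lists in which every step enlarges the result by a bounded amount. -/
theorem list_foldr_add {l : α → List β} {i : α → γ} {g : α → β → γ → γ} {B : α × β → ℕ} (hl : PT l)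
    (hi : PT i) (hg : PT fun p : α × β × γ => g p.1 p.2.1 p.2.2) (hB : SizeLE B)
    (hle : ∀ x y a, sz (g x y a) ≤ sz a + B (x, y)) :
    PT fun x => (l x).foldr (g x) (i x) := by
  obtain ⟨k, hk⟩ := hB
  refine list_foldr (B := fun x => sz (i x) + sz (l x) * (sz x + sz (l x) + 2) ^ k) hl hi hg
    (.add hi.size (.mul hl.size (.pow (.add (.add .self hl.size) (.const 2)) _))) ?_
  intro x l' h
  have key : ∀ l', l' <:+ l x → sz (l'.foldr (g x) (i x)) ≤
      sz (i x) + l'.length * (sz x + sz (l x) + 2) ^ k := by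
    intro l'
    induction l' with
    | nil => simp
    | cons y l' ih =>
      intro h
      have h1 := ih ((List.suffix_cons y l').trans h)
      have h2 := hle x y (l'.foldr (g x) (i x))
      have h3 := hk (x, y)
      have h4 : sz y < sz (l x) := sz_le_of_mem (h.subset List.mem_cons_self)
      have h5 : (sz (x, y) + 2) ^ k ≤ (sz x + sz (l x) + 2) ^ k :=
        Nat.pow_le_pow_left (by rw [sz_pair]; omega) _
      rw [List.length_cons, Nat.add_mul, List.foldr_cons]
      omega
  refine (key l' h).trans (Nat.add_le_add_left (Nat.mul_le_mul_right _ ?_) _)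
  have := length_le_sz (l x)
  have := h.length_le
  omega

theorem list_foldl_add {l : α → List β} {i : α → γ} {g : α → γ → β → γ} {B : α × β → ℕ} (hl : PT l)
    (hi : PT i) (hg : PT fun p : α × γ × β => g p.1 p.2.1 p.2.2) (hB : SizeLE B)
    (hle : ∀ x y a, sz (g x a y) ≤ sz a + B (x, y)) :
    PT fun x => (l x).foldl (g x) (i x) := by
  have := list_foldr_add (l := fun x => (l x).reverse) (g := fun x y a => g x a y) (B := B)
    (by fun_prop) hi (hg.comp (g := fun p : α × β × γ => (p.1, p.2.2, p.2.1)) (by fun_prop)) hB hle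
  simpa using this

/-! ### Booleans -/

@[fun_prop]
theorem not {f : α → Bool} (hf : PT f) : PT fun x => !f x :=
  (cond hf (const false) (const true)).congr_enc (fun a => a) (fun _ => rfl) fun x => by
    cases f x <;> rfl

@[fun_prop]
theorem and {f g : α → Bool} (hf : PT f) (hg : PT g) : PT fun x => f x && g x :=
  (cond hf hg (const false)).congr_enc (fun a => a) (fun _ => rfl) fun x => by cases f x <;> rfl

@[fun_prop]
theorem or {f g : α → Bool} (hf : PT f) (hg : PT g) : PT fun x => f x || g x :=
  (cond hf (const true) hg).congr_enc (fun a => a) (fun _ => rfl) fun x => by cases f x <;> rfl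

@[fun_prop]
theorem bool_beq {f g : α → Bool} (hf : PT f) (hg : PT g) : PT fun x => f x == g x :=
  (cond hf hg (not hg)).congr_enc (fun a => a) (fun _ => rfl) fun x => by
    cases f x <;> cases g x <;> rfl

@[fun_prop]
theorem ite {c : α → Prop} [DecidablePred c] {f g : α → β} (hc : PT fun x => decide (c x))
    (hf : PT f) (hg : PT g) : PT fun x => if c x then f x else g x :=
  (cond hc hf hg).congr_enc (fun a => a) (fun _ => rfl) fun x => by by_cases h : c x <;> simp [h]

/-! ### Lists -/

@[fun_prop]
theorem list_map {l : α → List β} {f : α → β → γ} (hl : PT l) (hf : PT fun p : α × β => f p.1 p.2) :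
    PT fun x => (l x).map (f x) := by
  have := list_foldr_add (g := fun x y a => f x y :: a) (B := fun p => sz (f p.1 p.2) + 1) hl
    (const ([] : List γ))
    (list_cons (hf.comp (g := fun p : α × β × List γ => (p.1, p.2.1)) (by fun_prop)) (by fun_prop))
    (.add hf.size (.const 1)) (fun x y a => by simp; omega)
  simpa only [← List.map_eq_foldr] using this

@[fun_prop]
theorem list_append {l l' : α → List β} (hl : PT l) (hl' : PT l') : PT fun x => l x ++ l' x := by
  have := list_foldr_add (g := fun _ y a => y :: a) (B := fun p : α × β => sz p) hl hl'
    (by fun_prop) .self (fun x y a => by simp; omega)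
  simpa using this

@[fun_prop]
theorem list_flatten {l : α → List (List β)} (hl : PT l) : PT fun x => (l x).flatten := by
  have := list_foldr_add (g := fun _ y a => y ++ a) (B := fun p : α × List β => sz p) hl
    (const ([] : List β)) (by fun_prop) .self (fun x y a => by
      have := sz_append y a
      simp; omega)
  refine this.congr_enc (fun a => a) (fun _ => rfl) fun x => ?_
  congr 1
  induction l x with
  | nil => rfl
  | cons y l ih => simp [ih]

@[fun_prop]
theorem list_flatMap {l : α → List β} {f : α → β → List γ} (hl : PT l)
    (hf : PT fun p : α × β => f p.1 p.2) : PT fun x => (l x).flatMap (f x) := by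
  simpa [List.flatMap_def] using list_flatten (list_map hl hf)

@[fun_prop]
theorem list_any {l : α → List β} {f : α → β → Bool} (hl : PT l)
    (hf : PT fun p : α × β => f p.1 p.2) : PT fun x => (l x).any (f x) := by
  have := list_foldr_add (g := fun x y a => f x y || a) (B := fun _ => 3) hl (const false)
    (or (hf.comp (g := fun p : α × β × Bool => (p.1, p.2.1)) (by fun_prop)) (by fun_prop))
    (.const 3) (fun x y a => by have := sz_bool (f x y || a); omega)
  refine this.congr_enc (fun a => a) (fun _ => rfl) fun x => ?_
  congr 1
  induction l x with
  | nil => rfl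
  | cons y l ih => simp [ih]

@[fun_prop]
theorem list_all {l : α → List β} {f : α → β → Bool} (hl : PT l)
    (hf : PT fun p : α × β => f p.1 p.2) : PT fun x => (l x).all (f x) := by
  simpa [List.all_eq_not_any_not] using not (list_any hl (f := fun x y => !f x y) (by fun_prop))

@[fun_prop]
theorem list_find? {l : α → List β} {f : α → β → Bool} (hl : PT l)
    (hf : PT fun p : α × β => f p.1 p.2) : PT fun x => (l x).find? (f x) := by
  have := list_foldr_add (g := fun x y a => bif f x y then Option.some y else a)
    (B := fun p : α × β => sz p + 1) hl (const (none : Option β))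
    (cond (hf.comp (g := fun p : α × β × Option β => (p.1, p.2.1)) (by fun_prop)) (by fun_prop)
      (by fun_prop)) (.add .self (.const 1)) (fun x y a => by
        have := sz_pos a
        cases f x y <;> simp; omega)
  refine this.congr_enc (fun a => a) (fun _ => rfl) fun x => ?_
  congr 1
  induction l x with
  | nil => rfl
  | cons y l ih => cases h : f x y <;> simp [ih, h]

@[fun_prop]
theorem list_findIdx {l : α → List β} {f : α → β → Bool} (hl : PT l)
    (hf : PT fun p : α × β => f p.1 p.2) : PT fun x => (l x).findIdx (f x) := by
  have := list_foldr_add (g := fun x y a => bif f x y then 0 else a + 1)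
    (B := fun _ => 2) hl (const 0)
    (cond (hf.comp (g := fun p : α × β × ℕ => (p.1, p.2.1)) (by fun_prop)) (by fun_prop)
      (by fun_prop)) (.const 2) (fun x y a => by
        cases f x y <;> simp; omega)
  refine this.congr_enc (fun a => a) (fun _ => rfl) fun x => ?_
  congr 1
  induction l x with
  | nil => rfl
  | cons y l ih => cases h : f x y <;> simp [List.findIdx_cons, ih, h]

@[fun_prop]
theorem list_length {l : α → List β} (hl : PT l) : PT fun x => (l x).length := by
  have := list_foldr_add (g := fun _ _ a => a + 1) (B := fun _ => 2) hl (const 0) (by fun_prop)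
    (.const 2) (fun x y a => by simp; omega)
  simpa using this

@[fun_prop]
theorem list_tail {l : α → List β} (hl : PT l) : PT fun x => (l x).tail :=
  (list_casesOn hl (const ([] : List β)) (g := fun _ _ ys => ys) (by fun_prop)).congr_enc
    (fun a => a) (fun _ => rfl) fun x => by cases l x <;> rfl

@[fun_prop]
theorem list_headD {l : α → List β} {d : α → β} (hl : PT l) (hd : PT d) :
    PT fun x => (l x).headD (d x) :=
  (list_casesOn hl hd (g := fun _ y _ => y) (by fun_prop)).congr_enc
    (fun a => a) (fun _ => rfl) fun x => by cases l x <;> rfl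

theorem replicate_unit {f : α → ℕ} (hf : PT f) : PT fun x => List.replicate (f x) () :=
  hf.congr_enc (fun a => a) (fun _ => rfl) fun _ => (enc_replicate _).symm

@[fun_prop]
theorem list_drop {f : α → ℕ} {l : α → List β} (hf : PT f) (hl : PT l) :
    PT fun x => (l x).drop (f x) := by
  have := list_foldr_add (g := fun _ _ a => a.tail) (B := fun _ => 0) (replicate_unit hf) hl
    (by fun_prop) (.const 0) (fun x y a => by cases a <;> simp; omega)
  refine this.congr_enc (fun a => a) (fun _ => rfl) fun x => ?_
  congr 1
  induction f x with
  | zero => simp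
  | succ n ih => simp [List.replicate_succ, ih]

@[fun_prop]
theorem list_getD {f : α → ℕ} {l : α → List β} {d : α → β} (hl : PT l) (hf : PT f) (hd : PT d) :
    PT fun x => (l x).getD (f x) (d x) :=
  (list_headD (list_drop hf hl) hd).congr_enc (fun a => a) (fun _ => rfl) fun x => by
    congr 1
    simp [List.headD_eq_head?_getD, List.getD_eq_getElem?_getD]

/-! ### Natural numbers -/

@[fun_prop]
theorem nat_add {f g : α → ℕ} (hf : PT f) (hg : PT g) : PT fun x => f x + g x := by
  have := list_foldr_add (g := fun _ _ a => a + 1) (B := fun _ => 2) (replicate_unit hg) hf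
    (by fun_prop) (.const 2) (fun x y a => by simp; omega)
  refine this.congr_enc (fun a => a) (fun _ => rfl) fun x => ?_
  congr 1
  induction g x with
  | zero => rfl
  | succ n ih => simp only [List.replicate_succ, List.foldr_cons, ih]; rfl

@[fun_prop]
theorem nat_mul {f g : α → ℕ} (hf : PT f) (hg : PT g) : PT fun x => f x * g x := by
  have := list_foldr_add (g := fun x _ a => a + f x) (B := fun p : α × Unit => sz (f p.1))
    (replicate_unit hg) (const 0) (by fun_prop) (PT.size (by fun_prop))
    (fun x y a => by simp; omega)
  refine this.congr_enc (fun a => a) (fun _ => rfl) fun x => ?_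
  congr 1
  induction g x with
  | zero => rfl
  | succ n ih => simp only [List.replicate_succ, List.foldr_cons, ih]; rfl

@[fun_prop]
theorem nat_pred {f : α → ℕ} (hf : PT f) : PT fun x => f x - 1 :=
  (nat_casesOn hf (const 0) (g := fun _ y => y) (by fun_prop)).congr_enc
    (fun a => a) (fun _ => rfl) fun x => by cases f x <;> rfl

@[fun_prop]
theorem nat_sub {f g : α → ℕ} (hf : PT f) (hg : PT g) : PT fun x => f x - g x := by
  have := list_foldr_add (g := fun _ _ a => a - 1) (B := fun _ => 0) (replicate_unit hg) hf
    (by fun_prop) (.const 0) (fun x y a => by simp)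
  refine this.congr_enc (fun a => a) (fun _ => rfl) fun x => ?_
  congr 1
  induction g x with
  | zero => rfl
  | succ n ih => simp only [List.replicate_succ, List.foldr_cons, ih]; omega

@[fun_prop]
theorem nat_eq_zero {f : α → ℕ} (hf : PT f) : PT fun x => decide (f x = 0) :=
  (nat_casesOn hf (const true) (g := fun _ _ => false) (by fun_prop)).congr_enc
    (fun a => a) (fun _ => rfl) fun x => by cases f x <;> rfl

@[fun_prop]
theorem nat_le {f g : α → ℕ} (hf : PT f) (hg : PT g) : PT fun x => decide (f x ≤ g x) :=
  (nat_eq_zero (nat_sub hf hg)).congr_enc (fun a => a) (fun _ => rfl) fun x => by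
    simp only [Nat.sub_eq_zero_iff_le]

@[fun_prop]
theorem nat_lt {f g : α → ℕ} (hf : PT f) (hg : PT g) : PT fun x => decide (f x < g x) :=
  nat_le (succ hf) hg

@[fun_prop]
theorem nat_beq {f g : α → ℕ} (hf : PT f) (hg : PT g) : PT fun x => f x == g x :=
  (and (nat_le hf hg) (nat_le hg hf)).congr_enc (fun a => a) (fun _ => rfl) fun x => by
    congr 1
    rw [Bool.eq_iff_iff]
    simp
    omega

@[fun_prop]
theorem nat_divMod {f g : α → ℕ} (hf : PT f) (hg : PT g) : PT fun x => (f x / g x, f x % g x) := by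
  have := list_foldr_add (g := fun x _ a => bif a.2 + 1 == g x then (a.1 + 1, 0) else (a.1, a.2 + 1))
    (B := fun _ => 2) (replicate_unit hf) (const (0, 0)) (by fun_prop)
    (.const 2) (fun x y a => by
      obtain ⟨a, b⟩ := a
      cases b + 1 == g x <;> simp <;> omega)
  refine this.congr_enc (fun a => a) (fun _ => rfl) fun x => ?_
  congr 1
  induction f x with
  | zero => simp
  | succ n ih =>
    simp only [List.replicate_succ, List.foldr_cons, ih]
    have h0 := Nat.div_add_mod n (g x)
    by_cases h : n % g x + 1 = g x
    · have h1 : n + 1 = 0 + g x * (n / g x + 1) := by rw [Nat.mul_add]; omega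
      have h2 : 0 < g x := by omega
      simp only [h, beq_self_eq_true, cond_true]
      rw [h1, Nat.add_mul_div_left _ _ h2, Nat.add_mul_mod_self_left]
      simp
    · simp only [beq_eq_false_iff_ne.2 h, cond_false]
      rcases Nat.eq_zero_or_pos (g x) with h2 | h2
      · simp [h2]
      · have h3 := Nat.mod_lt n h2
        have h1 : n + 1 = (n % g x + 1) + g x * (n / g x) := by omega
        conv_rhs => rw [h1]
        rw [Nat.add_mul_div_left _ _ h2, Nat.add_mul_mod_self_left,
          Nat.div_eq_of_lt (a := n % g x + 1) (by omega), Nat.mod_eq_of_lt (a := n % g x + 1) (by omega)]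
        simp

@[fun_prop]
theorem nat_div {f g : α → ℕ} (hf : PT f) (hg : PT g) : PT fun x => f x / g x :=
  fst (nat_divMod hf hg)

@[fun_prop]
theorem nat_mod {f g : α → ℕ} (hf : PT f) (hg : PT g) : PT fun x => f x % g x :=
  snd (nat_divMod hf hg)

@[fun_prop]
theorem list_range {f : α → ℕ} (hf : PT f) : PT fun x => List.range (f x) := by
  have key : ∀ n, (List.replicate n ()).foldr (fun _ a => a ++ [a.length]) [] = List.range n := by
    intro n
    induction n with
    | zero => rfl
    | succ n ih => rw [List.replicate_succ, List.foldr_cons, ih, List.range_succ, List.length_range]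
  have := list_foldr (g := fun _ _ a => a ++ [a.length]) (B := fun x => f x * (2 * f x + 2) + 1)
    (replicate_unit hf)
    (const ([] : List ℕ)) (by fun_prop)
    (by
      have h := hf.size.mono (t := f) fun x => by simp; omega
      exact .add (.mul h (.add (.mul (.const 2) h) (.const 2))) (.const 1))
    (fun x l' h => by
      have h1 := h.length_le
      rw [List.eq_replicate_of_mem (a := ()) (l := l') (fun _ _ => rfl), key]
      rw [List.length_replicate] at h1
      refine (sz_le_of_forall (b := 2 * f x + 1) fun y hy => ?_).trans ?_
      · have := List.mem_range.1 hy
        simp; omega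
      · rw [List.length_range]
        gcongr)
  simpa [key] using this

/-! ### Words -/

@[fun_prop]
theorem word_beq {f g : α → List ℕ} (hf : PT f) (hg : PT g) : PT fun x => f x == g x := by
  have h1 : PT fun x => (f x).length == (g x).length && (List.range (f x).length).all
      (fun i => (f x).getD i 0 == (g x).getD i 0) := by fun_prop
  refine h1.congr_enc (fun a => a) (fun _ => rfl) fun x => ?_
  congr 1
  rw [Bool.eq_iff_iff]
  simp only [Bool.and_eq_true, beq_iff_eq, List.all_eq_true, List.mem_range]
  constructor
  · rintro ⟨h1, h2⟩
    refine List.ext_getElem h1 fun i hi hi' => ?_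
    have := h2 i hi
    simpa [hi, hi'] using this
  · rintro h
    simp [h]

@[fun_prop]
theorem list_tails {l : α → List β} (hl : PT l) : PT fun x => (l x).tails := by
  have h1 : PT fun x => (List.range ((l x).length + 1)).map fun i => (l x).drop i := by fun_prop
  refine h1.congr_enc (fun a => a) (fun _ => rfl) fun x => ?_
  congr 1
  refine List.ext_getElem (by simp) fun i hi hi' => by simp

@[fun_prop]
theorem list_product {l : α → List β} {l' : α → List γ} (hl : PT l) (hl' : PT l') :
    PT fun x => (l x) ×ˢ (l' x) := by
  have h1 : PT fun x => (l x).flatMap fun a => (l' x).map fun b => (a, b) := by fun_prop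
  exact h1

@[fun_prop]
theorem option_isSome {o : α → Option β} (ho : PT o) : PT fun x => (o x).isSome :=
  (option_casesOn ho (const false) (g := fun _ _ => true) (by fun_prop)).congr_enc
    (fun a => a) (fun _ => rfl) fun x => by cases o x <;> rfl

end PT

/-! ## The learner -/

/-- Words, with letters written as numbers. -/
abbrev Word := List ℕ

/-- Visible alphabets, as they are written in data. -/
abbrev RawAlphabet := List (ℕ × ℕ)

/-- Automata, as they are written in data. -/
abbrev RawAut := ℕ × List (Bool × List ((ℕ × ℕ) × (ℕ × ℕ)))

namespace RawAut

def fin (C : RawAut) (q : ℕ) : Bool := (C.2.getD q (false, [])).1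

def trans (C : RawAut) (q a : ℕ) : (ℕ × ℕ) × (ℕ × ℕ) :=
  (C.2.getD q (false, [])).2.getD a ((0, 0), (0, 0))

/-- The successor state, at counter-value zero if `b = 0` and at positive ones otherwise. -/
def succ (C : RawAut) (b q a : ℕ) : ℕ := if b = 0 then (C.trans q a).1.1 else (C.trans q a).2.1

/-- The automaton over the alphabet `cs` with `n` states and the given functions. -/
def mk (cs : RawAlphabet) (n init : ℕ) (f : ℕ → Bool) (δ : ℕ → ℕ → ℕ → ℕ) : RawAut :=
  (init, (List.range n).map fun q => (f q, (List.range cs.length).map fun a =>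
    ((δ 0 q a, (cs.getD a (0, 1)).1), (δ 1 q a, (cs.getD a (0, 1)).2))))

end RawAut

namespace Learner

/-- The counter-value after a letter. -/
def up (cs : RawAlphabet) (h a : ℕ) : ℕ :=
  -- The codes 0, 1, 2 at positive values stand for dec, stay, inc, hence the shift by one. The
  -- default pair leaves the counter unchanged.
  if h = 0 then (cs.getD a (0, 1)).1 else h + (cs.getD a (0, 1)).2 - 1

def height (cs : RawAlphabet) (w : Word) : ℕ := w.foldl (up cs) 0

/-- Does a prefix of the word exceed the counter-value `H`? -/
def high (cs : RawAlphabet) (H : ℕ) (w : Word) : Bool :=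
  (w.foldl (fun s a => (up cs s.1 a, s.2 || decide (H < up cs s.1 a))) (0, false)).2

/-- A list of known memberships. -/
abbrev Facts := List (Word × Bool)

def look (F : Facts) (w : Word) : Bool := F.any fun e => e.1 == w && e.2

def known (F : Facts) (w : Word) : Bool := F.any fun e => e.1 == w

/-- Words of the same height that are not separated by a suffix in `S`. -/
def similar (cs : RawAlphabet) (S : List Word) (f : Word → Bool) (u v : Word) : Bool :=
  height cs u == height cs v && S.all fun s => f (u ++ s) == f (v ++ s)

def extensions (m : ℕ) (R : List Word) : List Word :=
  R.flatMap fun r => (List.range m).map fun a => r ++ [a]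

def required (m : ℕ) (R S : List Word) : List Word :=
  (R ++ extensions m R).flatMap fun u => S.map fun s => u ++ s

def missing (m : ℕ) (R S : List Word) (F : Facts) : Option Word :=
  (required m R S).find? fun w => !known F w

def unclosed (cs : RawAlphabet) (H : ℕ) (R S : List Word) (f : Word → Bool) : Option Word :=
  (extensions cs.length R).find? fun u =>
    decide (height cs u ≤ H) && !R.any fun r => similar cs S f u r

/-- The transition function of the table: the class of a word is the index of the first
representative that is similar to it; the index past the end is a sink. -/
def next (cs : RawAlphabet) (R S : List Word) (f : Word → Bool) (o a : ℕ) : ℕ :=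
  if o < R.length then R.findIdx fun r => similar cs S f (R.getD o [] ++ [a]) r else R.length

/-- The automaton that answers as the table does as long as this is in a class, and as `C` does
from then on. The state `k * o + q` stands for the class `o` and the state `q` of `C`. -/
def combine (cs : RawAlphabet) (k : ℕ) (C : RawAut) (R S : List Word) (f : Word → Bool) : RawAut :=
  RawAut.mk cs ((R.length + 1) * k) C.1
    (fun s => if s / k < R.length then f (R.getD (s / k) []) else C.fin (s % k))
    (fun b s a => k * next cs R S f (s / k) a + C.succ b (s % k) a)

/-- Numbers of propositional variables. -/
def var (B t x y z w : ℕ) : ℕ := (((t * B + x) * B + y) * B + z) * B + w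

/-- Exceeds every digit in use: letters, states of both automata, and lengths and heights, which go
up to `l`. -/
def radix (cs : RawAlphabet) (k l : ℕ) (D : RawAut) : ℕ := cs.length + k + l + D.2.length + 3

/-- There are four families of variables with up to four digits each. Families 0 and 1 are the
transitions at zero and at positive values, family 2 the final states, and family 3 the joint
reachability of a length, a height, a state of the unknown automaton and a state of `D`. -/
def numVars (B : ℕ) : ℕ := 4 * B * B * B * B

/-- Clauses that tell that there is an automaton with `k` states that agrees with `D` on all words
of length less than `l`. -/
def clauses (cs : RawAlphabet) (k l : ℕ) (D : RawAut) (B : ℕ) : List (List (ℕ × Bool)) :=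
  -- At least one successor is demanded, not exactly one: the other clauses hold for all chosen
  -- successors, so that any of them can be taken.
  ((List.range 2 ×ˢ List.range k ×ˢ List.range cs.length).map fun x =>
    (List.range k).map fun q => (var B x.1 x.2.1 x.2.2 q 0, true)) ++
  [[(var B 3 0 0 0 D.1, true)]] ++
  ((List.range l ×ˢ List.range l ×ˢ List.range k ×ˢ List.range D.2.length).map fun x =>
    [(var B 3 x.1 x.2.1 x.2.2.1 x.2.2.2, false), (var B 2 x.2.2.1 0 0 0, D.fin x.2.2.2)]) ++
  -- Joint reachability is closed under common transitions. Only this direction is forced, which is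
  -- all that soundness requires.
  ((List.range l ×ˢ List.range l ×ˢ List.range k ×ˢ List.range D.2.length ×ˢ
      List.range cs.length ×ˢ List.range k).map fun x =>
    [(var B 3 x.1 x.2.1 x.2.2.1 x.2.2.2.1, false),
      (var B (if x.2.1 = 0 then 0 else 1) x.2.2.1 x.2.2.2.2.1 x.2.2.2.2.2 0, false),
      (var B 3 (x.1 + 1) (up cs x.2.1 x.2.2.2.2.1) x.2.2.2.2.2
        (D.succ x.2.1 x.2.2.2.1 x.2.2.2.2.1), true)])

/-- The automaton that is described by an assignment. -/
def decode (cs : RawAlphabet) (k B : ℕ) (bits : List ℕ) : RawAut :=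
  RawAut.mk cs k 0 (fun q => bits.getD (var B 2 q 0 0 0) 0 == 1)
    (fun b q a => (List.range k).findIdx fun q' => bits.getD (var B b q a q' 0) 0 == 1)

/-- The memory of the learner. -/
structure Mem where
  -- The phase tells which answer is awaited: 0 for a membership query, 1 for the solver, 2 and 3
  -- for the equivalence queries about `C` and `E`. The automaton `D` is right on words of length
  -- less than `l`, and `w` is the word of the last membership query.
  phase : ℕ
  cs : RawAlphabet
  k : ℕ
  l : ℕ
  D : RawAut
  R : List Word
  S : List Word
  F : Facts
  C : RawAut
  E : RawAut
  w : Word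

/-! ### The reactions of the learner to the answers. -/

namespace Mem

def toTuple (M : Mem) : ℕ × RawAlphabet × ℕ × ℕ × RawAut × List Word × List Word × Facts × RawAut ×
    RawAut × Word :=
  (M.phase, M.cs, M.k, M.l, M.D, M.R, M.S, M.F, M.C, M.E, M.w)

instance : Enc Mem := ⟨fun M => enc M.toTuple⟩

/-- The bound on the counter-values that the table is concerned with. -/
def H (M : Mem) : ℕ := 2 * M.k * M.k

def B (M : Mem) : ℕ := radix M.cs M.k M.l M.D

/-- Call the SAT solver. -/
def solve (M : Mem) : Data :=
  enc ((2, numVars M.B, clauses M.cs M.k M.l M.D M.B), { M with phase := 1 })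

/-- Fill and close the table, then call the SAT solver. -/
def fill (M : Mem) : Data :=
  match missing M.cs.length M.R M.S M.F with
  | some w => enc ((0, w), { M with phase := 0, w := w })
  | none =>
    match unclosed M.cs M.H M.R M.S (look M.F) with
    | some u => enc ((0, ([] : Word)), { M with phase := 0, w := [], R := M.R ++ [u], F := [] })
    | none => M.solve

def onMembership (M : Mem) (ans : Option Word) : Data :=
  fill { M with F := (M.w, ans.isSome) :: M.F }

/-- The table has just been filled, so `look` is correct on all words that `combine` consults. `E`
is built now, before `S` changes. -/
def setC (M : Mem) (C : RawAut) : Mem :=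
  { M with phase := 2, C := C, E := combine M.cs M.k C M.R M.S (look M.F) }

def onSat (M : Mem) (ans : Option Word) : Data :=
  match ans with
  | none => fill { M with k := M.k + 1 }
  | some bits => enc ((1, decode M.cs M.k M.B bits), M.setC (decode M.cs M.k M.B bits))

/-- The suffixes of a low `z` enter `S` whatever the answer about `E` will be. Hence the next filled
table is right about `z`, which the bound on `l` relies on. -/
def onFirst (M : Mem) (ans : Option Word) : Data :=
  match ans with
  | none => enc ((3, M.C), M)
  | some z => bif high M.cs M.H z then fill { M with k := M.k + 1 }
    else enc ((1, M.E), { M with phase := 3, S := M.S ++ z.tails })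

/-- Even a correct `E` does not end the process, as it need not be minimal; it serves as the new
`D`. A shortest counterexample longer than `l` certifies that `E` is right up to the length `l`. -/
def onSecond (M : Mem) (ans : Option Word) : Data :=
  match ans with
  | none => fill { M with D := M.E, l := M.l + 1, F := [] }
  | some z => bif high M.cs M.H z then
      if z.length ≤ M.l then fill { M with k := M.k + 1, F := [] }
      else fill { M with D := M.E, l := M.l + 1, F := [] }
    else fill { M with S := M.S ++ z.tails, F := [] }

/-- One round of the learner. -/
def round (x : Option Word × Mem) : Data :=
  if x.2.phase = 0 then x.2.onMembership x.1
  else if x.2.phase = 1 then x.2.onSat x.1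
  else if x.2.phase = 2 then x.2.onFirst x.1
  else x.2.onSecond x.1

def trivialAut (cs : RawAlphabet) : RawAut :=
  RawAut.mk cs 1 0 (fun _ => false) (fun _ _ _ => 0)

def start (cs : RawAlphabet) : Mem where
  phase := 0
  cs := cs
  k := 1
  l := 0
  D := trivialAut cs
  R := [[]]
  S := [[]]
  F := []
  C := trivialAut cs
  E := trivialAut cs
  w := []

end Mem

end Learner

/-! ### The learner runs in polynomial time -/

section PolynomialTime

open Learner

variable {α : Type} [Enc α]

@[fun_prop]
theorem PT.raw_fin {C : α → RawAut} {q : α → ℕ} (hC : PT C) (hq : PT q) :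
    PT fun x => (C x).fin (q x) := by
  unfold RawAut.fin; fun_prop

@[fun_prop]
theorem PT.raw_succ {C : α → RawAut} {b q a : α → ℕ} (hC : PT C) (hb : PT b) (hq : PT q)
    (ha : PT a) : PT fun x => (C x).succ (b x) (q x) (a x) := by
  unfold RawAut.succ RawAut.trans; fun_prop

@[fun_prop]
theorem PT.raw_mk {cs : α → RawAlphabet} {n i : α → ℕ} {f : α → ℕ → Bool}
    {δ : α → ℕ → ℕ → ℕ → ℕ} (hcs : PT cs) (hn : PT n) (hi : PT i)
    (hf : PT fun p : α × ℕ => f p.1 p.2)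
    (hδ : PT fun p : α × ℕ × ℕ × ℕ => δ p.1 p.2.1 p.2.2.1 p.2.2.2) :
    PT fun x => RawAut.mk (cs x) (n x) (i x) (f x) (δ x) := by
  have h0 : PT fun p : (α × ℕ) × ℕ => δ p.1.1 0 p.1.2 p.2 :=
    hδ.comp (g := fun p : (α × ℕ) × ℕ => (p.1.1, 0, p.1.2, p.2)) (by fun_prop)
  have h1 : PT fun p : (α × ℕ) × ℕ => δ p.1.1 1 p.1.2 p.2 :=
    hδ.comp (g := fun p : (α × ℕ) × ℕ => (p.1.1, 1, p.1.2, p.2)) (by fun_prop)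
  unfold RawAut.mk; fun_prop

@[fun_prop]
theorem PT.up {cs : α → RawAlphabet} {h a : α → ℕ} (hcs : PT cs) (hh : PT h) (ha : PT a) :
    PT fun x => up (cs x) (h x) (a x) := by
  unfold Learner.up; fun_prop

/-- The growth does not depend on the counter-value, as `list_foldl_add` demands. It must cover
arbitrary raw data, not only the codes of actions. -/
theorem up_le (cs : RawAlphabet) (h a : ℕ) : up cs h a ≤ h + 2 * sz cs := by
  have key : (cs.getD a (0, 1)).1 ≤ sz cs ∧ (cs.getD a (0, 1)).2 ≤ sz cs := by
    rw [List.getD_eq_getElem?_getD]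
    cases h : cs[a]? with
    | none => have := sz_pos cs; simp; omega
    | some y =>
      have := sz_le_of_mem (List.mem_of_getElem? h)
      obtain ⟨y1, y2⟩ := y
      simp at *; omega
  unfold up; split_ifs <;> omega

@[fun_prop]
theorem PT.height {cs : α → RawAlphabet} {w : α → Word} (hcs : PT cs) (hw : PT w) :
    PT fun x => height (cs x) (w x) :=
  list_foldl_add (g := fun x => Learner.up (cs x)) (B := fun p => 4 * sz (cs p.1)) hw (const 0)
    (by fun_prop) (.mul (.const 4) (PT.size (by fun_prop))) fun x y a => by
      have := up_le (cs x) a y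
      simp only [sz_nat]; omega

@[fun_prop]
theorem PT.high {cs : α → RawAlphabet} {H : α → ℕ} {w : α → Word} (hcs : PT cs) (hH : PT H)
    (hw : PT w) : PT fun x => high (cs x) (H x) (w x) :=
  snd (list_foldl_add (g := fun x (s : ℕ × Bool) a =>
    (Learner.up (cs x) s.1 a, s.2 || decide (H x < Learner.up (cs x) s.1 a)))
    (B := fun p => 4 * sz (cs p.1) + 4) hw (const (0, false))
    (by fun_prop) (.add (.mul (.const 4) (PT.size (by fun_prop))) (.const 4)) fun x y a => by
      have := up_le (cs x) a.1 y
      obtain ⟨a, b⟩ := a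
      have := sz_bool (b || decide (H x < Learner.up (cs x) a y))
      simp only [sz_nat, sz_pair] at *; omega)

@[fun_prop]
theorem PT.look {F : α → Facts} {w : α → Word} (hF : PT F) (hw : PT w) :
    PT fun x => look (F x) (w x) := by
  unfold Learner.look; fun_prop

-- The membership function appears as `look` of a list of facts, since a program can take data but
-- not an arbitrary function as its argument.
@[fun_prop]
theorem PT.similar {cs : α → RawAlphabet} {S : α → List Word} {F : α → Facts} {u v : α → Word}
    (hcs : PT cs) (hS : PT S) (hF : PT F) (hu : PT u) (hv : PT v) :
    PT fun x => similar (cs x) (S x) (Learner.look (F x)) (u x) (v x) := by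
  unfold Learner.similar; fun_prop

@[fun_prop]
theorem PT.extensions {m : α → ℕ} {R : α → List Word} (hm : PT m) (hR : PT R) :
    PT fun x => extensions (m x) (R x) := by
  unfold Learner.extensions; fun_prop

@[fun_prop]
theorem PT.missing {m : α → ℕ} {R S : α → List Word} {F : α → Facts} (hm : PT m) (hR : PT R)
    (hS : PT S) (hF : PT F) : PT fun x => missing (m x) (R x) (S x) (F x) := by
  unfold Learner.missing required known; fun_prop

@[fun_prop]
theorem PT.unclosed {cs : α → RawAlphabet} {H : α → ℕ} {R S : α → List Word} {F : α → Facts}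
    (hcs : PT cs) (hH : PT H) (hR : PT R) (hS : PT S) (hF : PT F) :
    PT fun x => unclosed (cs x) (H x) (R x) (S x) (Learner.look (F x)) := by
  unfold Learner.unclosed; fun_prop

@[fun_prop]
theorem PT.next {cs : α → RawAlphabet} {R S : α → List Word} {F : α → Facts} {o a : α → ℕ}
    (hcs : PT cs) (hR : PT R) (hS : PT S) (hF : PT F) (ho : PT o) (ha : PT a) :
    PT fun x => next (cs x) (R x) (S x) (Learner.look (F x)) (o x) (a x) := by
  unfold Learner.next; fun_prop

@[fun_prop]
theorem PT.combine {cs : α → RawAlphabet} {k : α → ℕ} {C : α → RawAut} {R S : α → List Word}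
    {F : α → Facts} (hcs : PT cs) (hk : PT k) (hC : PT C) (hR : PT R) (hS : PT S) (hF : PT F) :
    PT fun x => combine (cs x) (k x) (C x) (R x) (S x) (Learner.look (F x)) := by
  unfold Learner.combine; fun_prop

@[fun_prop]
theorem PT.var {B t x y z w : α → ℕ} (hB : PT B) (ht : PT t) (hx : PT x) (hy : PT y) (hz : PT z)
    (hw : PT w) : PT fun a => var (B a) (t a) (x a) (y a) (z a) (w a) := by
  unfold Learner.var; fun_prop

@[fun_prop]
theorem PT.clauses {cs : α → RawAlphabet} {k l B : α → ℕ} {D : α → RawAut} (hcs : PT cs) (hk : PT k)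
    (hl : PT l) (hD : PT D) (hB : PT B) :
    PT fun x => clauses (cs x) (k x) (l x) (D x) (B x) := by
  unfold Learner.clauses
  refine list_append (list_append (list_append ?_ ?_) ?_) ?_ <;> fun_prop

@[fun_prop]
theorem PT.decode {cs : α → RawAlphabet} {k B : α → ℕ} {bits : α → List ℕ} (hcs : PT cs)
    (hk : PT k) (hB : PT B) (hbits : PT bits) :
    PT fun x => decode (cs x) (k x) (B x) (bits x) := by
  unfold Learner.decode; fun_prop

theorem PT.mem_toTuple : PT Mem.toTuple :=
  PT.id.congr_enc (fun M : Mem => enc M) (fun _ => rfl) fun _ => rfl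

/-! ### The operations on the memory take polynomial time. -/

variable {M : α → Mem}

@[fun_prop]
theorem PT.mem_phase (hM : PT M) : PT fun x => (M x).phase := (mem_toTuple.comp hM).fst
@[fun_prop]
theorem PT.mem_cs (hM : PT M) : PT fun x => (M x).cs := (mem_toTuple.comp hM).snd.fst
@[fun_prop]
theorem PT.mem_k (hM : PT M) : PT fun x => (M x).k := (mem_toTuple.comp hM).snd.snd.fst
@[fun_prop]
theorem PT.mem_l (hM : PT M) : PT fun x => (M x).l := (mem_toTuple.comp hM).snd.snd.snd.fst
@[fun_prop]
theorem PT.mem_D (hM : PT M) : PT fun x => (M x).D := (mem_toTuple.comp hM).snd.snd.snd.snd.fst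
@[fun_prop]
theorem PT.mem_R (hM : PT M) : PT fun x => (M x).R :=
  (mem_toTuple.comp hM).snd.snd.snd.snd.snd.fst
@[fun_prop]
theorem PT.mem_S (hM : PT M) : PT fun x => (M x).S :=
  (mem_toTuple.comp hM).snd.snd.snd.snd.snd.snd.fst
@[fun_prop]
theorem PT.mem_F (hM : PT M) : PT fun x => (M x).F :=
  (mem_toTuple.comp hM).snd.snd.snd.snd.snd.snd.snd.fst
@[fun_prop]
theorem PT.mem_C (hM : PT M) : PT fun x => (M x).C :=
  (mem_toTuple.comp hM).snd.snd.snd.snd.snd.snd.snd.snd.fst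
@[fun_prop]
theorem PT.mem_E (hM : PT M) : PT fun x => (M x).E :=
  (mem_toTuple.comp hM).snd.snd.snd.snd.snd.snd.snd.snd.snd.fst
@[fun_prop]
theorem PT.mem_w (hM : PT M) : PT fun x => (M x).w :=
  (mem_toTuple.comp hM).snd.snd.snd.snd.snd.snd.snd.snd.snd.snd

@[fun_prop]
theorem PT.mem_mk {p k l : α → ℕ} {cs : α → RawAlphabet} {D C E : α → RawAut} {R S : α → List Word}
    {F : α → Facts} {w : α → Word} (hp : PT p) (hcs : PT cs) (hk : PT k) (hl : PT l) (hD : PT D)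
    (hR : PT R) (hS : PT S) (hF : PT F) (hC : PT C) (hE : PT E) (hw : PT w) :
    PT fun x => Mem.mk (p x) (cs x) (k x) (l x) (D x) (R x) (S x) (F x) (C x) (E x) (w x) :=
  (pair hp (pair hcs (pair hk (pair hl (pair hD (pair hR (pair hS (pair hF (pair hC
    (pair hE hw)))))))))).congr_enc (fun a => a) (fun _ => rfl) fun _ => rfl

@[fun_prop]
theorem PT.mem_H (hM : PT M) : PT fun x => (M x).H := by
  unfold Mem.H; fun_prop

@[fun_prop]
theorem PT.mem_B (hM : PT M) : PT fun x => (M x).B := by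
  unfold Mem.B radix; fun_prop

@[fun_prop]
theorem PT.mem_solve (hM : PT M) : PT fun x => (M x).solve := by
  unfold Mem.solve numVars; fun_prop

@[fun_prop]
theorem PT.mem_fill (hM : PT M) : PT fun x => (M x).fill := by
  have h := option_casesOn
    (l := fun x => Learner.missing (M x).cs.length (M x).R (M x).S (M x).F)
    (g := fun x w => enc ((0, w), { M x with phase := 0, w := w })) (by fun_prop)
    (option_casesOn
      (l := fun x => Learner.unclosed (M x).cs (M x).H (M x).R (M x).S (Learner.look (M x).F))
      (f := fun x => (M x).solve) (g := fun x u => enc ((0, ([] : Word)),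
        { M x with phase := 0, w := [], R := (M x).R ++ [u], F := [] }))
      (by fun_prop) (by fun_prop) (by fun_prop)) (by fun_prop)
  refine h.congr_enc (fun a => a) (fun _ => rfl) fun x => ?_
  unfold Mem.fill
  cases Learner.missing (M x).cs.length (M x).R (M x).S (M x).F
  · cases Learner.unclosed (M x).cs (M x).H (M x).R (M x).S (Learner.look (M x).F) <;> rfl
  · rfl

variable {a : α → Option Word}

@[fun_prop]
theorem PT.mem_onMembership (hM : PT M) (ha : PT a) : PT fun x => (M x).onMembership (a x) := by
  unfold Mem.onMembership; fun_prop

@[fun_prop]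
theorem PT.mem_setC {C : α → RawAut} (hM : PT M) (hC : PT C) : PT fun x => (M x).setC (C x) := by
  unfold Mem.setC; fun_prop

@[fun_prop]
theorem PT.mem_onSat (hM : PT M) (ha : PT a) : PT fun x => (M x).onSat (a x) := by
  have h := option_casesOn (f := fun x => Mem.fill { M x with k := (M x).k + 1 })
    (g := fun x bits => enc ((1, Learner.decode (M x).cs (M x).k (M x).B bits),
    (M x).setC (Learner.decode (M x).cs (M x).k (M x).B bits))) ha (by fun_prop) (by fun_prop)
  refine h.congr_enc (fun a => a) (fun _ => rfl) fun x => ?_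
  unfold Mem.onSat
  cases a x <;> rfl

@[fun_prop]
theorem PT.mem_onFirst (hM : PT M) (ha : PT a) : PT fun x => (M x).onFirst (a x) := by
  have h := option_casesOn (f := fun x => enc ((3, (M x).C), M x))
    (g := fun x z => bif Learner.high (M x).cs (M x).H z then Mem.fill { M x with k := (M x).k + 1 }
    else enc ((1, (M x).E), { M x with phase := 3, S := (M x).S ++ z.tails })) ha
    (by fun_prop) (by fun_prop)
  refine h.congr_enc (fun a => a) (fun _ => rfl) fun x => ?_
  unfold Mem.onFirst
  cases a x <;> rfl

@[fun_prop]
theorem PT.mem_onSecond (hM : PT M) (ha : PT a) : PT fun x => (M x).onSecond (a x) := by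
  have h := option_casesOn (f := fun x => Mem.fill { M x with D := (M x).E, l := (M x).l + 1, F := [] })
    (g := fun x z => bif Learner.high (M x).cs (M x).H z then
      if z.length ≤ (M x).l then Mem.fill { M x with k := (M x).k + 1, F := [] }
      else Mem.fill { M x with D := (M x).E, l := (M x).l + 1, F := [] }
    else Mem.fill { M x with S := (M x).S ++ z.tails, F := [] }) ha (by fun_prop) (by fun_prop)
  refine h.congr_enc (fun a => a) (fun _ => rfl) fun x => ?_
  unfold Mem.onSecond
  cases a x <;> rfl

theorem PT.round : PT Mem.round := by
  unfold Mem.round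
  have h (n : ℕ) : PT fun x : Option Word × Mem => decide (x.2.phase = n) := by
    have : PT fun x : Option Word × Mem => x.2.phase == n := by fun_prop
    exact this
  have h0 := h 0
  have h1 := h 1
  have h2 := h 2
  exact ite h0 (by fun_prop) (ite h1 (by fun_prop) (ite h2 (by fun_prop) (by fun_prop)))

theorem PT.start : PT fun cs => (Mem.start cs).fill := by
  unfold Mem.start Mem.trivialAut; fun_prop

/-- The learner as a program. -/
theorem exists_learner : ∃ (p : Prog) (j : ℕ),
    (∀ cs : RawAlphabet, ∃ t ≤ (sz cs + 2) ^ j,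
      p.Runs (.cons (enc cs) .nil) (Mem.start cs).fill t) ∧
    ∀ (a : Option Word) (M : Mem), ∃ t ≤ (sz (a, M) + 2) ^ j,
      p.Runs (.cons (enc a) (enc M)) (Mem.round (a, M)) t := by
  obtain ⟨p₁, b₁, ⟨j₁, hj₁⟩, h₁⟩ := PT.start
  obtain ⟨p₂, b₂, ⟨j₂, hj₂⟩, h₂⟩ := PT.round
  -- The memory is a leaf in the very first round only, because an encoded `Mem` is a pair; the tail
  -- of the input therefore tells the two programs apart. The extra power 6 absorbs the linear
  -- overhead of the case distinction.
  refine ⟨.ite .tl p₂ (.comp p₁ .hd), j₁ + j₂ + 6, fun cs => ?_, fun a M => ?_⟩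
  · obtain ⟨t, ht, hr⟩ := h₁ cs
    refine ⟨_, ?_, .ite_false (.tl _) (.comp (.hd _) hr)⟩
    have h := ht.trans (hj₁ cs)
    have hs : (Data.cons (enc cs) .nil).size = sz cs + 2 := rfl
    rw [hs]
    set n := sz cs + 2 with hn
    have h3 : n ^ j₁ ≤ n ^ (j₁ + j₂) := Nat.pow_le_pow_right (by omega) (by omega)
    have h4 : 1 ≤ n ^ (j₁ + j₂) := Nat.one_le_pow _ _ (by omega)
    have h5 : 3 ≤ n := by have := sz_pos cs; omega
    have h6 : n * 1 ≤ n * n ^ (j₁ + j₂) := Nat.mul_le_mul_left _ h4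
    have h7 : n ^ (j₁ + j₂) * n ^ 6 ≥ n ^ (j₁ + j₂) * (n * 3 ^ 5) := by
      rw [pow_succ' n 5]
      gcongr
    rw [pow_add _ _ 6]
    nlinarith
  · obtain ⟨t, ht, hr⟩ := h₂ (a, M)
    refine ⟨_, ?_, .ite_true (.tl _) (by simp [Data.tl, Enc.enc, Mem.toTuple]) hr⟩
    have h := ht.trans (hj₂ (a, M))
    have hs : (Data.cons (enc a) (enc M)).size = sz (a, M) := rfl
    rw [hs]
    set n := sz (a, M) + 2 with hn
    have h3 : n ^ j₂ ≤ n ^ (j₁ + j₂) := Nat.pow_le_pow_right (by omega) (by omega)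
    have h4 : 1 ≤ n ^ (j₁ + j₂) := Nat.one_le_pow _ _ (by omega)
    have h5 : 3 ≤ n := by have := sz_pos (a, M); omega
    have h6 : n * 1 ≤ n * n ^ (j₁ + j₂) := Nat.mul_le_mul_left _ h4
    have h7 : n ^ (j₁ + j₂) * n ^ 6 ≥ n ^ (j₁ + j₂) * (n * 3 ^ 5) := by
      rw [pow_succ' n 5]
      gcongr
    rw [pow_add _ _ 6]
    nlinarith

end PolynomialTime

/-! ## Shortest words that separate two automata -/

/-- The matrix of these sums is triangular with nonzero diagonal, hence of rank `n`, and it factors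
through the space of functions on `ι`. Both bounds on shortest separating words come from here. -/
theorem card_le_of_triangular {ι : Type*} [Fintype ι] {n : ℕ} (φ : Fin n → ι → ℚ)
    (v : Fin n → ι → ℚ) (h : ∀ i, ∑ s, φ i s * v i s ≠ 0)
    (h' : ∀ i j, j < i → ∑ s, φ i s * v j s = 0) : n ≤ Fintype.card ι := by
  let P : Matrix (Fin n) (Fin n) ℚ := Matrix.of φ * (Matrix.of v).transpose
  have hP : P.BlockTriangular id := fun i j hij => h' i j hij
  have hdet : P.det ≠ 0 := by
    rw [Matrix.det_of_isUpperTriangular hP, Finset.prod_ne_zero_iff]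
    exact fun i _ => h i
  have h1 : P.rank = n := by
    rw [Matrix.rank_of_isUnit P ((Matrix.isUnit_iff_isUnit_det P).2 hdet.isUnit), Fintype.card_fin]
  rw [← h1]
  exact (Matrix.rank_mul_le_left _ _).trans (Matrix.rank_le_card_width _)

/-- Two finite automata that are not equivalent are separated by a short word. -/
theorem exists_short_separating {α X Y : Type*} [Fintype X] [Fintype Y] (f : X → α → X)
    (g : Y → α → Y) (oX : X → Bool) (oY : Y → Bool) (x : X) (y : Y)
    (h : ∃ w : List α, oX (w.foldl f x) ≠ oY (w.foldl g y)) :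
    ∃ w : List α, w.length < Fintype.card X + Fintype.card Y ∧
      oX (w.foldl f x) ≠ oY (w.foldl g y) := by
  classical
  obtain ⟨w, hw, hmin⟩ := exists_minimalFor_of_wellFoundedLT
    (fun w : List α => oX (w.foldl f x) ≠ oY (w.foldl g y)) List.length h
  refine ⟨w, ?_, hw⟩
  have hmin' : ∀ w' : List α, w'.length < w.length → oX (w'.foldl f x) = oY (w'.foldl g y) := by
    intro w' hw'
    by_contra hne
    have := hmin hne hw'.le
    omega
  let b : Bool → ℚ := fun t => if t then 1 else 0
  have hb : Function.Injective b := by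
    intro s t; cases s <;> cases t <;> simp [b]
  have key : ∀ i j : Fin (w.length + 1),
      ∑ s : X ⊕ Y, (Sum.elim (fun s => b (oX ((w.drop i).foldl f s)))
        (fun s => b (oY ((w.drop i).foldl g s))) s) *
        (Sum.elim (Pi.single ((w.take j).foldl f x) 1)
          (-Pi.single ((w.take j).foldl g y) 1) s : ℚ) =
      b (oX ((w.take j ++ w.drop i).foldl f x)) - b (oY ((w.take j ++ w.drop i).foldl g y)) := by
    intro i j
    rw [Fintype.sum_sum_type]
    simp [Pi.single_apply, sub_eq_add_neg]
  -- For `j < i` the entry compares the automata on `w` without the letters from position `j` to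
  -- `i`. That word is shorter, so the entry vanishes; the diagonal entries all compare them on `w`
  -- itself.
  have := card_le_of_triangular (n := w.length + 1) (ι := X ⊕ Y)
    (fun i => Sum.elim (fun s => b (oX ((w.drop i).foldl f s)))
      (fun s => b (oY ((w.drop i).foldl g s))))
    (fun j => Sum.elim (Pi.single ((w.take j).foldl f x) 1) (-Pi.single ((w.take j).foldl g y) 1))
    (fun i => by
      rw [key, List.take_append_drop]
      exact sub_ne_zero.2 fun h => hw (hb h))
    (fun i j hij => by
      rw [key, hmin', sub_self]
      have h1 := i.2
      have h2 : (j : ℕ) < i := hij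
      simp only [List.length_append, List.length_take, List.length_drop]
      omega)
  rw [Fintype.card_sum] at this
  omega

/-! ### Visibly one-counter automata -/

namespace VisibleAlphabet

variable {α : Type*} (c : VisibleAlphabet α)

/-- The counter-value after a letter. -/
def next : ℕ → α → ℕ
  | 0, a => (c.zero a).result
  | n + 1, a => (c.pos a).result n

/-- The counter-value after a word. -/
def height (h : ℕ) (w : List α) : ℕ := w.foldl c.next h

theorem height_append (h : ℕ) (u v : List α) :
    c.height h (u ++ v) = c.height (c.height h u) v := List.foldl_append ..

theorem next_le (h : ℕ) (a : α) : c.next h a ≤ h + 1 := by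
  cases h with
  | zero => cases hc : c.zero a <;> simp [next, hc, ZeroAction.result]
  | succ n => cases hc : c.pos a <;> simp [next, hc, PosAction.result]; omega

theorem le_next (h : ℕ) (a : α) : h ≤ c.next h a + 1 := by
  cases h with
  | zero => simp
  | succ n => cases hc : c.pos a <;> simp [next, hc, PosAction.result]

theorem height_le (h : ℕ) (w : List α) : c.height h w ≤ h + w.length := by
  induction w generalizing h with
  | nil => simp [height]
  | cons a w ih =>
    have h1 := ih (c.next h a)
    have h2 := c.next_le h a
    have h3 : c.height h (a :: w) = c.height (c.next h a) w := rfl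
    simp only [List.length_cons]
    omega

/-- The last time that a run is at the height `h`. -/
theorem exists_last (h : ℕ) {e : ℕ} (he : e ≤ h) (t : List α) (ht : h ≤ c.height e t) :
    ∃ u r, t = u ++ r ∧ c.height e u = h ∧ (∀ p, p <+: r → h ≤ c.height h p) ∧
      ∀ u', u' <+: t → c.height e u' ≤ h → u'.length ≤ u.length := by
  induction t using List.reverseRecOn with
  | nil =>
    have : e = h := le_antisymm he ht
    subst this
    refine ⟨[], [], rfl, rfl, ?_, ?_⟩
    · rintro p hp
      rw [List.prefix_nil.1 hp]; rfl
    · rintro u' hu' -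
      rw [List.prefix_nil.1 hu']
  | append_singleton t a ih =>
    rcases ht.eq_or_lt with ht | ht
    · refine ⟨t ++ [a], [], by simp, ht.symm, ?_, ?_⟩
      · rintro p hp
        rw [List.prefix_nil.1 hp]; rfl
      · exact fun u' hu' _ => hu'.length_le
    · have h1 : c.height e (t ++ [a]) = c.next (c.height e t) a := by rw [height_append]; rfl
      have h2 := c.next_le (c.height e t) a
      obtain ⟨u, r, rfl, hu, hr, hl⟩ := ih (by omega)
      refine ⟨u, r ++ [a], by simp, hu, ?_, ?_⟩
      · intro p hp
        rcases List.prefix_concat_iff.1 hp with rfl | hp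
        · have : c.height h (r ++ [a]) = c.height e (u ++ r ++ [a]) := by
            rw [List.append_assoc, height_append _ _ u, hu]
          omega
        · exact hr p hp
      · intro u' hu' hle
        rcases List.prefix_concat_iff.1 hu' with rfl | hu'
        · omega
        · exact hl u' hu' hle

/-- The first time that a run is back at the height `h`, if there is any. -/
theorem exists_first (h : ℕ) {e : ℕ} (he : h ≤ e) (s : List α) :
    ∃ d v, s = d ++ v ∧ (∀ p, p <+: d → h ≤ c.height e p) ∧ (c.height e d = h ∨ v = []) ∧
      ∀ u, u <+: s → c.height e u ≤ h → d.length ≤ u.length := by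
  induction s generalizing e with
  | nil =>
    refine ⟨[], [], rfl, ?_, .inr rfl, fun _ _ _ => by simp⟩
    rintro p hp
    rw [List.prefix_nil.1 hp]; exact he
  | cons a s ih =>
    rcases he.eq_or_lt with rfl | he
    · refine ⟨[], a :: s, rfl, ?_, .inl rfl, fun _ _ _ => by simp⟩
      rintro p hp
      rw [List.prefix_nil.1 hp]; exact le_rfl
    · have h1 := c.le_next e a
      obtain ⟨d, v, rfl, hd, hv, hl⟩ := ih (e := c.next e a) (by omega)
      refine ⟨a :: d, v, rfl, ?_, hv, ?_⟩
      · intro p hp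
        rcases List.prefix_cons_iff.1 hp with rfl | ⟨p, rfl, hp'⟩
        · exact he.le
        · exact hd p hp'
      · intro u hu hle
        rcases List.prefix_cons_iff.1 hu with rfl | ⟨u, rfl, hu'⟩
        · have : c.height e [] = e := rfl
          omega
        · simpa using hl u hu' hle

end VisibleAlphabet

namespace DROCA

variable {Q Q' : Type} {α : Type*} {c : VisibleAlphabet α} {A : DROCA Q α} {C : DROCA Q' α}

/-- Is the word accepted? -/
def out (A : DROCA Q α) (w : List α) : Bool := A.final (A.run w).1

theorem mem_language {w : List α} : w ∈ A.language ↔ A.out w = true := Iff.rfl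

theorem run_append (u v : List α) : A.run (u ++ v) = v.foldl A.step (A.run u) :=
  List.foldl_append ..

theorem IsVOCA.step_snd (hA : A.IsVOCA c) (s : Q × ℕ) (a : α) :
    (A.step s a).2 = c.next s.2 a := by
  obtain ⟨q, _ | n⟩ := s
  · simp [step, VisibleAlphabet.next, (hA q a).1]
  · simp [step, VisibleAlphabet.next, (hA q a).2]

theorem IsVOCA.foldl_snd (hA : A.IsVOCA c) (s : Q × ℕ) (w : List α) :
    (w.foldl A.step s).2 = c.height s.2 w := by
  induction w generalizing s with
  | nil => rfl
  | cons a w ih => rw [List.foldl_cons, ih, hA.step_snd]; rfl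

theorem IsVOCA.ce_eq (hA : A.IsVOCA c) (w : List α) : A.ce w = c.height 0 w := hA.foldl_snd _ _

/-- The state reached does not change when a run that stays positive is moved. -/
theorem IsVOCA.foldl_shift (hA : A.IsVOCA c) {b e : ℕ} (b' : ℕ) (q : Q) (w : List α)
    (h : ∀ p, p <+: w → b + 1 ≤ c.height (b + 1 + e) p) :
    (w.foldl A.step (q, b' + 1 + e)).1 = (w.foldl A.step (q, b + 1 + e)).1 ∧
    c.height (b' + 1 + e) w + b = c.height (b + 1 + e) w + b' := by
  induction w generalizing q e with
  | nil => exact ⟨rfl, by simp [VisibleAlphabet.height]; omega⟩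
  | cons a w ih =>
    have h1 : b + 1 ≤ c.next (b + 1 + e) a := h [a] (by simp)
    have h2 : ∃ e', c.next (b + 1 + e) a = b + 1 + e' ∧ c.next (b' + 1 + e) a = b' + 1 + e' := by
      rw [show b + 1 + e = b + e + 1 by omega] at h1 ⊢
      rw [show b' + 1 + e = b' + e + 1 by omega]
      cases hc : c.pos a <;> simp only [VisibleAlphabet.next, hc, PosAction.result] at h1 ⊢
      · exact ⟨e - 1, by omega, by omega⟩
      · exact ⟨e, by omega, by omega⟩
      · exact ⟨e + 1, by omega, by omega⟩
    obtain ⟨e', h3, h4⟩ := h2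
    have h5 (b : ℕ) : A.step (q, b + 1 + e) a = ((A.δ₁ q a).1, c.next (b + 1 + e) a) := by
      refine Prod.ext ?_ (hA.step_snd _ _)
      rw [show b + 1 + e = b + e + 1 by omega]
      rfl
    have h6 (b : ℕ) : c.height (b + 1 + e) (a :: w) = c.height (c.next (b + 1 + e) a) w := rfl
    rw [List.foldl_cons, List.foldl_cons, h5, h5, h6, h6, h3, h4]
    refine ih _ fun p hp => ?_
    have := h (a :: p) (by simpa using hp)
    rwa [show c.height (b + 1 + e) (a :: p) = c.height (c.next (b + 1 + e) a) p from rfl, h3] at this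

/-- A shortest word that separates two visibly one-counter automata does not exceed a quadratic
counter-value. -/
theorem height_le_of_minimal [Fintype Q] [Fintype Q'] (hA : A.IsVOCA c) (hC : C.IsVOCA c)
    {z : List α} (hz : A.out z ≠ C.out z)
    (hmin : ∀ w : List α, w.length < z.length → A.out w = C.out w) {t : List α} (ht : t <+: z) :
    c.height 0 t ≤ Fintype.card Q * Fintype.card Q + Fintype.card Q' * Fintype.card Q' := by
  classical
  obtain ⟨s, rfl⟩ := ht
  set P := c.height 0 t with hP
  -- The levels are `i + 1` and not `i`: a middle part can be moved only if every transition in it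
  -- is taken at a positive counter-value.
  have h1 : ∀ i : Fin P, ∃ u r, t = u ++ r ∧ c.height 0 u = i + 1 ∧
      (∀ p, p <+: r → i + 1 ≤ c.height (i + 1) p) ∧
      ∀ u', u' <+: t → c.height 0 u' ≤ i + 1 → u'.length ≤ u.length :=
    fun i => c.exists_last (i + 1) (Nat.zero_le _) t (by omega)
  have h2 : ∀ i : Fin P, ∃ d v, s = d ++ v ∧ (∀ p, p <+: d → i + 1 ≤ c.height P p) ∧
      (c.height P d = i + 1 ∨ v = []) ∧
      ∀ u, u <+: s → c.height P u ≤ i + 1 → d.length ≤ u.length :=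
    fun i => c.exists_first (i + 1) (by omega) s
  choose u r hur hu hr hul using h1
  choose d v hdv hd hv hdl using h2
  -- the part of the run that stays at least at the height `i + 1`
  let m : Fin P → List α := fun i => r i ++ d i
  have hzm : ∀ i, t ++ s = u i ++ m i ++ v i := fun i => by
    conv_lhs => rw [hur i, hdv i]
    simp [m]
  have hPr : ∀ i : Fin P, c.height (i + 1) (r i) = P := fun i => by
    have h3 : c.height 0 (u i ++ r i) = P := by rw [← hur i]
    rwa [c.height_append, hu] at h3
  have hm : ∀ i p, p <+: m i → (i : ℕ) + 1 ≤ c.height (i + 1) p := by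
    intro i p hp
    rcases List.prefix_or_prefix_of_prefix hp (List.prefix_append (r i) (d i)) with hp' | ⟨p, rfl⟩
    · exact hr i p hp'
    · replace hp := (List.prefix_append_right_inj (r i)).1 hp
      rw [c.height_append, hPr]
      exact hd i p hp
  have hmv : ∀ i : Fin P, c.height (i + 1) (m i) = i + 1 ∨ v i = [] := fun i => by
    rw [c.height_append, hPr]; exact hv i
  have hulen : ∀ i j, j < i → (u j).length < (u i).length := by
    intro i j hij
    have hp : u j <+: t := ⟨r j, (hur j).symm⟩
    have h3 := hul i (u j) hp (by rw [hu]; have : (j : ℕ) < i := hij; omega)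
    refine lt_of_le_of_ne h3 fun h4 => ?_
    have h5 : u j = u i := by
      rw [List.prefix_iff_eq_take.1 hp, List.prefix_iff_eq_take.1 (⟨r i, (hur i).symm⟩ : u i <+: t),
        h4]
    have h6 := hu i
    rw [← h5, hu j] at h6
    exact hij.ne (Fin.ext (by omega))
  -- Coming down to the lower level takes at least as long. If the run never reaches it, all of `s`
  -- belongs to the middle part of that level and nothing remains after it.
  have hdlen : ∀ i j, j < i → (d i).length ≤ (d j).length ∧ (v j = [] ∨
      c.height (i + 1) (m i) = i + 1) := by
    intro i j hij
    have hp : d j <+: s := ⟨v j, (hdv j).symm⟩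
    have hij' : (j : ℕ) < i := hij
    have hsi : (d i).length ≤ s.length := by rw [hdv i]; simp
    rcases hv j with h3 | h3
    · have h4 := hdl i (d j) hp (by rw [h3]; omega)
      refine ⟨h4, ?_⟩
      rcases hmv i with h5 | h5
      · exact .inr h5
      · left
        have h6 := congrArg List.length (hdv i)
        have h7 := congrArg List.length (hdv j)
        rw [List.length_append, h5, List.length_nil] at h6
        rw [List.length_append] at h7
        exact List.length_eq_zero_iff.1 (by omega)
    · refine ⟨?_, .inl h3⟩
      have h7 := congrArg List.length (hdv j)
      rw [h3, List.append_nil] at h7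
      omega
  let b : Bool → ℚ := fun t => if t then 1 else 0
  have hb : Function.Injective b := by
    intro s t; cases s <;> cases t <;> simp [b]
  -- the effect of pasting the middle part for `i` into the run for `j`
  have hpaste : ∀ {Q₀ : Type} {B : DROCA Q₀ α} (_ : B.IsVOCA c) (i j : Fin P), j ≤ i →
      B.final ((v j).foldl B.step (((m i).foldl B.step ((B.run (u j)).1, (i : ℕ) + 1)).1,
        (j : ℕ) + 1)).1 = B.out (u j ++ m i ++ v j) := by
    intro Q₀ B hB i j hij
    have h3 := hB.foldl_shift (b := i) (e := 0) (j : ℕ) (B.run (u j)).1 (m i) (hm i)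
    have h4 : B.run (u j) = ((B.run (u j)).1, (j : ℕ) + 1) :=
      Prod.ext rfl ((hB.ce_eq _).trans (hu j))
    have h5 : (m i).foldl B.step (B.run (u j)) =
        (((m i).foldl B.step ((B.run (u j)).1, (i : ℕ) + 1)).1,
          c.height ((j : ℕ) + 1) (m i)) := by
      conv_lhs => rw [h4]
      exact Prod.ext h3.1 (hB.foldl_snd _ _)
    -- Either nothing follows the middle part, and then the counter-value at its end is irrelevant
    -- to acceptance, or the middle part returns to its level.
    have h6 : v j = [] ∨ c.height ((i : ℕ) + 1) (m i) = i + 1 := by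
      rcases hij.eq_or_lt with rfl | hij
      · exact (hmv j).symm
      · exact (hdlen i j hij).2
    rw [out, run_append, run_append, h5]
    rcases h6 with h6 | h6
    · rw [h6]; rfl
    · have h7 : c.height ((j : ℕ) + 1) (m i) = j + 1 := by
        have := h3.2
        simp only [add_zero] at this
        omega
      rw [h7]
  -- Acceptance of the pasted word is a sum over the pair of states before and after the middle
  -- part. One factor depends on the middle part for `i`, the other on the outer parts for `j`.
  have key : ∀ i j : Fin P, j ≤ i →
      ∑ x : Q × Q ⊕ Q' × Q',
        (Sum.elim
          (fun x => if ((m i).foldl A.step (x.1, (i : ℕ) + 1)).1 = x.2 then 1 else 0)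
          (fun x => if ((m i).foldl C.step (x.1, (i : ℕ) + 1)).1 = x.2 then 1 else 0) x : ℚ) *
        (Sum.elim
          (fun x => if (A.run (u j)).1 = x.1 then
            b (A.final ((v j).foldl A.step (x.2, (j : ℕ) + 1)).1) else 0)
          (fun x => if (C.run (u j)).1 = x.1 then
            -b (C.final ((v j).foldl C.step (x.2, (j : ℕ) + 1)).1) else 0) x : ℚ) =
      b (A.out (u j ++ m i ++ v j)) - b (C.out (u j ++ m i ++ v j)) := by
    intro i j hij
    rw [Fintype.sum_sum_type, ← hpaste hA i j hij, ← hpaste hC i j hij]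
    simp [Fintype.sum_prod_type, sub_eq_add_neg, -Prod.mk.eta]
  have := card_le_of_triangular (n := P) (ι := Q × Q ⊕ Q' × Q') _ _
    (fun i => by
      rw [key i i le_rfl, ← hzm]
      exact sub_ne_zero.2 fun h => hz (hb h))
    -- The initial part for the lower level is strictly shorter and the final part is no longer, so
    -- minimality applies to the pasted word.
    (fun i j hij => by
      rw [key i j hij.le, hmin, sub_self]
      have h3 := hulen i j hij
      have h4 := (hdlen i j hij).1
      have h5 := congrArg List.length (hdv i)
      have h6 := congrArg List.length (hdv j)
      have h7 := congrArg List.length (hur i)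
      simp only [List.length_append, m] at *
      omega)
  simpa using this

/-- All prefixes of the word have counter-value at most `H`. -/
def Low (A : DROCA Q α) (H : ℕ) (w : List α) : Prop := ∀ p, p <+: w → A.ce p ≤ H

theorem low_concat {H : ℕ} {w : List α} {a : α} :
    A.Low H (w ++ [a]) ↔ A.Low H w ∧ A.ce (w ++ [a]) ≤ H := by
  constructor
  · exact fun h => ⟨fun p hp => h p (hp.trans (List.prefix_append _ _)), h _ (List.prefix_refl _)⟩
  · rintro ⟨h1, h2⟩ p hp
    rcases List.prefix_concat_iff.1 hp with rfl | hp
    · exact h2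
    · exact h1 p hp

theorem IsVOCA.low_iff (hA : A.IsVOCA c) {H : ℕ} {w : List α} :
    A.Low H w ↔ ∀ p, p <+: w → c.height 0 p ≤ H := by
  simp only [Low, hA.ce_eq]

/-- The automaton with its counter-values cut off above `H`. -/
def truncStep (A : DROCA Q α) (H : ℕ) (s : Option (Q × Fin (H + 1))) (a : α) :
    Option (Q × Fin (H + 1)) :=
  s.bind fun s => if h : (A.step (s.1, s.2) a).2 < H + 1 then
    some ((A.step (s.1, s.2) a).1, ⟨(A.step (s.1, s.2) a).2, h⟩) else none

def truncOut (A : DROCA Q α) (H : ℕ) (s : Option (Q × Fin (H + 1))) : Bool :=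
  s.elim false fun s => A.final s.1

-- The cut-off automaton follows the configuration of a low word and is stuck at `none` once the
-- bound is exceeded. Thus bounds for finite automata apply to words below a height.
open Classical in
theorem truncOut_foldl (A : DROCA Q α) (H : ℕ) (w : List α) :
    A.truncOut H (w.foldl (A.truncStep H) (some (A.init, 0))) = (decide (A.Low H w) && A.out w) := by
  have key : w.foldl (A.truncStep H) (some (A.init, 0)) =
      if h : A.Low H w then some ((A.run w).1,
        ⟨(A.run w).2, Nat.lt_succ_of_le (h w (List.prefix_refl _))⟩) else none := by
    induction w using List.reverseRecOn with
    | nil =>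
      have : A.Low H [] := fun p hp => by rw [List.prefix_nil.1 hp]; exact Nat.zero_le _
      rw [dif_pos this]; rfl
    | append_singleton w a ih =>
      rw [List.foldl_append, ih]
      have h1 : A.run (w ++ [a]) = A.step (A.run w) a := by rw [run_append]; rfl
      by_cases hw : A.Low H w
      · rw [dif_pos hw]
        by_cases hwa : A.ce (w ++ [a]) ≤ H
        · rw [dif_pos (low_concat.2 ⟨hw, hwa⟩)]
          have h2 : (A.step (A.run w) a).2 < H + 1 := by rw [← h1]; exact Nat.lt_succ_of_le hwa
          simp only [List.foldl_cons, List.foldl_nil, truncStep, Option.bind_some, Prod.mk.eta,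
            dif_pos h2, h1]
        · rw [dif_neg fun h => hwa (low_concat.1 h).2]
          have h2 : ¬(A.step (A.run w) a).2 < H + 1 := by
            rw [← h1]; exact fun h => hwa (Nat.le_of_lt_succ h)
          simp only [List.foldl_cons, List.foldl_nil, truncStep, Option.bind_some, Prod.mk.eta,
            dif_neg h2]
      · rw [dif_neg hw, dif_neg fun h => hw (low_concat.1 h).1]; rfl
  rw [key]
  by_cases h : A.Low H w <;> simp [h, truncOut, out]

theorem card_trunc [Fintype Q] (H : ℕ) :
    Fintype.card (Option (Q × Fin (H + 1))) = Fintype.card Q * (H + 1) + 1 := by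
  simp

/-- A shortest word that separates two visibly one-counter automata has polynomial length. -/
theorem length_le_of_minimal [Fintype Q] [Fintype Q'] (hA : A.IsVOCA c) (hC : C.IsVOCA c)
    {z : List α} (hz : A.out z ≠ C.out z)
    (hmin : ∀ w : List α, w.length < z.length → A.out w = C.out w) :
    z.length ≤ (Fintype.card Q + Fintype.card Q') *
      (Fintype.card Q * Fintype.card Q + Fintype.card Q' * Fintype.card Q' + 1) + 1 := by
  classical
  set H := Fintype.card Q * Fintype.card Q + Fintype.card Q' * Fintype.card Q' with hH
  have h1 : ∀ p, p <+: z → c.height 0 p ≤ H := fun p hp => height_le_of_minimal hA hC hz hmin hp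
  -- The alphabet determines the heights, so both automata have the same low words. A word that
  -- separates the cut-off automata must be low, and then it separates the original ones.
  obtain ⟨w, hw, hne⟩ := exists_short_separating (A.truncStep H) (C.truncStep H) (A.truncOut H)
    (C.truncOut H) (some (A.init, 0)) (some (C.init, 0)) ⟨z, by
      rw [truncOut_foldl, truncOut_foldl, decide_eq_true (hA.low_iff.2 h1),
        decide_eq_true (hC.low_iff.2 h1)]
      simpa using hz⟩
  rw [truncOut_foldl, truncOut_foldl] at hne
  have h2 : A.Low H w ↔ C.Low H w := by rw [hA.low_iff, hC.low_iff]
  rw [card_trunc, card_trunc] at hw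
  have h3 : A.out w ≠ C.out w := by
    intro h
    rw [h] at hne
    simp [h2] at hne
  have h4 : z.length ≤ w.length := by
    by_contra h
    exact h3 (hmin w (by omega))
  rw [Nat.add_mul]
  omega

end DROCA

/-! ## Raw data of automata -/

def ZeroAction.code : ZeroAction → ℕ
  | .stay => 0
  | .inc => 1

def PosAction.code : PosAction → ℕ
  | .dec => 0
  | .stay => 1
  | .inc => 2

/-- A word over `Fin m` as raw data. -/
def rawWord {m : ℕ} (w : List (Fin m)) : Word := w.map Fin.val

def rawAlphabet {m : ℕ} (c : VisibleAlphabet (Fin m)) : RawAlphabet :=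
  List.ofFn fun a => ((c.zero a).code, (c.pos a).code)

def DROCA.raw {n m : ℕ} (A : DROCA (Fin n) (Fin m)) : RawAut :=
  ((A.init : ℕ), List.ofFn fun q => (A.final q, List.ofFn fun a =>
    ((((A.δ₀ q a).1 : ℕ), (A.δ₀ q a).2.code), (((A.δ₁ q a).1 : ℕ), (A.δ₁ q a).2.code))))

section Encodings

variable {n m : ℕ}

theorem enc_zeroAction (x : ZeroAction) : enc x.code = Data.ofZeroAction x := by cases x <;> rfl

theorem enc_posAction (x : PosAction) : enc x.code = Data.ofPosAction x := by cases x <;> rfl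

theorem enc_ofFn {α : Type} [Enc α] (f : Fin n → α) :
    enc (List.ofFn f) = Data.ofList (List.ofFn fun i => enc (f i)) := by
  show Data.ofList ((List.ofFn f).map enc) = _
  rw [List.map_ofFn]; rfl

theorem enc_rawWord (w : List (Fin m)) : enc (rawWord w) = Data.ofWord w := by
  rw [Data.ofWord]
  show Data.ofList ((w.map Fin.val).map enc) = _
  congr 1
  induction w with
  | nil => rfl
  | cons a w ih => simp_all; rfl

theorem enc_rawAlphabet (c : VisibleAlphabet (Fin m)) : enc (rawAlphabet c) = Data.ofAlphabet c := by
  rw [rawAlphabet, enc_ofFn]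
  simp only [enc_pair, enc_zeroAction, enc_posAction]
  rfl

theorem DROCA.enc_raw (A : DROCA (Fin n) (Fin m)) : enc A.raw = Data.ofDROCA A := by
  rw [raw, enc_pair]
  simp only [enc_ofFn, enc_pair, enc_zeroAction, enc_posAction]
  rfl

@[simp] theorem rawWord_nil : rawWord ([] : List (Fin m)) = [] := rfl

@[simp] theorem rawWord_append (u v : List (Fin m)) : rawWord (u ++ v) = rawWord u ++ rawWord v :=
  List.map_append

@[simp] theorem length_rawWord (w : List (Fin m)) : (rawWord w).length = w.length :=
  List.length_map _

theorem rawWord_injective : Function.Injective (rawWord (m := m)) :=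
  List.map_injective_iff.2 Fin.val_injective

theorem rawWord_singleton (a : Fin m) : rawWord [a] = [(a : ℕ)] := rfl

/-- Raw words with letters less than `m`. -/
def Valid (m : ℕ) (w : Word) : Prop := ∃ v : List (Fin m), rawWord v = w

theorem valid_rawWord (w : List (Fin m)) : Valid m (rawWord w) := ⟨w, rfl⟩

theorem Valid.append {u v : Word} (hu : Valid m u) (hv : Valid m v) : Valid m (u ++ v) := by
  obtain ⟨u, rfl⟩ := hu
  obtain ⟨v, rfl⟩ := hv
  exact ⟨u ++ v, rawWord_append u v⟩

theorem Valid.singleton {a : ℕ} (ha : a < m) : Valid m [a] := ⟨[⟨a, ha⟩], rfl⟩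

theorem Valid.of_suffix {u v : Word} (hv : Valid m v) (h : u <:+ v) : Valid m u := by
  obtain ⟨v, rfl⟩ := hv
  rw [List.suffix_iff_eq_drop.1 h]
  exact ⟨v.drop _, by rw [rawWord, rawWord, List.map_drop]⟩

theorem Valid.of_prefix {u v : Word} (hv : Valid m v) (h : u <+: v) : Valid m u := by
  obtain ⟨v, rfl⟩ := hv
  rw [List.prefix_iff_eq_take.1 h]
  exact ⟨v.take _, by rw [rawWord, rawWord, List.map_take]⟩

end Encodings

/-! ### Heights of raw words agree with counter-values. -/

namespace Learner

variable {m : ℕ} (c : VisibleAlphabet (Fin m))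

@[simp] theorem length_rawAlphabet : (rawAlphabet c).length = m := List.length_ofFn

theorem getD_rawAlphabet (a : Fin m) (d : ℕ × ℕ) :
    (rawAlphabet c).getD a d = ((c.zero a).code, (c.pos a).code) := by
  rw [rawAlphabet, List.getD_eq_getElem _ _ (by simp)]
  simp

theorem up_rawAlphabet (h : ℕ) (a : Fin m) : up (rawAlphabet c) h a = c.next h a := by
  rw [up, getD_rawAlphabet]
  cases h with
  | zero => cases hc : c.zero a <;>
      simp [VisibleAlphabet.next, hc, ZeroAction.result, ZeroAction.code]
  | succ n => cases hc : c.pos a <;>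
      simp [VisibleAlphabet.next, hc, PosAction.result, PosAction.code]

theorem foldl_up (h : ℕ) (w : List (Fin m)) :
    (rawWord w).foldl (up (rawAlphabet c)) h = c.height h w := by
  induction w generalizing h with
  | nil => rfl
  | cons a w ih =>
    show (rawWord w).foldl _ (up (rawAlphabet c) h a) = _
    rw [up_rawAlphabet, ih]; rfl

theorem height_rawWord (w : List (Fin m)) : height (rawAlphabet c) (rawWord w) = c.height 0 w :=
  foldl_up c 0 w

theorem high_concat (cs : RawAlphabet) (H : ℕ) (w : Word) (a : ℕ) :
    high cs H (w ++ [a]) = (high cs H w || decide (H < height cs (w ++ [a]))) := by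
  have key : ∀ w : Word, (w.foldl (fun s a => (up cs s.1 a, s.2 || decide (H < up cs s.1 a)))
      ((0, false) : ℕ × Bool)).1 = height cs w := by
    intro w
    induction w using List.reverseRecOn with
    | nil => rfl
    | append_singleton w a ih => rw [List.foldl_append]; simp [ih, height]
  rw [high, List.foldl_append]
  simp only [List.foldl_cons, List.foldl_nil, key]
  simp only [high, height, List.foldl_append, List.foldl_cons, List.foldl_nil]
  rfl

/-- The word exceeds the counter-value `H`. -/
theorem high_rawWord {Q : Type} {A : DROCA Q (Fin m)} (hA : A.IsVOCA c) (H : ℕ) (w : List (Fin m)) :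
    high (rawAlphabet c) H (rawWord w) = false ↔ A.Low H w := by
  induction w using List.reverseRecOn with
  | nil => exact ⟨fun _ p hp => by rw [List.prefix_nil.1 hp]; exact Nat.zero_le _, fun _ => rfl⟩
  | append_singleton w a ih =>
    rw [rawWord_append, rawWord_singleton, high_concat, Bool.or_eq_false_iff, ih,
      DROCA.low_concat, ← rawWord_singleton, ← rawWord_append, height_rawWord, hA.ce_eq]
    simp

end Learner

/-! ### Raw data that come from automata, and renaming of states. -/

namespace DROCA

variable {n m : ℕ} {c : VisibleAlphabet (Fin m)}

theorem getD_raw (A : DROCA (Fin n) (Fin m)) (q : Fin n) (d) : A.raw.2.getD q d =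
    (A.final q, List.ofFn fun a =>
    ((((A.δ₀ q a).1 : ℕ), (A.δ₀ q a).2.code), (((A.δ₁ q a).1 : ℕ), (A.δ₁ q a).2.code))) := by
  rw [raw, List.getD_eq_getElem _ _ (by simp)]
  simp

@[simp] theorem raw_fin (A : DROCA (Fin n) (Fin m)) (q : Fin n) : A.raw.fin q = A.final q := by
  rw [RawAut.fin, getD_raw]

@[simp] theorem length_raw (A : DROCA (Fin n) (Fin m)) : A.raw.2.length = n := List.length_ofFn

theorem raw_succ (A : DROCA (Fin n) (Fin m)) (b : ℕ) (q : Fin n) (a : Fin m) :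
    A.raw.succ b q a = if b = 0 then ((A.δ₀ q a).1 : ℕ) else ((A.δ₁ q a).1 : ℕ) := by
  rw [RawAut.succ, RawAut.trans, getD_raw, List.getD_eq_getElem _ _ (by simp)]
  simp

theorem step_fst (A : DROCA (Fin n) (Fin m)) (s : Fin n × ℕ) (a : Fin m) :
    ((A.step s a).1 : ℕ) = A.raw.succ s.2 s.1 a := by
  obtain ⟨q, _ | h⟩ := s <;> simp [raw_succ, step]

/-- A request must carry a genuine automaton. This turns what the learner builds with `RawAut.mk`
into a VOCA, provided that the functions keep real states within range; the counter-actions are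
right by construction. -/
theorem exists_raw_eq_mk (c : VisibleAlphabet (Fin m)) {n i : ℕ} (hi : i < n) (f : ℕ → Bool)
    (δ : ℕ → ℕ → ℕ → ℕ) (hδ : ∀ b q a, b < 2 → q < n → a < m → δ b q a < n) :
    ∃ B : DROCA (Fin n) (Fin m), B.IsVOCA c ∧ B.raw = RawAut.mk (rawAlphabet c) n i f δ ∧
      (B.init : ℕ) = i ∧ (∀ q, B.final q = f q) ∧
      ∀ (q : Fin n) (h : ℕ) (a : Fin m), ((B.step (q, h) a).1 : ℕ) = δ (if h = 0 then 0 else 1) q a := by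
  refine ⟨⟨⟨i, hi⟩, fun q a => (⟨δ 0 q a, hδ 0 q a (by omega) q.2 a.2⟩, c.zero a),
    fun q a => (⟨δ 1 q a, hδ 1 q a (by omega) q.2 a.2⟩, c.pos a), fun q => f q⟩,
    fun q a => ⟨rfl, rfl⟩, ?_, rfl, fun q => rfl, ?_⟩
  · refine Prod.ext rfl ?_
    refine List.ext_getElem (by simp [raw, RawAut.mk]) fun q hq hq' => ?_
    simp only [raw, RawAut.mk, List.getElem_ofFn, List.getElem_map, List.getElem_range]
    refine Prod.ext rfl ?_
    refine List.ext_getElem (by simp) fun a ha ha' => ?_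
    have := Learner.getD_rawAlphabet c ⟨a, by simpa using ha⟩ (0, 1)
    simp only [List.getElem_ofFn, List.getElem_map, List.getElem_range, this]
  · rintro q (_ | h) a <;> simp [step]

/-- Renaming the states. -/
def rename {Q Q' α : Type*} (e : Q ≃ Q') (A : DROCA Q α) : DROCA Q' α where
  init := e A.init
  δ₀ q a := (e (A.δ₀ (e.symm q) a).1, (A.δ₀ (e.symm q) a).2)
  δ₁ q a := (e (A.δ₁ (e.symm q) a).1, (A.δ₁ (e.symm q) a).2)
  final q := A.final (e.symm q)

theorem rename_isVOCA {Q Q' α : Type*} (e : Q ≃ Q') {A : DROCA Q α} {c : VisibleAlphabet α}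
    (hA : A.IsVOCA c) : (A.rename e).IsVOCA c := fun q a => hA (e.symm q) a

theorem rename_out {Q Q' : Type} {α : Type*} (e : Q ≃ Q') (A : DROCA Q α) (w : List α) :
    (A.rename e).out w = A.out w := by
  have key : (A.rename e).run w = (e (A.run w).1, (A.run w).2) := by
    induction w using List.reverseRecOn with
    | nil => rfl
    | append_singleton w a ih =>
      rw [run_append, run_append, ih]
      rcases h : A.run w with ⟨q, _ | n⟩ <;> simp [step, rename]
  rw [out, key, out]
  simp [rename]

theorem language_eq_iff {Q Q' : Type} {α : Type*} {A : DROCA Q α} {B : DROCA Q' α} :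
    A.Equivalent B ↔ ∀ w, A.out w = B.out w := by
  constructor
  · intro h w
    rw [Bool.eq_iff_iff, ← mem_language, ← mem_language, show A.language = B.language from h]
  · intro h
    refine Set.ext fun w => ?_
    show A.out w = true ↔ B.out w = true
    rw [h]

end DROCA

/-! ## Tables -/

namespace DROCA

variable {Q : Type} {m : ℕ}

open Classical in
/-- Acceptance of raw words. -/
noncomputable def acc (A : DROCA Q (Fin m)) (w : Word) : Bool :=
  decide (∃ v : List (Fin m), rawWord v = w ∧ A.out v = true)

@[simp] theorem acc_rawWord (A : DROCA Q (Fin m)) (w : List (Fin m)) :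
    A.acc (rawWord w) = A.out w := by
  classical
  rw [acc, Bool.eq_iff_iff, decide_eq_true_iff]
  constructor
  · rintro ⟨v, hv, h⟩
    rwa [← rawWord_injective hv]
  · exact fun h => ⟨w, rfl, h⟩

end DROCA

namespace Learner

theorem similar_iff {cs : RawAlphabet} {S : List Word} {f : Word → Bool} {u v : Word} :
    similar cs S f u v = true ↔ height cs u = height cs v ∧ ∀ s ∈ S, f (u ++ s) = f (v ++ s) := by
  simp [similar]

theorem similar_symm {cs : RawAlphabet} {S : List Word} {f : Word → Bool} {u v : Word}
    (h : similar cs S f u v = true) : similar cs S f v u = true := by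
  rw [similar_iff] at *
  exact ⟨h.1.symm, fun s hs => (h.2 s hs).symm⟩

theorem similar_trans {cs : RawAlphabet} {S : List Word} {f : Word → Bool} {u v w : Word}
    (h : similar cs S f u v = true) (h' : similar cs S f v w = true) :
    similar cs S f u w = true := by
  rw [similar_iff] at *
  exact ⟨h.1.trans h'.1, fun s hs => (h.2 s hs).trans (h'.2 s hs)⟩

theorem mem_extensions {m : ℕ} {R : List Word} {u : Word} :
    u ∈ extensions m R ↔ ∃ r ∈ R, ∃ a < m, r ++ [a] = u := by
  simp [extensions]

theorem mem_required {m : ℕ} {R S : List Word} {w : Word} :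
    w ∈ required m R S ↔ ∃ u, (u ∈ R ∨ u ∈ extensions m R) ∧ ∃ s ∈ S, u ++ s = w := by
  simp only [required, List.mem_flatMap, List.mem_append, List.mem_map]

/-- The representatives of a table are pairwise separated by its suffixes. -/
structure Table (cs : RawAlphabet) (H : ℕ) (f : Word → Bool) (R S : List Word) : Prop where
  head : R.head? = some []
  nil_mem : [] ∈ S
  height_le : ∀ r ∈ R, height cs r ≤ H
  pairwise : R.Pairwise fun r u => similar cs S f u r = false

/-- Every extension of a representative is similar to a representative. -/
def Closed (cs : RawAlphabet) (H : ℕ) (f : Word → Bool) (R S : List Word) : Prop :=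
  ∀ u ∈ extensions cs.length R, height cs u ≤ H → ∃ r ∈ R, similar cs S f u r = true

/-- The class of a word in the table. -/
def cls (cs : RawAlphabet) (R S : List Word) (f : Word → Bool) (w : Word) : ℕ :=
  w.foldl (next cs R S f) 0

variable {cs : RawAlphabet} {H : ℕ} {f g : Word → Bool} {R S S' : List Word}

theorem cls_concat (w : Word) (a : ℕ) :
    cls cs R S f (w ++ [a]) = next cs R S f (cls cs R S f w) a := by
  rw [cls, List.foldl_append]; rfl

theorem next_le (o a : ℕ) : next cs R S f o a ≤ R.length := by
  rw [next]; split_ifs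
  · exact List.findIdx_le_length
  · exact le_rfl

theorem Table.eq_of_similar (hT : Table cs H f R S) {i j : ℕ} (hi : i < R.length)
    (hj : j < R.length) (h : similar cs S f R[i] R[j] = true) : i = j := by
  have key := List.pairwise_iff_getElem.1 hT.pairwise
  rcases lt_trichotomy i j with hij | hij | hij
  · have := key i j hi hj hij
    rw [similar_symm h] at this; simp at this
  · exact hij
  · have := key j i hj hi hij
    rw [h] at this; simp at this

theorem Table.length_pos (hT : Table cs H f R S) : 0 < R.length := by
  have := hT.head
  cases R <;> simp at *

theorem Table.getD_zero (hT : Table cs H f R S) : R.getD 0 [] = [] := by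
  have := hT.head
  cases R <;> simp_all

/-- The index found by `next`, when there is a similar representative. -/
theorem next_spec {o a : ℕ} (ho : o < R.length) {r : Word} (hr : r ∈ R)
    (h : similar cs S f (R.getD o [] ++ [a]) r = true) :
    next cs R S f o a < R.length ∧
      similar cs S f (R.getD o [] ++ [a]) (R.getD (next cs R S f o a) []) = true := by
  have h1 : R.findIdx (fun r => similar cs S f (R.getD o [] ++ [a]) r) < R.length :=
    List.findIdx_lt_length_of_exists ⟨r, hr, h⟩
  rw [next, if_pos ho]
  refine ⟨h1, ?_⟩
  rw [List.getD_eq_getElem _ _ h1]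
  exact List.findIdx_getElem (w := h1)

theorem next_eq_length {o a : ℕ} (h : ∀ r ∈ R, similar cs S f (R.getD o [] ++ [a]) r = false) :
    next cs R S f o a = R.length := by
  rw [next]; split_ifs
  · exact List.findIdx_eq_length_of_false h
  · rfl

theorem getD_mem {o : ℕ} (ho : o < R.length) : R.getD o [] ∈ R := by
  rw [List.getD_eq_getElem _ _ ho]; exact List.getElem_mem _

/-- As long as it does not exceed the bound, a word has a class of its height. -/
theorem Table.cls_spec (hT : Table cs H f R S) (hC : Closed cs H f R S) {w : Word}
    (hw : Valid cs.length w) :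
    (high cs H w = false → cls cs R S f w < R.length ∧
      height cs (R.getD (cls cs R S f w) []) = height cs w) ∧
    (high cs H w = true → cls cs R S f w = R.length) := by
  obtain ⟨w, rfl⟩ := hw
  induction w using List.reverseRecOn with
  | nil =>
    refine ⟨fun _ => ⟨hT.length_pos, ?_⟩, fun h => ?_⟩
    · show height cs (R.getD 0 []) = _
      rw [hT.getD_zero]; rfl
    · simp [high] at h
  | append_singleton w a ih =>
    rw [rawWord_append, rawWord_singleton, high_concat, cls_concat]
    set o := cls cs R S f (rawWord w)
    have hlt : ∀ ho : o < R.length, R.getD o [] ++ [(a : ℕ)] ∈ extensions cs.length R := fun ho =>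
      mem_extensions.2 ⟨_, getD_mem ho, a, a.2, rfl⟩
    have hh : height cs (R.getD o []) = height cs (rawWord w) →
        height cs (R.getD o [] ++ [(a : ℕ)]) = height cs (rawWord w ++ [(a : ℕ)]) := by
      intro h
      simp only [height, List.foldl_append] at *
      rw [h]
    constructor
    · rw [Bool.or_eq_false_iff, decide_eq_false_iff_not, not_lt]
      rintro ⟨h1, h2⟩
      obtain ⟨ho, h3⟩ := ih.1 h1
      obtain ⟨r, hr, hs⟩ := hC _ (hlt ho) (by rw [hh h3]; exact h2)
      obtain ⟨h4, h5⟩ := next_spec ho hr hs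
      exact ⟨h4, by rw [← (similar_iff.1 h5).1, hh h3]⟩
    · rw [Bool.or_eq_true, decide_eq_true_iff]
      intro h
      cases h1 : high cs H (rawWord w) with
      | true =>
        rw [next, if_neg]
        have : o = R.length := ih.2 h1
        omega
      | false =>
        obtain ⟨ho, h3⟩ := ih.1 h1
        have h2 : H < height cs (rawWord w ++ [(a : ℕ)]) := by simpa [h1] using h
        refine next_eq_length fun r hr => ?_
        by_contra hs
        have := (similar_iff.1 (Bool.not_eq_false _ ▸ hs)).1
        rw [hh h3] at this
        have := hT.height_le r hr
        omega

theorem high_of_prefix {u v : Word} (h : high cs H (u ++ v) = false) : high cs H u = false := by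
  induction v using List.reverseRecOn with
  | nil => simpa using h
  | append_singleton v a ih =>
    rw [← List.append_assoc, high_concat, Bool.or_eq_false_iff] at h
    exact ih h.1

/-- The representative of a low prefix has the height of that prefix, so its extension is within the
bound and closedness applies to it. This is the one-step correctness from which the statements about
whole words follow by induction. -/
theorem cls_step (hT : Table cs H f R S) (hC : Closed cs H f R S) {x : Word} {a : ℕ}
    (hx : Valid cs.length (x ++ [a])) (hlow : high cs H (x ++ [a]) = false) :
    cls cs R S f x < R.length ∧ similar cs S f (R.getD (cls cs R S f x) [] ++ [a])
      (R.getD (cls cs R S f (x ++ [a])) []) = true := by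
  obtain ⟨w, hw⟩ := hx
  have hw' := hw
  rw [rawWord, List.map_eq_append_iff] at hw
  obtain ⟨w₁, w₂, rfl, rfl, h2⟩ := hw
  obtain ⟨b, rfl, rfl⟩ : ∃ b : Fin cs.length, w₂ = [b] ∧ (b : ℕ) = a := by
    match w₂, h2 with
    | [b], h => exact ⟨b, rfl, by simpa using h⟩
  have h1 := (hT.cls_spec hC ⟨w₁, rfl⟩).1 (high_of_prefix hlow)
  have hlt : R.getD (cls cs R S f (rawWord w₁)) [] ++ [(b : ℕ)] ∈ extensions cs.length R :=
      mem_extensions.2 ⟨_, getD_mem h1.1, b, b.2, rfl⟩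
  have hh : height cs (R.getD (cls cs R S f (rawWord w₁)) [] ++ [(b : ℕ)]) ≤ H := by
    rw [high_concat, Bool.or_eq_false_iff, decide_eq_false_iff_not, not_lt] at hlow
    refine le_trans (le_of_eq ?_) hlow.2
    have := h1.2
    simp only [height, List.foldl_append, rawWord] at *
    rw [this]
  obtain ⟨r, hr, hs⟩ := hC _ hlt hh
  refine ⟨h1.1, ?_⟩
  rw [cls_concat]
  exact (next_spec h1.1 hr hs).2

/-- If the table has all suffixes of a word, it classifies the word correctly. -/
theorem Table.apply_cls (hT : Table cs H f R S) (hC : Closed cs H f R S) {z : Word}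
    (hz : Valid cs.length z) (hlow : high cs H z = false) (hS : ∀ s, s <:+ z → s ∈ S) :
    f (R.getD (cls cs R S f z) []) = f z := by
  -- The part already read is replaced by its representative. Each step is invisible to the unread
  -- part `y`, which is a suffix of `z` and hence in `S`.
  have key : ∀ y x, x ++ y = z → f (R.getD (cls cs R S f x) [] ++ y) = f z := by
    intro y x
    induction x using List.reverseRecOn generalizing y with
    | nil =>
      rintro rfl
      show f (R.getD 0 [] ++ _) = _
      rw [hT.getD_zero]
    | append_singleton x a ih =>
      intro h
      have h1 := ih (a :: y) (by simpa using h)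
      rw [← h1]
      have h2 := cls_step (x := x) (a := a) hT hC (hz.of_prefix ⟨y, h⟩)
        (high_of_prefix (v := y) (by rw [h]; exact hlow))
      have h3 := (similar_iff.1 h2.2).2 y (hS y ⟨_, h⟩)
      rw [← h3]
      simp
  simpa using key [] z (by simp)

/-- If more suffixes do not lead to more representatives, the classes of words do not change. -/
theorem Table.cls_eq (hT : Table cs H f R S) (hC : Closed cs H f R S) (hT' : Table cs H f R S')
    (hC' : Closed cs H f R S') (hS : ∀ s ∈ S, s ∈ S') {z : Word} (hz : Valid cs.length z)
    (hlow : high cs H z = false) : cls cs R S f z = cls cs R S' f z := by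
  obtain ⟨z, rfl⟩ := hz
  induction z using List.reverseRecOn with
  | nil => rfl
  | append_singleton z a ih =>
    rw [rawWord_append, rawWord_singleton] at hlow ⊢
    have hv : Valid cs.length (rawWord z ++ [(a : ℕ)]) := (valid_rawWord z).append (.singleton a.2)
    have h0 := ih (high_of_prefix hlow)
    have h1 := cls_step hT hC hv hlow
    have h2 := cls_step hT' hC' hv hlow
    rw [← h0] at h2
    -- More suffixes make similarity finer, so the class found with `S'` is also similar with
    -- respect to `S` to the same extension. The representatives are pairwise separated by `S`,
    -- which leaves one candidate only.
    have h3 : similar cs S f (R.getD (cls cs R S f (rawWord z)) [] ++ [(a : ℕ)])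
        (R.getD (cls cs R S' f (rawWord z ++ [(a : ℕ)])) []) = true := by
      rw [similar_iff] at *
      exact ⟨h2.2.1, fun s hs => h2.2.2 s (hS s hs)⟩
    have h4 := similar_trans (similar_symm h1.2) h3
    have h5 := ((hT.cls_spec hC hv).1 hlow).1
    have h6 := ((hT'.cls_spec hC' hv).1 hlow).1
    rw [List.getD_eq_getElem _ _ h5, List.getD_eq_getElem _ _ h6] at h4
    exact hT.eq_of_similar h5 h6 h4

/-- There are not more representatives than configurations. -/
theorem Table.length_le {m : ℕ} {c : VisibleAlphabet (Fin m)} {Q : Type} [Fintype Q]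
    {A : DROCA Q (Fin m)} (hA : A.IsVOCA c) (hT : Table (rawAlphabet c) H A.acc R S)
    (hR : ∀ r ∈ R, Valid m r) (hS : ∀ s ∈ S, Valid m s) :
    R.length ≤ Fintype.card Q * (H + 1) := by
  choose w hw using fun i : Fin R.length => hR R[i] (List.getElem_mem _)
  have hh : ∀ i, (A.run (w i)).2 ≤ H := fun i => by
    have := hT.height_le R[i] (List.getElem_mem _)
    rw [← hw, height_rawWord, ← hA.ce_eq] at this
    exact this
  -- Representatives that reach the same configuration of `A` have the same height and the same
  -- accepted suffixes, so no suffix separates them.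
  let F : Fin R.length → Q × Fin (H + 1) := fun i =>
    ((A.run (w i)).1, ⟨(A.run (w i)).2, Nat.lt_succ_of_le (hh i)⟩)
  have hF : Function.Injective F := by
    intro i j hij
    have h1 : A.run (w i) = A.run (w j) := by
      have h2 := congrArg Prod.fst hij
      have h3 := congrArg (fun x => (x.2 : ℕ)) hij
      exact Prod.ext h2 h3
    refine Fin.ext (hT.eq_of_similar i.2 j.2 (similar_iff.2 ⟨?_, fun s hs => ?_⟩))
    · have h2 := hw i
      have h3 := hw j
      simp only [Fin.getElem_fin] at h2 h3
      rw [← h2, ← h3, height_rawWord, height_rawWord, ← hA.ce_eq, ← hA.ce_eq, DROCA.ce, h1]; rfl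
    · have h2 := hw i
      have h3 := hw j
      simp only [Fin.getElem_fin] at h2 h3
      obtain ⟨s, rfl⟩ := hS s hs
      rw [← h2, ← h3, ← rawWord_append, ← rawWord_append, DROCA.acc_rawWord, DROCA.acc_rawWord,
        DROCA.out, DROCA.run_append, h1, ← DROCA.run_append, DROCA.out]
  have := Fintype.card_le_of_injective F hF
  simpa using this

/-- If the table and an automaton classify some word below the bound differently, they do so on
a short one. -/
theorem exists_short_of_ne {m k : ℕ} {c : VisibleAlphabet (Fin m)} {C : DROCA (Fin k) (Fin m)}
    (hCV : C.IsVOCA c) (hT : Table (rawAlphabet c) H f R S) (hC : Closed (rawAlphabet c) H f R S)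
    {z : List (Fin m)} (hz : C.Low H z)
    (hne : f (R.getD (cls (rawAlphabet c) R S f (rawWord z)) []) ≠ C.out z) :
    ∃ w : List (Fin m), C.Low H w ∧ w.length < R.length + k * (H + 1) + 2 ∧
      f (R.getD (cls (rawAlphabet c) R S f (rawWord w)) []) ≠ C.out w := by
  classical
  -- The table is a finite automaton with one extra state for the sink. The sink rejects, just as
  -- the cut-off automaton does above the bound, so these two can differ on low words only.
  let F : Fin (R.length + 1) → Fin m → Fin (R.length + 1) := fun o a =>
    ⟨next (rawAlphabet c) R S f o a, Nat.lt_succ_of_le (next_le _ _)⟩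
  let o : Fin (R.length + 1) → Bool := fun i => decide ((i : ℕ) < R.length) && f (R.getD i [])
  have hF : ∀ w : List (Fin m), ((w.foldl F 0 : Fin _) : ℕ) =
      cls (rawAlphabet c) R S f (rawWord w) := by
    intro w
    induction w using List.reverseRecOn with
    | nil => rfl
    | append_singleton w a ih =>
      rw [rawWord_append, rawWord_singleton, cls_concat, ← ih, List.foldl_append]; rfl
  have ho : ∀ w : List (Fin m), o (w.foldl F 0) = (decide (C.Low H w) &&
      f (R.getD (cls (rawAlphabet c) R S f (rawWord w)) [])) := by
    intro w
    simp only [o, hF]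
    congr 1
    have h1 := hT.cls_spec hC (w := rawWord w) (by
      rw [length_rawAlphabet]; exact valid_rawWord w)
    by_cases hw : C.Low H w
    · simp [hw, (h1.1 ((high_rawWord c hCV H w).2 hw)).1]
    · have h2 : high (rawAlphabet c) H (rawWord w) = true := by
        rw [← high_rawWord c hCV] at hw; simpa using hw
      simp [hw, h1.2 h2]
  obtain ⟨w, hw, h1⟩ := exists_short_separating F (C.truncStep H) o (C.truncOut H) 0
    (some (C.init, 0)) ⟨z, by
      rw [ho, DROCA.truncOut_foldl, decide_eq_true hz]
      simpa using hne⟩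
  rw [ho, DROCA.truncOut_foldl] at h1
  rw [DROCA.card_trunc, Fintype.card_fin, Fintype.card_fin] at hw
  by_cases hlow : C.Low H w
  · exact ⟨w, hlow, by omega, by simpa [hlow] using h1⟩
  · simp [hlow] at h1

/-! ### Combining a table with an automaton -/

/-- The learner computes with `look` where the proof wants `acc`. They agree on the required words,
and this lemma and the next two say that nothing else is consulted. -/
theorem similar_congr (h : ∀ u ∈ R ++ extensions cs.length R, ∀ s ∈ S, f (u ++ s) = g (u ++ s))
    {u r : Word} (hu : u ∈ R ++ extensions cs.length R) (hr : r ∈ R ++ extensions cs.length R) :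
    similar cs S f u r = similar cs S g u r := by
  rw [Bool.eq_iff_iff, similar_iff, similar_iff]
  refine and_congr_right fun _ => forall₂_congr fun s hs => ?_
  rw [h u hu s hs, h r hr s hs]

theorem next_congr (h : ∀ u ∈ R ++ extensions cs.length R, ∀ s ∈ S, f (u ++ s) = g (u ++ s))
    {o a : ℕ} (ha : a < cs.length) : next cs R S f o a = next cs R S g o a := by
  rw [next, next]
  split_ifs with ho
  · have h1 : R.getD o [] ++ [a] ∈ R ++ extensions cs.length R :=
      List.mem_append_right _ (mem_extensions.2 ⟨_, getD_mem ho, a, ha, rfl⟩)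
    have h2 : ∀ r ∈ R, similar cs S f (R.getD o [] ++ [a]) r =
        similar cs S g (R.getD o [] ++ [a]) r := fun r hr =>
      similar_congr h h1 (List.mem_append_left _ hr)
    clear h h1 ho
    generalize R.getD o [] ++ [a] = u at *
    induction R with
    | nil => rfl
    | cons x R ih =>
      rw [List.findIdx_cons, List.findIdx_cons, h2 x List.mem_cons_self,
        ih fun r hr => h2 r (List.mem_cons_of_mem _ hr)]
  · rfl

theorem combine_congr (h : ∀ u ∈ R ++ extensions cs.length R, ∀ s ∈ S, f (u ++ s) = g (u ++ s))
    (hnil : [] ∈ S) (k : ℕ) (C : RawAut) : combine cs k C R S f = combine cs k C R S g := by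
  unfold combine RawAut.mk
  refine Prod.ext rfl (List.map_congr_left fun q hq => Prod.ext ?_ ?_)
  · dsimp only
    split_ifs with ho
    · have := h _ (List.mem_append_left _ (getD_mem ho)) [] hnil
      simpa using this
    · rfl
  · refine List.map_congr_left fun a ha => ?_
    rw [List.mem_range] at ha
    simp only [next_congr h ha]

/-- The two components run side by side, and `f` may be arbitrary. That the classes mean anything is
left to `Table.cls_spec`. -/
theorem exists_combine {m k : ℕ} (c : VisibleAlphabet (Fin m)) {C : DROCA (Fin k) (Fin m)}
    (hCV : C.IsVOCA c) (f : Word → Bool) :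
    ∃ E : DROCA (Fin ((R.length + 1) * k)) (Fin m), E.IsVOCA c ∧
      E.raw = combine (rawAlphabet c) k C.raw R S f ∧
      ∀ w, E.out w = if cls (rawAlphabet c) R S f (rawWord w) < R.length then
        f (R.getD (cls (rawAlphabet c) R S f (rawWord w)) []) else C.out w := by
  have hk : 0 < k := C.init.pos
  have hCi : C.raw.1 = C.init := rfl
  have hlt : ∀ o q, o ≤ R.length → q < k → k * o + q < (R.length + 1) * k := by
    intro o q ho hq
    have := Nat.mul_le_mul_left k ho
    rw [Nat.add_mul, Nat.mul_comm R.length]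
    omega
  have hdiv : ∀ o q, q < k → (k * o + q) / k = o ∧ (k * o + q) % k = q := by
    intro o q hq
    rw [Nat.mul_add_div hk, Nat.mul_add_mod, Nat.div_eq_of_lt hq, Nat.mod_eq_of_lt hq]
    exact ⟨rfl, rfl⟩
  have hs : ∀ b (q : Fin k) (a : Fin m), C.raw.succ b q a < k := by
    intro b q a
    rw [DROCA.raw_succ]; split_ifs <;> exact Fin.is_lt _
  obtain ⟨E, hE1, hE2, hE3, hE4, hE5⟩ := DROCA.exists_raw_eq_mk c
    (n := (R.length + 1) * k) (i := C.raw.1)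
    (by rw [hCi]; have := hlt 0 C.init (Nat.zero_le _) C.init.2; simpa using this)
    (fun s => if s / k < R.length then f (R.getD (s / k) []) else C.raw.fin (s % k))
    (fun b s a => k * next (rawAlphabet c) R S f (s / k) a + C.raw.succ b (s % k) a)
    (fun b q a _ _ ha => hlt _ _ (next_le _ _) (hs b ⟨q % k, Nat.mod_lt _ hk⟩ ⟨a, ha⟩))
  refine ⟨E, hE1, hE2, ?_⟩
  -- Both automata follow the alphabet, so their heights agree and the component for `C` always uses
  -- the transition function that `C` itself would use.
  have hrun : ∀ w, ((E.run w).1 : ℕ) = k * cls (rawAlphabet c) R S f (rawWord w) + (C.run w).1 := by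
    intro w
    induction w using List.reverseRecOn with
    | nil => show (E.init : ℕ) = k * 0 + C.init; rw [hE3, hCi]; omega
    | append_singleton w a ih =>
      rw [DROCA.run_append, DROCA.run_append, rawWord_append, rawWord_singleton, cls_concat]
      have h1 : (E.run w).2 = (C.run w).2 := (hE1.ce_eq w).trans (hCV.ce_eq w).symm
      have h2 := hE5 (E.run w).1 (E.run w).2 a
      have h3 := DROCA.step_fst C (C.run w) a
      have h4 := hdiv (cls (rawAlphabet c) R S f (rawWord w)) (C.run w).1 (C.run w).1.2
      rw [← ih] at h4
      show ((E.step (E.run w) a).1 : ℕ) = _ + ((C.step (C.run w) a).1 : ℕ)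
      rw [h3, h2, h4.1, h4.2, h1]
      simp only [RawAut.succ]
      split_ifs <;> simp_all
  intro w
  have h4 := hdiv (cls (rawAlphabet c) R S f (rawWord w)) (C.run w).1 (C.run w).1.2
  rw [DROCA.out, hE4, hrun, h4.1, h4.2, DROCA.raw_fin]; rfl

end Learner

/-! ## The propositional formula -/

namespace Learner

theorem var_lt {B t x y z w : ℕ} (ht : t < 4) (hx : x < B) (hy : y < B) (hz : z < B) (hw : w < B) :
    var B t x y z w < numVars B := by
  have key : ∀ {a b y : ℕ}, a < b → y < B → a * B + y < b * B := by
    intro a b y hab hy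
    calc a * B + y < (a + 1) * B := by rw [Nat.add_mul]; omega
      _ ≤ b * B := Nat.mul_le_mul_right _ hab
  exact key (key (key (key ht hx) hy) hz) hw

/-- Reads each clause with negative literals as an implication. -/
theorem forall_clauses_iff {cs : RawAlphabet} {k l B : ℕ} {D : RawAut} {g : ℕ → Bool} :
    (∀ C ∈ clauses cs k l D B, ∃ x ∈ C, g x.1 = x.2) ↔
      (∀ b < 2, ∀ q < k, ∀ a < cs.length, ∃ q' < k, g (var B b q a q' 0) = true) ∧
      g (var B 3 0 0 0 D.1) = true ∧
      (∀ i < l, ∀ h < l, ∀ q < k, ∀ d < D.2.length, g (var B 3 i h q d) = true →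
        g (var B 2 q 0 0 0) = D.fin d) ∧
      (∀ i < l, ∀ h < l, ∀ q < k, ∀ d < D.2.length, ∀ a < cs.length, ∀ q' < k,
        g (var B 3 i h q d) = true → g (var B (if h = 0 then 0 else 1) q a q' 0) = true →
        g (var B 3 (i + 1) (up cs h a) q' (D.succ h d a)) = true) := by
  simp only [clauses, List.forall_mem_append, List.forall_mem_map, List.forall_mem_singleton]
  simp only [List.mem_map, Prod.forall, List.mem_product, List.mem_range, List.mem_cons,
    List.not_mem_nil, or_false, exists_eq_left, exists_eq_or_imp, exists_exists_and_eq_and,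
    and_imp, and_assoc]
  refine and_congr ?_ (and_congr Iff.rfl (and_congr ?_ ?_))
  · exact ⟨fun h b hb q hq a ha => h b q a hb hq ha, fun h b q a hb hq ha => h b hb q hq a ha⟩
  · constructor
    · intro H i hi h hh q hq d hd h1
      rcases H i h q d hi hh hq hd with h2 | h2
      · rw [h1] at h2; simp at h2
      · exact h2
    · intro H i h q d hi hh hq hd
      cases h1 : g (var B 3 i h q d)
      · exact .inl rfl
      · exact .inr (H i hi h hh q hq d hd h1)
  · constructor
    · intro H i hi h hh q hq d hd a ha q' hq' h1 h3
      rcases H i h q d a q' hi hh hq hd ha hq' with h2 | h2 | h2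
      · rw [h1] at h2; simp at h2
      · rw [h3] at h2; simp at h2
      · exact h2
    · intro H i h q d a q' hi hh hq hd ha hq'
      cases h1 : g (var B 3 i h q d)
      · exact .inl rfl
      · cases h3 : g (var B (if h = 0 then 0 else 1) q a q' 0)
        · exact .inr (.inl rfl)
        · exact .inr (.inr (H i hi h hh q hq d hd a ha q' hq' h1 h3))

theorem clauses_lt {m n k l B : ℕ} (c : VisibleAlphabet (Fin m)) (D : DROCA (Fin n) (Fin m))
    (hB : m + k + l + n + 3 ≤ B) :
    ∀ C ∈ clauses (rawAlphabet c) k l D.raw B, ∀ x ∈ C, x.1 < numVars B := by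
  have hi : D.raw.1 < n := D.init.2
  simp only [clauses, List.forall_mem_append, List.forall_mem_map, List.forall_mem_singleton,
    List.forall_mem_cons, length_rawAlphabet, DROCA.length_raw]
  simp only [Prod.forall, List.mem_product, List.mem_range, and_imp]
  refine ⟨⟨⟨?_, ?_⟩, ?_⟩, ?_⟩
  · intro b q a hb hq ha q' hq'
    exact var_lt (by omega) (by omega) (by omega) (by omega) (by omega)
  · exact var_lt (by omega) (by omega) (by omega) (by omega) (by omega)
  · intro i h q d hi hh hq hd
    exact ⟨var_lt (by omega) (by omega) (by omega) (by omega) (by omega),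
      var_lt (by omega) (by omega) (by omega) (by omega) (by omega)⟩
  · intro i h q d a q' hi hh hq hd ha hq'
    refine ⟨var_lt (by omega) (by omega) (by omega) (by omega) (by omega), ?_, ?_⟩
    · exact var_lt (by split_ifs <;> omega) (by omega) (by omega) (by omega) (by omega)
    · have h1 : D.raw.succ h d a < n := by
        have := DROCA.raw_succ D h ⟨d, hd⟩ ⟨a, ha⟩
        simp only at this
        rw [this]; split_ifs <;> exact Fin.is_lt _
      have h2 : up (rawAlphabet c) h a ≤ h + 1 := by
        have := up_rawAlphabet c h ⟨a, ha⟩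
        simp only at this
        rw [this]; exact c.next_le _ _
      exact var_lt (by omega) (by omega) (by omega) (by omega) (by omega)

/-- A satisfying assignment describes an automaton that agrees with `D` on short words. -/
theorem exists_decode {m n k l B : ℕ} {c : VisibleAlphabet (Fin m)} {D : DROCA (Fin n) (Fin m)}
    (hD : D.IsVOCA c) (hk : 0 < k) (hB : m + k + l + n + 3 ≤ B) {g : ℕ → Bool}
    (hg : ∀ C ∈ clauses (rawAlphabet c) k l D.raw B, ∃ x ∈ C, g x.1 = x.2) {bits : List ℕ}
    (hb : ∀ v < numVars B, (bits.getD v 0 == 1) = g v) :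
    ∃ C : DROCA (Fin k) (Fin m), C.IsVOCA c ∧ C.raw = decode (rawAlphabet c) k B bits ∧
      ∀ w, w.length < l → C.out w = D.out w := by
  obtain ⟨h1, h2, h3, h4⟩ := forall_clauses_iff.1 hg
  rw [length_rawAlphabet, DROCA.length_raw] at *
  -- `decode` takes the first successor that the assignment permits; the first group of clauses
  -- guarantees that there is one.
  have hδ : ∀ b q a, b < 2 → q < k → a < m →
      ∃ hlt : (List.range k).findIdx (fun q' => bits.getD (var B b q a q' 0) 0 == 1) < k,
      g (var B b q a ((List.range k).findIdx fun q' => bits.getD (var B b q a q' 0) 0 == 1) 0) =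
        true := by
    intro b q a hb' hq ha
    obtain ⟨q', hq', h⟩ := h1 b hb' q hq a ha
    have h5 : (List.range k).findIdx (fun q' => bits.getD (var B b q a q' 0) 0 == 1) <
        (List.range k).length := List.findIdx_lt_length_of_exists ⟨q', List.mem_range.2 hq', by
      rw [hb _ (var_lt (by omega) (by omega) (by omega) (by omega) (by omega)), h]⟩
    have h6 := List.findIdx_getElem (w := h5)
    rw [List.getElem_range] at h6
    rw [List.length_range] at h5
    refine ⟨h5, ?_⟩
    rwa [hb _ (var_lt (by omega) (by omega) (by omega) (by omega) (by omega))] at h6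
  obtain ⟨C, hC1, hC2, hC3, hC4, hC5⟩ := DROCA.exists_raw_eq_mk c (n := k) hk
    (fun q => bits.getD (var B 2 q 0 0 0) 0 == 1)
    (fun b q a => (List.range k).findIdx fun q' => bits.getD (var B b q a q' 0) 0 == 1)
    (fun b q a hb hq ha => (hδ b q a hb hq ha).1)
  refine ⟨C, hC1, hC2, ?_⟩
  have hht : ∀ w, c.height 0 w ≤ w.length := fun w => by simpa using c.height_le 0 w
  have key : ∀ w, w.length < l →
      g (var B 3 w.length (c.height 0 w) (C.run w).1 (D.run w).1) = true := by
    intro w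
    induction w using List.reverseRecOn with
    | nil =>
      intro _
      show g (var B 3 0 0 C.init D.init) = true
      rw [hC3]; exact h2
    | append_singleton w a ih =>
      intro hw
      rw [List.length_append, List.length_singleton] at hw ⊢
      have h5 := hht w
      have h6 := (hδ (if c.height 0 w = 0 then 0 else 1) (C.run w).1 a
        (by split_ifs <;> omega) (C.run w).1.2 a.2).2
      have h7 := h4 w.length (by omega) (c.height 0 w) (by omega) (C.run w).1 (C.run w).1.2
        (D.run w).1 (D.run w).1.2 a a.2 _ (hδ (if c.height 0 w = 0 then 0 else 1) (C.run w).1 a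
        (by split_ifs <;> omega) (C.run w).1.2 a.2).1 (ih (by omega)) h6
      have h8 : (C.run w).2 = c.height 0 w := hC1.ce_eq w
      have h9 : (D.run w).2 = c.height 0 w := hD.ce_eq w
      have h10 := hC5 (C.run w).1 (C.run w).2 a
      have h11 := DROCA.step_fst D (D.run w) a
      rw [h8] at h10
      rw [h9] at h11
      rw [up_rawAlphabet, ← h11, ← h10] at h7
      rw [DROCA.run_append, DROCA.run_append, c.height_append]
      rw [← h8] at h7
      rw [← h8]
      exact h7
  intro w hw
  have h5 := hht w
  have h6 := h3 w.length hw (c.height 0 w) (by omega) _ (C.run w).1.2 _ (D.run w).1.2 (key w hw)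
  have h7 := (C.run w).1.2
  rw [DROCA.raw_fin, ← hb _ (var_lt (by omega) (by omega) (by omega) (by omega) (by omega)),
    ← hC4] at h6
  exact h6

/-- The formula is satisfiable if there is an automaton that agrees with `D` on short words. -/
theorem exists_assignment {m n k l B : ℕ} {c : VisibleAlphabet (Fin m)}
    {D : DROCA (Fin n) (Fin m)} (hD : D.IsVOCA c) {C : DROCA (Fin k) (Fin m)} (hC : C.IsVOCA c)
    (hi : (C.init : ℕ) = 0) (hB : m + k + l + n + 3 ≤ B)
    (hCD : ∀ w, w.length < l → C.out w = D.out w) :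
    ∃ g : ℕ → Bool, ∀ C ∈ clauses (rawAlphabet c) k l D.raw B, ∃ x ∈ C, g x.1 = x.2 := by
  classical
  -- The intended meaning of the four families: transitions and final states are those of `C`, and
  -- joint reachability means that an actual word leads to the tuple. The function `g` below
  -- recovers the digits.
  let G : ℕ → ℕ → ℕ → ℕ → ℕ → Bool := fun t x y z v =>
    if t < 2 then decide (C.raw.succ t x y = z) else if t = 2 then C.raw.fin x else
      decide (∃ w : List (Fin m), w.length = x ∧ c.height 0 w = y ∧ ((C.run w).1 : ℕ) = z ∧
        ((D.run w).1 : ℕ) = v)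
  let g : ℕ → Bool := fun v => G (v / B / B / B / B) (v / B / B / B % B) (v / B / B % B)
    (v / B % B) (v % B)
  have hg : ∀ t x y z v, x < B → y < B → z < B → v < B → g (var B t x y z v) = G t x y z v := by
    intro t x y z v hx hy hz hv
    have h0 : 0 < B := by omega
    have h1 : ∀ a b, b < B → (a * B + b) / B = a ∧ (a * B + b) % B = b := by
      intro a b hb
      rw [Nat.mul_comm, Nat.mul_add_div h0, Nat.mul_add_mod, Nat.div_eq_of_lt hb,
        Nat.mod_eq_of_lt hb]
      exact ⟨rfl, rfl⟩
    simp only [g, var, h1 _ _ hx, h1 _ _ hy, h1 _ _ hz, h1 _ _ hv]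
  have hDi : D.raw.1 < n := D.init.2
  refine ⟨g, forall_clauses_iff.2 ⟨?_, ?_, ?_, ?_⟩⟩
  · intro b hb q hq a ha
    rw [length_rawAlphabet] at ha
    have h1 : C.raw.succ b q a < k := by
      have := DROCA.raw_succ C b ⟨q, hq⟩ ⟨a, ha⟩
      simp only at this
      rw [this]; split_ifs <;> exact Fin.is_lt _
    refine ⟨_, h1, ?_⟩
    rw [hg _ _ _ _ _ (by omega) (by omega) (by omega) (by omega)]
    simp only [G, if_pos hb, decide_true]
  · rw [hg _ _ _ _ _ (by omega) (by omega) (by omega) (by omega)]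
    have : ∃ w : List (Fin m), w.length = 0 ∧ c.height 0 w = 0 ∧ ((C.run w).1 : ℕ) = 0 ∧
        ((D.run w).1 : ℕ) = D.raw.1 := ⟨[], rfl, rfl, hi, rfl⟩
    simpa [G] using this
  · intro i hi h hh q hq d hd
    rw [DROCA.length_raw] at hd
    rw [hg _ _ _ _ _ (by omega) (by omega) (by omega) (by omega),
      hg _ _ _ _ _ (by omega) (by omega) (by omega) (by omega)]
    simp only [G, lt_irrefl, if_true, if_false, show ¬3 < 2 by omega, show ¬3 = 2 by omega,
      decide_eq_true_iff]
    rintro ⟨w, rfl, -, rfl, rfl⟩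
    rw [DROCA.raw_fin, DROCA.raw_fin]
    exact hCD w hi
  · intro i hi h hh q hq d hd a ha q' hq'
    rw [DROCA.length_raw] at hd
    rw [length_rawAlphabet] at ha
    have h1 : D.raw.succ h d a < n := by
      have := DROCA.raw_succ D h ⟨d, hd⟩ ⟨a, ha⟩
      simp only at this
      rw [this]; split_ifs <;> exact Fin.is_lt _
    have h2 : up (rawAlphabet c) h a ≤ h + 1 := by
      have := up_rawAlphabet c h ⟨a, ha⟩
      simp only at this
      rw [this]; exact c.next_le _ _
    rw [hg _ _ _ _ _ (by omega) (by omega) (by omega) (by omega),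
      hg _ _ _ _ _ (by omega) (by omega) (by omega) (by omega),
      hg _ _ _ _ _ (by omega) (by omega) (by omega) (by omega)]
    simp only [G, if_false, show ¬3 < 2 by omega, show ¬3 = 2 by omega,
      show (if h = 0 then 0 else 1) < 2 by split_ifs <;> omega, if_true, decide_eq_true_iff]
    rintro ⟨w, rfl, rfl, rfl, rfl⟩ h3
    have h8 : (C.run w).2 = c.height 0 w := hC.ce_eq w
    have h9 : (D.run w).2 = c.height 0 w := hD.ce_eq w
    have h10 := DROCA.step_fst C (C.run w) ⟨a, ha⟩
    have h11 := DROCA.step_fst D (D.run w) ⟨a, ha⟩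
    refine ⟨w ++ [⟨a, ha⟩], by simp, ?_, ?_, ?_⟩
    · rw [c.height_append]
      exact (up_rawAlphabet c _ ⟨a, ha⟩).symm
    · rw [DROCA.run_append]
      refine h10.trans ?_
      rw [h8, ← h3]
      simp only [RawAut.succ]
      split_ifs <;> simp_all
    · rw [DROCA.run_append]
      refine h11.trans ?_
      rw [h9]

/-- Raw clauses as a formula. -/
theorem exists_formula {n : ℕ} (cl : List (List (ℕ × Bool))) (h : ∀ C ∈ cl, ∀ x ∈ C, x.1 < n) :
    ∃ φ : CNFFormula n, φ.map (fun C => C.map fun x => ((x.1 : ℕ), x.2)) = cl := by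
  have h1 : ∀ C : List (ℕ × Bool), (∀ x ∈ C, x.1 < n) →
      ∃ C' : List (Fin n × Bool), C'.map (fun x => ((x.1 : ℕ), x.2)) = C := by
    intro C
    induction C with
    | nil => exact fun _ => ⟨[], rfl⟩
    | cons x C ih =>
      intro h
      obtain ⟨C', hC'⟩ := ih fun y hy => h y (List.mem_cons_of_mem _ hy)
      exact ⟨(⟨x.1, h x List.mem_cons_self⟩, x.2) :: C', by simp [hC']⟩
  induction cl with
  | nil => exact ⟨[], rfl⟩
  | cons C cl ih =>
    obtain ⟨φ, hφ⟩ := ih fun y hy => h y (List.mem_cons_of_mem _ hy)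
    obtain ⟨C', hC'⟩ := h1 C (h C List.mem_cons_self)
    exact ⟨C' :: φ, by rw [List.map_cons, hC', hφ]⟩

theorem satisfiedBy_iff {n : ℕ} (φ : CNFFormula n) (g : ℕ → Bool) :
    φ.SatisfiedBy (fun v => g v) ↔
      ∀ C ∈ φ.map (fun C => C.map fun x => ((x.1 : ℕ), x.2)), ∃ x ∈ C, g x.1 = x.2 := by
  simp only [CNFFormula.SatisfiedBy, List.forall_mem_map]
  simp only [List.mem_map, exists_exists_and_eq_and]

end Learner

/-! ## Budgets -/

section Budgets

variable {p : Prog} {Q : Type} {m : ℕ} {c : VisibleAlphabet (Fin m)} {A : DROCA Q (Fin m)}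

/-- Only `halt` allows for unused budget, so the surplus is carried down to the end of every branch.
-/
theorem Prog.LearnsFrom.mono {x : Data} {M E S T M' E' S' T' : ℕ} (h : p.LearnsFrom c A x M E S T)
    (hM : M ≤ M') (hE : E ≤ E') (hS : S ≤ S') (hT : T ≤ T') : p.LearnsFrom c A x M' E' S' T' := by
  induction h generalizing M' E' S' T' with
  | halt B hr ht hB => exact .halt B hr (ht.trans hT) hB
  | membership w hr _ ih =>
    obtain ⟨a, rfl⟩ := Nat.exists_eq_add_of_le' hM
    obtain ⟨b, rfl⟩ := Nat.exists_eq_add_of_le' hT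
    convert membership w hr (ih (Nat.le_add_left _ a) hE hS (Nat.le_add_left _ b)) using 1 <;> omega
  | equivalence C hr _ ih =>
    obtain ⟨a, rfl⟩ := Nat.exists_eq_add_of_le' hE
    obtain ⟨b, rfl⟩ := Nat.exists_eq_add_of_le' hT
    convert equivalence C hr (fun d hd => ih d hd hM (Nat.le_add_left _ a) hS
      (Nat.le_add_left _ b)) using 1 <;> omega
  | sat φ hr _ ih =>
    obtain ⟨a, rfl⟩ := Nat.exists_eq_add_of_le' hS
    obtain ⟨b, rfl⟩ := Nat.exists_eq_add_of_le' hT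
    convert sat φ hr (fun d hd => ih d hd hM hE (Nat.le_add_left _ a)
      (Nat.le_add_left _ b)) using 1 <;> omega

/-- From the tree `x` on, the learner succeeds with the given numbers of queries and at most `τ`
steps in each round. -/
def Good (p : Prog) (c : VisibleAlphabet (Fin m)) (A : DROCA Q (Fin m)) (τ : ℕ) (x : Data)
    (M E S : ℕ) : Prop :=
  p.LearnsFrom c A x M E S ((M + E + S + 1) * τ)

/-- The learner succeeds from every tree on that is mapped to `y` in at most `τ` steps. -/
def Res (p : Prog) (c : VisibleAlphabet (Fin m)) (A : DROCA Q (Fin m)) (τ : ℕ) (y : Data)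
    (M E S : ℕ) : Prop :=
  ∀ x, (∃ t ≤ τ, p.Runs x y t) → Good p c A τ x M E S

variable {τ M E S M' E' S' : ℕ} {x y : Data}

theorem Good.mono (h : Good p c A τ x M E S) (hM : M ≤ M') (hE : E ≤ E') (hS : S ≤ S') :
    Good p c A τ x M' E' S' :=
  Prog.LearnsFrom.mono h hM hE hS (Nat.mul_le_mul_right _ (by omega))

theorem Res.mono (h : Res p c A τ y M E S) (hM : M ≤ M') (hE : E ≤ E') (hS : S ≤ S') :
    Res p c A τ y M' E' S' :=
  fun x hx => (h x hx).mono hM hE hS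

/-- The answer to a membership query as it is seen by the learner. -/
def boolAnswer (b : Bool) : Option Word := bif b then some [] else none

theorem enc_boolAnswer (w : List (Fin m)) : enc (boolAnswer (A.out w)) = membershipAnswer A w := by
  classical
  have h : A.out w = true ↔ w ∈ A.language := DROCA.mem_language.symm
  rw [membershipAnswer]
  cases h1 : A.out w <;> simp only [h1, Bool.false_eq_true, false_iff, true_iff] at h
  · rw [decide_eq_false h]; rfl
  · rw [decide_eq_true h]; rfl

/-- One request costs one round, that is, one more `τ` in the time budget of `Good`. A Boolean
answer, a counterexample and an assignment can all be read as an `Option Word`, so a single type of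
answers suffices. -/
theorem Res.membership {w : List (Fin m)} {μ : Learner.Mem}
    (h : Good p c A τ (.cons (enc (boolAnswer (A.out w))) (enc μ)) M E S) :
    Res p c A τ (enc ((0, rawWord w), μ)) (M + 1) E S := by
  rintro x ⟨t, ht, hr⟩
  have h1 : enc ((0, rawWord w), μ) = .cons (Request.membership w).toData (enc μ) := by
    rw [enc_pair, enc_pair, enc_rawWord]; rfl
  rw [h1] at hr
  rw [enc_boolAnswer] at h
  exact (Prog.LearnsFrom.membership w hr h).mono le_rfl le_rfl le_rfl (by
    rw [show M + 1 + E + S + 1 = (M + E + S + 1) + 1 by omega,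
      Nat.add_mul (M + E + S + 1) 1, Nat.one_mul]; omega)

theorem Res.equivalence {n : ℕ} {C : DROCA (Fin n) (Fin m)} {μ : Learner.Mem}
    (h₁ : C.CounterSynchronised A → C.Equivalent A →
      Good p c A τ (.cons (enc (none : Option Word)) (enc μ)) M E S)
    (h₂ : ∀ z, A.IsMinimalCounterexample C z →
      Good p c A τ (.cons (enc (some (rawWord z))) (enc μ)) M E S) :
    Res p c A τ (enc ((1, C.raw), μ)) M (E + 1) S := by
  rintro x ⟨t, ht, hr⟩
  have h1 : enc ((1, C.raw), μ) = .cons (Request.equivalence n C).toData (enc μ) := by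
    rw [enc_pair, enc_pair, C.enc_raw]; rfl
  rw [h1] at hr
  refine (Prog.LearnsFrom.equivalence (T := (M + E + S + 1) * τ) C hr fun a ha => ?_).mono
    le_rfl le_rfl le_rfl (by
      rw [show M + (E + 1) + S + 1 = (M + E + S + 1) + 1 by omega,
      Nat.add_mul (M + E + S + 1) 1, Nat.one_mul]; omega)
  rcases ha with ⟨h3, h4⟩ | ⟨z, hz⟩
  · exact h₁ h3 h4
  · rw [← enc_rawWord]; exact h₂ z hz

/-- Clauses and assignments use plain numbers for variables here, to match the data that the learner
computes; the bound on the variables makes this a genuine formula. -/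
theorem Res.sat {n : ℕ} {cl : List (List (ℕ × Bool))} {μ : Learner.Mem}
    (hcl : ∀ C ∈ cl, ∀ x ∈ C, x.1 < n)
    (h₁ : (∀ g : ℕ → Bool, ¬∀ C ∈ cl, ∃ x ∈ C, g x.1 = x.2) →
      Good p c A τ (.cons (enc (none : Option Word)) (enc μ)) M E S)
    (h₂ : ∀ (bits : List ℕ) (g : ℕ → Bool), bits.length = n → (∀ b ∈ bits, b ≤ 1) →
      (∀ C ∈ cl, ∃ x ∈ C, g x.1 = x.2) → (∀ v < n, (bits.getD v 0 == 1) = g v) →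
      Good p c A τ (.cons (enc (some bits)) (enc μ)) M E S) :
    Res p c A τ (enc ((2, n, cl), μ)) M E (S + 1) := by
  rintro x ⟨t, ht, hr⟩
  obtain ⟨φ, hφ⟩ := Learner.exists_formula cl hcl
  have h1 : enc ((2, n, cl), μ) = .cons (Request.sat (m := m) n φ).toData (enc μ) := by
    have : enc cl = Data.ofList (φ.map fun C => .ofList
        (C.map fun l => .cons (.ofNat l.1) (.ofBool l.2))) := by
      rw [← hφ]
      show Data.ofList ((φ.map fun C => C.map fun x => ((x.1 : ℕ), x.2)).map enc) = _
      rw [List.map_map]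
      congr 1
      refine List.map_congr_left fun C _ => ?_
      show Data.ofList ((C.map fun x => ((x.1 : ℕ), x.2)).map enc) = _
      rw [List.map_map]
      rfl
    rw [enc_pair, enc_pair, enc_pair, this]; rfl
  rw [h1] at hr
  refine (Prog.LearnsFrom.sat (T := (M + E + S + 1) * τ) φ hr fun a ha => ?_).mono
    le_rfl le_rfl le_rfl (by
      rw [show M + E + (S + 1) + 1 = (M + E + S + 1) + 1 by omega,
      Nat.add_mul (M + E + S + 1) 1, Nat.one_mul]; omega)
  rcases ha with h3 | ⟨f, hf⟩
  · refine h₁ fun g hg => h3 (fun v => g v) ?_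
    rw [Learner.satisfiedBy_iff, hφ]; exact hg
  · have h4 : enc (List.ofFn fun v => (f v).toNat) =
        Data.ofList (List.ofFn fun v => Data.ofBool (f v)) := by
      rw [enc_ofFn]
      congr 2
      funext v
      cases f v <;> rfl
    rw [← h4]
    refine h₂ (List.ofFn fun v => (f v).toNat)
      (fun v => if h : v < n then f ⟨v, h⟩ else false) List.length_ofFn ?_ ?_ ?_
    · intro b hb
      obtain ⟨v, rfl⟩ := (List.mem_ofFn' _ _).1 hb
      exact Bool.toNat_le _
    · rw [← hφ]
      refine (Learner.satisfiedBy_iff φ fun v => if h : v < n then f ⟨v, h⟩ else false).1 ?_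
      simpa using hf
    · intro v hv
      rw [List.getD_eq_getElem _ _ (by simpa using hv), dif_pos hv]
      simp

theorem Res.halt {n : ℕ} {B : DROCA (Fin n) (Fin m)} {μ : Learner.Mem}
    (h : IsMinimalVOCAFor c A B) : Res p c A τ (enc ((3, B.raw), μ)) M E S := by
  rintro x ⟨t, ht, hr⟩
  have h1 : enc ((3, B.raw), μ) = .cons (Request.halt n B).toData (enc μ) := by
    rw [enc_pair, enc_pair, B.enc_raw]; rfl
  rw [h1] at hr
  exact .halt B hr (ht.trans (by rw [Nat.add_mul _ 1]; omega)) h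

end Budgets

/-! ## Sizes -/

namespace Learner

/-- A bound on the number of representatives in the table. -/
def boundR (n : ℕ) : ℕ := n * (2 * n * n + 1)

/-- A bound on the potential of the memory. -/
def boundΦ (n : ℕ) : ℕ := n + 3 * boundR n + 2

/-- The invariant `Ready.l_le` gives at most `2 * boundR n + 2` before an increment. -/
def boundL (n : ℕ) : ℕ := 2 * boundR n + 3

/-- A bound on the numbers of states of the automata in the memory. -/
def boundE (n : ℕ) : ℕ := (boundR n + 1) * n + 1

/-- A bound on the lengths of minimal counterexamples. -/
def boundZ (n : ℕ) : ℕ := (n + boundE n) * (n * n + boundE n * boundE n + 1) + 1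

/-- One initial suffix, and in each iteration the suffixes of at most two counterexamples. The last
summand leaves room for the current iteration. -/
def boundS (n : ℕ) : ℕ := 1 + 2 * (boundZ n + 1) * (boundΦ n + 1)

/-- A bound on the number of required memberships. -/
def boundW (n : ℕ) : ℕ := (boundR n + boundR n * n) * boundS n

/-- A bound on the sizes of words of length `l`. -/
def boundWord (n l : ℕ) : ℕ := l * (2 * n + 2) + 1

def boundAut (n : ℕ) : ℕ :=
  (2 * boundE n + 1) + (boundE n * (3 + (n * (2 * (2 * boundE n + 7) + 2) + 1) + 1 + 1) + 1) + 1

def boundB (n : ℕ) : ℕ := n + n + boundL n + boundE n + 3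

/-- A bound on the sizes of the answers. -/
def boundAnswer (n : ℕ) : ℕ :=
  boundWord n (boundZ n) + (numVars (boundB n) * 4 + 1) + 2

/-- A bound on the sizes of the trees that the learner is run on. -/
def boundX (n : ℕ) : ℕ :=
  boundAnswer n + 7 + (n * 12 + 1) + (2 * n + 1) + (2 * boundL n + 1) + 3 * boundAut n +
    (boundR n * (boundWord n (boundR n) + 1) + 1) + (boundS n * (boundWord n (boundZ n) + 1) + 1) +
    ((boundW n + 1) * (boundWord n (boundR n + 1 + boundZ n) + 4 + 1) + 1) +
    boundWord n (boundR n + 1 + boundZ n) + 11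

section Poly

variable {ι : Type} {s t u : ι → ℕ}

theorem polyLE_boundR (h : PolyLE s t) : PolyLE s fun i => boundR (t i) :=
  .mul h (.add (.mul (.mul (.const 2) h) h) (.const 1))

theorem polyLE_boundΦ (h : PolyLE s t) : PolyLE s fun i => boundΦ (t i) :=
  .add (.add h (.mul (.const 3) (polyLE_boundR h))) (.const 2)

theorem polyLE_boundL (h : PolyLE s t) : PolyLE s fun i => boundL (t i) :=
  .add (.mul (.const 2) (polyLE_boundR h)) (.const 3)

theorem polyLE_boundE (h : PolyLE s t) : PolyLE s fun i => boundE (t i) :=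
  .add (.mul (.add (polyLE_boundR h) (.const 1)) h) (.const 1)

theorem polyLE_boundZ (h : PolyLE s t) : PolyLE s fun i => boundZ (t i) :=
  .add (.mul (.add h (polyLE_boundE h)) (.add (.add (.mul h h)
    (.mul (polyLE_boundE h) (polyLE_boundE h))) (.const 1))) (.const 1)

theorem polyLE_boundS (h : PolyLE s t) : PolyLE s fun i => boundS (t i) :=
  .add (.const 1) (.mul (.mul (.const 2) (.add (polyLE_boundZ h) (.const 1)))
    (.add (polyLE_boundΦ h) (.const 1)))

theorem polyLE_boundW (h : PolyLE s t) : PolyLE s fun i => boundW (t i) :=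
  .mul (.add (polyLE_boundR h) (.mul (polyLE_boundR h) h)) (polyLE_boundS h)

theorem polyLE_boundWord (h : PolyLE s t) (h' : PolyLE s u) :
    PolyLE s fun i => boundWord (t i) (u i) :=
  .add (.mul h' (.add (.mul (.const 2) h) (.const 2))) (.const 1)

theorem polyLE_boundAut (h : PolyLE s t) : PolyLE s fun i => boundAut (t i) :=
  .add (.add (.add (.mul (.const 2) (polyLE_boundE h)) (.const 1)) (.add (.mul (polyLE_boundE h)
    (.add (.add (.add (.const 3) (.add (.mul h (.add (.mul (.const 2)
      (.add (.mul (.const 2) (polyLE_boundE h)) (.const 7))) (.const 2))) (.const 1)))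
      (.const 1)) (.const 1))) (.const 1))) (.const 1)

theorem polyLE_boundB (h : PolyLE s t) : PolyLE s fun i => boundB (t i) :=
  .add (.add (.add (.add h h) (polyLE_boundL h)) (polyLE_boundE h)) (.const 3)

theorem polyLE_boundAnswer (h : PolyLE s t) : PolyLE s fun i => boundAnswer (t i) :=
  .add (.add (polyLE_boundWord h (polyLE_boundZ h)) (.add (.mul (.mul (.mul (.mul (.mul (.const 4)
    (polyLE_boundB h)) (polyLE_boundB h)) (polyLE_boundB h)) (polyLE_boundB h)) (.const 4))
    (.const 1))) (.const 2)

theorem polyLE_boundX (h : PolyLE s t) : PolyLE s fun i => boundX (t i) := by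
  have hR := polyLE_boundR h
  have hZ := polyLE_boundZ h
  have hw := polyLE_boundWord h (.add (.add hR (.const 1)) hZ)
  refine .add (.add (.add (.add (.add (.add (.add (.add (.add (.add (polyLE_boundAnswer h)
    (.const 7)) (.add (.mul h (.const 12)) (.const 1))) (.add (.mul (.const 2) h) (.const 1)))
    (.add (.mul (.const 2) (polyLE_boundL h)) (.const 1))) (.mul (.const 3) (polyLE_boundAut h)))
    (.add (.mul hR (.add (polyLE_boundWord h hR) (.const 1))) (.const 1)))
    (.add (.mul (polyLE_boundS h) (.add (polyLE_boundWord h hZ) (.const 1))) (.const 1)))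
    (.add (.mul (.add (polyLE_boundW h) (.const 1)) (.add (.add hw (.const 4)) (.const 1)))
      (.const 1))) hw) (.const 11)

end Poly

theorem sz_valid {m n l : ℕ} (hm : m ≤ n) {w : Word} (hw : Valid m w) (hl : w.length ≤ l) :
    sz w ≤ boundWord n l := by
  obtain ⟨v, rfl⟩ := hw
  refine (sz_le_of_forall (b := 2 * n + 1) fun x hx => ?_).trans ?_
  · obtain ⟨a, -, rfl⟩ := List.mem_map.1 hx
    have := a.2
    rw [sz_nat]; omega
  · rw [boundWord]
    exact Nat.add_le_add_right (Nat.mul_le_mul_right _ hl) 1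

theorem sz_words {m n l b : ℕ} (hm : m ≤ n) {L : List Word} (hL : ∀ w ∈ L, Valid m w)
    (hl : ∀ w ∈ L, w.length ≤ l) (hb : L.length ≤ b) : sz L ≤ b * (boundWord n l + 1) + 1 := by
  refine (sz_le_of_forall fun w hw => sz_valid hm (hL w hw) (hl w hw)).trans ?_
  have := Nat.mul_le_mul_right (boundWord n l + 1) hb
  omega

theorem sz_zeroAction (x : ZeroAction) : sz x.code ≤ 5 := by cases x <;> simp [ZeroAction.code]

theorem sz_posAction (x : PosAction) : sz x.code ≤ 5 := by cases x <;> simp [PosAction.code]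

theorem sz_rawAlphabet {m n : ℕ} (hm : m ≤ n) (c : VisibleAlphabet (Fin m)) :
    sz (rawAlphabet c) ≤ n * 12 + 1 := by
  refine (sz_le_of_forall (b := 11) fun x hx => ?_).trans ?_
  · obtain ⟨a, rfl⟩ := (List.mem_ofFn' _ _).1 hx
    have := sz_zeroAction (c.zero a)
    have := sz_posAction (c.pos a)
    rw [sz_pair]; omega
  · rw [length_rawAlphabet]; omega

theorem sz_raw {m n N : ℕ} (hm : m ≤ n) (hN : N ≤ boundE n) (B : DROCA (Fin N) (Fin m)) :
    sz B.raw ≤ boundAut n := by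
  have h1 : ∀ q : Fin N, sz (q : ℕ) ≤ 2 * boundE n + 1 := fun q => by
    have := q.2; rw [sz_nat]; omega
  rw [DROCA.raw, sz_pair]
  refine Nat.add_le_add_right (Nat.add_le_add (h1 _) ?_) 1
  refine (sz_le_of_forall (b := 3 + (n * (2 * (2 * boundE n + 7) + 2) + 1) + 1)
    fun x hx => ?_).trans ?_
  · obtain ⟨q, rfl⟩ := (List.mem_ofFn' _ _).1 hx
    rw [sz_pair]
    refine Nat.add_le_add_right (Nat.add_le_add (sz_bool _) ?_) 1
    refine (sz_le_of_forall (b := 2 * (2 * boundE n + 7) + 1) fun x hx => ?_).trans ?_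
    · obtain ⟨a, rfl⟩ := (List.mem_ofFn' _ _).1 hx
      have := h1 (B.δ₀ q a).1
      have := h1 (B.δ₁ q a).1
      have := sz_zeroAction (B.δ₀ q a).2
      have := sz_posAction (B.δ₁ q a).2
      simp only [sz_pair]; omega
    · rw [List.length_ofFn]
      exact Nat.add_le_add_right (Nat.mul_le_mul_right _ hm) 1
  · rw [List.length_ofFn]
    exact Nat.add_le_add_right (Nat.mul_le_mul_right _ hN) 1

end Learner

/-! ## Filling the table -/

namespace Learner

/-- Needed when `k` raises the bound or counterexamples add suffixes. Closedness is not monotone in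
this way, which is why the table is filled again. -/
theorem Table.mono {cs : RawAlphabet} {H H' : ℕ} {f : Word → Bool} {R S S' : List Word}
    (hT : Table cs H f R S) (hH : H ≤ H') (hS : ∀ s ∈ S, s ∈ S') : Table cs H' f R S' where
  head := hT.head
  nil_mem := hS _ hT.nil_mem
  height_le r hr := (hT.height_le r hr).trans hH
  pairwise := hT.pairwise.imp fun {r u} h => by
    by_contra h'
    rw [Bool.not_eq_false, similar_iff] at h'
    rw [Bool.eq_false_iff, ne_eq, similar_iff] at h
    exact h ⟨h'.1, fun s hs => h'.2 s (hS s hs)⟩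

variable {Q : Type} {m : ℕ}

/-- The raw data belongs to an automaton with at most `boundE n` states. -/
def IsRaw (m n : ℕ) (C : RawAut) : Prop :=
  ∃ N ≤ boundE n, ∃ B : DROCA (Fin N) (Fin m), B.raw = C

/-- The invariants of the memory, with polynomial bounds in `n`. -/
structure Inv (c : VisibleAlphabet (Fin m)) (A : DROCA Q (Fin m)) (n : ℕ) (M : Mem) : Prop where
  cs_eq : M.cs = rawAlphabet c
  phase_le : M.phase ≤ 3
  k_pos : 0 < M.k
  k_le : ∀ n (B : DROCA (Fin n) (Fin m)), B.IsVOCA c → B.Equivalent A → M.k ≤ n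
  D_spec : ∃ N ≤ boundE n, ∃ D : DROCA (Fin N) (Fin m), D.IsVOCA c ∧ D.raw = M.D ∧
    ∀ w, w.length < M.l → D.out w = A.out w
  l_le : M.l ≤ boundL n
  table : Table (rawAlphabet c) M.H A.acc M.R M.S
  R_spec : ∀ r ∈ M.R, Valid m r ∧ r.length ≤ M.R.length
  S_spec : ∀ s ∈ M.S, Valid m s ∧ s.length ≤ boundZ n
  S_le : M.S.length ≤ boundS n
  F_spec : ∀ e ∈ M.F, A.acc e.1 = e.2 ∧ Valid m e.1 ∧ e.1.length ≤ boundR n + 1 + boundZ n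
  F_le : M.F.length ≤ boundW n + 1
  C_spec : IsRaw m n M.C
  E_spec : IsRaw m n M.E
  w_spec : Valid m M.w ∧ M.w.length ≤ boundR n + 1 + boundZ n

/-- Every round of the learner that starts with small data succeeds if its result does. -/
def Rounds (p : Prog) (c : VisibleAlphabet (Fin m)) (A : DROCA Q (Fin m)) (n τ : ℕ) : Prop :=
  ∀ (a : Option Word) (μ : Mem) (M E S : ℕ), sz (a, μ) ≤ boundX n →
    Res p c A τ (Mem.round (a, μ)) M E S → Good p c A τ (.cons (enc a) (enc μ)) M E S

/-- The memory after learning about the membership of a word. -/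
def Mem.record (M : Mem) (w : Word) (b : Bool) : Mem :=
  { M with phase := 0, w := w, F := (w, b) :: M.F }

def missingCount (M : Mem) : ℕ :=
  (required M.cs.length M.R M.S).countP fun w => !known M.F w

theorem missingCount_le (M : Mem) :
    missingCount M ≤ (required M.cs.length M.R M.S).length := List.countP_le_length

variable {p : Prog} {c : VisibleAlphabet (Fin m)} {A : DROCA Q (Fin m)} {n τ : ℕ} {M : Mem}

theorem length_required (m : ℕ) (R S : List Word) :
    (required m R S).length = (R.length + R.length * m) * S.length := by
  have h : ∀ L : List Word, (L.flatMap fun u => S.map fun s => u ++ s).length =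
      L.length * S.length := by
    intro L
    induction L with
    | nil => simp
    | cons u L ih => rw [List.flatMap_cons, List.length_append, ih, List.length_map,
        List.length_cons, Nat.succ_mul, Nat.add_comm]
  have h' : (extensions m R).length = R.length * m := by
    rw [extensions]
    induction R with
    | nil => simp
    | cons u R ih => rw [List.flatMap_cons, List.length_append, ih, List.length_map,
        List.length_range, List.length_cons, Nat.succ_mul, Nat.add_comm]
  rw [required, h, List.length_append, h']

theorem countP_lt {α : Type*} {p q : α → Bool} {L : List α} {w : α} (hw : w ∈ L) (hp : p w = true)
    (hq : q w = false) (h : ∀ x, q x = true → p x = true) : L.countP q < L.countP p := by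
  induction L with
  | nil => simp at hw
  | cons x L ih =>
    rw [List.countP_cons, List.countP_cons]
    have h1 : L.countP q ≤ L.countP p := List.countP_mono_left fun x _ => h x
    rcases List.mem_cons.1 hw with rfl | hw
    · rw [if_neg (by simp [hq]), if_pos hp]; omega
    · have := ih hw
      have := h x
      split_ifs <;> first | omega | simp_all

/-- `look` searches for a positive entry. That entries do not contradict each other follows from
their truth. -/
theorem look_eq_of_known {F : Facts} {f : Word → Bool} (hF : ∀ e ∈ F, f e.1 = e.2) {w : Word}
    (hw : known F w = true) : look F w = f w := by
  rw [known, List.any_eq_true] at hw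
  obtain ⟨e, he, h⟩ := hw
  rw [beq_iff_eq] at h
  subst h
  rw [look]
  cases h : f e.1 with
  | true => exact List.any_eq_true.2 ⟨e, he, by rw [← hF e he, h]; simp⟩
  | false =>
    rw [List.any_eq_false]
    intro e' he' h'
    rw [Bool.and_eq_true, beq_iff_eq] at h'
    have := hF e' he'
    rw [h'.1, h, h'.2] at this
    exact absurd this (by simp)

namespace Inv

theorem ask (hI : Inv c A n M) {w : Word} (hw : Valid m w)
    (hl : w.length ≤ boundR n + 1 + boundZ n) : Inv c A n { M with phase := 0, w := w } :=
  { hI with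
    phase_le := Nat.zero_le _
    w_spec := ⟨hw, hl⟩ }

theorem record (hI : Inv c A n M) {w : Word} {b : Bool} (hb : A.acc w = b) (hw : Valid m w)
    (hl : w.length ≤ boundR n + 1 + boundZ n) (hF : M.F.length ≤ boundW n) :
    Inv c A n (M.record w b) :=
  { hI with
    phase_le := Nat.zero_le _
    w_spec := ⟨hw, hl⟩
    F_spec := by
      rintro e (_ | ⟨_, he⟩)
      exacts [⟨hb, hw, hl⟩, hI.F_spec e he]
    F_le := Nat.succ_le_succ hF }

variable [Fintype Q]

theorem k_le_card (hA : A.IsVOCA c) (hI : Inv c A n M) : M.k ≤ Fintype.card Q :=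
  hI.k_le _ (A.rename (Fintype.equivFin Q)) (DROCA.rename_isVOCA _ hA)
    (DROCA.language_eq_iff.2 fun w => DROCA.rename_out _ A w)

theorem length_R_le (hA : A.IsVOCA c) (hI : Inv c A n M) :
    M.R.length ≤ boundR (Fintype.card Q) := by
  have h := hI.table.length_le hA (fun r hr => (hI.R_spec r hr).1) fun s hs => (hI.S_spec s hs).1
  refine h.trans (Nat.mul_le_mul_left _ (Nat.add_le_add_right ?_ 1))
  exact Nat.mul_le_mul (Nat.mul_le_mul_left _ (hI.k_le_card hA)) (hI.k_le_card hA)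

theorem boundR_mono {a b : ℕ} (h : a ≤ b) : boundR a ≤ boundR b :=
  Nat.mul_le_mul h (Nat.add_le_add_right (Nat.mul_le_mul (Nat.mul_le_mul_left _ h) h) 1)

theorem sz_le (hA : A.IsVOCA c) (hn : n = Fintype.card Q + m) (hI : Inv c A n M) {a : Option Word}
    (ha : sz a ≤ boundAnswer n) : sz (a, M) ≤ boundX n := by
  have hm : m ≤ n := by omega
  have hR := (hI.length_R_le hA).trans (boundR_mono (show _ ≤ n by omega))
  have h1 := sz_rawAlphabet hm c
  rw [← hI.cs_eq] at h1
  have h2 : sz M.D ≤ boundAut n := by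
    obtain ⟨N, hN, D, -, h, -⟩ := hI.D_spec
    rw [← h]; exact sz_raw hm hN D
  have h3 : sz M.C ≤ boundAut n := by
    obtain ⟨N, hN, D, h⟩ := hI.C_spec
    rw [← h]; exact sz_raw hm hN D
  have h4 : sz M.E ≤ boundAut n := by
    obtain ⟨N, hN, D, h⟩ := hI.E_spec
    rw [← h]; exact sz_raw hm hN D
  have h5 := sz_words hm (fun r hr => (hI.R_spec r hr).1) (fun r hr => (hI.R_spec r hr).2.trans hR)
    hR
  have h6 := sz_words hm (fun r hr => (hI.S_spec r hr).1) (fun r hr => (hI.S_spec r hr).2)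
    hI.S_le
  have h7 := sz_valid hm hI.w_spec.1 hI.w_spec.2
  have h8 : sz M.F ≤
      (boundW n + 1) * (boundWord n (boundR n + 1 + boundZ n) + 4 + 1) + 1 := by
    refine (sz_le_of_forall (b := boundWord n (boundR n + 1 + boundZ n) + 4) fun e he => ?_).trans
      (Nat.add_le_add_right (Nat.mul_le_mul_right _ hI.F_le) 1)
    have := sz_valid hm (hI.F_spec e he).2.1 (hI.F_spec e he).2.2
    have := sz_bool e.2
    obtain ⟨e1, e2⟩ := e
    dsimp only at *
    rw [sz_pair]; omega
  have h9 : sz M = sz M.toTuple := rfl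
  have h10 := hI.phase_le
  have h11 := hI.k_le_card hA
  have h12 := hI.l_le
  rw [sz_pair, h9]
  simp only [Mem.toTuple, sz_pair, sz_nat]
  rw [boundX]
  omega

theorem length_required_le (hA : A.IsVOCA c) (hn : n = Fintype.card Q + m) (hI : Inv c A n M) :
    (required M.cs.length M.R M.S).length ≤ boundW n := by
  have hR := (hI.length_R_le hA).trans (boundR_mono (show _ ≤ n by omega))
  rw [length_required, hI.cs_eq, length_rawAlphabet]
  exact Nat.mul_le_mul (Nat.add_le_add hR (Nat.mul_le_mul hR (by omega))) hI.S_le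

theorem required_spec (hA : A.IsVOCA c) (hn : n = Fintype.card Q + m) (hI : Inv c A n M) {w : Word}
    (hw : w ∈ required M.cs.length M.R M.S) :
    Valid m w ∧ w.length ≤ boundR n + 1 + boundZ n := by
  have hR := (hI.length_R_le hA).trans (boundR_mono (show _ ≤ n by omega))
  rw [hI.cs_eq, length_rawAlphabet] at hw
  obtain ⟨u, hu, s, hs, rfl⟩ := mem_required.1 hw
  have h2 := hI.S_spec s hs
  have h1 : Valid m u ∧ u.length ≤ M.R.length + 1 := by
    rcases hu with hu | hu
    · have := hI.R_spec u hu
      exact ⟨this.1, by omega⟩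
    · obtain ⟨r, hr, a, ha, rfl⟩ := mem_extensions.1 hu
      have := hI.R_spec r hr
      exact ⟨this.1.append (.singleton ha), by simpa using this.2⟩
  exact ⟨h1.1.append h2.1, by rw [List.length_append]; omega⟩

end Inv

theorem Mem.round_ask (M : Mem) (w : Word) (a : Option Word) :
    Mem.round (a, { M with phase := 0, w := w }) = (M.record w a.isSome).fill := rfl

theorem isSome_boolAnswer (b : Bool) : (boolAnswer b).isSome = b := by cases b <;> rfl

/-- The memory `M'` is the result of filling and closing the table of `M`. -/
structure Filled (c : VisibleAlphabet (Fin m)) (A : DROCA Q (Fin m)) (n : ℕ) (M M' : Mem) :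
    Prop where
  inv : Inv c A n M'
  k_eq : M'.k = M.k
  l_eq : M'.l = M.l
  D_eq : M'.D = M.D
  S_eq : M'.S = M.S
  R_prefix : M.R <+: M'.R
  complete : ∀ w ∈ required m M'.R M'.S, look M'.F w = A.acc w
  closed : Closed (rawAlphabet c) M'.H A.acc M'.R M'.S
  missingCount_eq : missingCount M' = 0

/-- A new representative discards all facts, so each of those still to come is charged for a
complete table; the surplus 3 more than covers the query that accompanies it. -/
def fuel (n : ℕ) (M : Mem) : ℕ := (boundR n - M.R.length) * (boundW n + 3) + missingCount M

/-- A round has to end with a request, so filling is spread over many rounds, each of which lowers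
`fuel`. What happens afterwards enters as a hypothesis on every possible result. -/
theorem res_fill [Fintype Q] (hp : Rounds p c A n τ) (hA : A.IsVOCA c) (hn : n = Fintype.card Q + m)
    {x y z : ℕ} (N : ℕ) : ∀ M : Mem, Inv c A n M → M.F.length + missingCount M ≤ boundW n + 1 →
    fuel n M ≤ N → (∀ M', Filled c A n M M' → Res p c A τ M'.solve x y z) →
    Res p c A τ M.fill (x + N) y z := by
  have hans : ∀ b, sz (boolAnswer b) ≤ boundAnswer n := by
    intro b
    rw [boundAnswer]
    cases b <;> simp [boolAnswer]
    omega
  induction N using Nat.strong_induction_on with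
  | _ N ih =>
  intro M hI hF hN h
  rw [Mem.fill]
  have hm : M.cs.length = m := by rw [hI.cs_eq, length_rawAlphabet]
  cases h1 : missing M.cs.length M.R M.S M.F with
  | some w =>
    have hw := List.mem_of_find?_eq_some h1
    have hw' := List.find?_some h1
    have hs := hI.required_spec hA hn hw
    obtain ⟨⟨v, rfl⟩, hv⟩ := hs
    have hlt : missingCount (M.record (rawWord v) (A.out v)) < missingCount M := by
      refine countP_lt hw hw' ?_ fun x hx => ?_
      · show (!known ((rawWord v, A.out v) :: M.F) (rawWord v)) = false
        simp [known]
      · have hx' : (!known ((rawWord v, A.out v) :: M.F) x) = true := hx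
        simp only [known, List.any_cons, Bool.not_or, Bool.and_eq_true] at hx' ⊢
        exact hx'.2
    have hN' : fuel n M = (boundR n - M.R.length) * (boundW n + 3) + missingCount M := rfl
    refine (Res.membership (M := x + (N - 1)) ?_).mono (by omega) le_rfl le_rfl
    refine hp _ _ _ _ _ ((hI.ask ⟨v, rfl⟩ hv).sz_le hA hn (hans _)) ?_
    rw [Mem.round_ask, isSome_boolAnswer]
    refine ih (N - 1) (by omega) _ (hI.record (DROCA.acc_rawWord A v) ⟨v, rfl⟩ hv (by omega))
      ?_ ?_ fun M' hM' => h M' ⟨hM'.inv, hM'.k_eq, hM'.l_eq, hM'.D_eq, hM'.S_eq,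
          hM'.R_prefix, hM'.complete, hM'.closed,
          hM'.missingCount_eq⟩
    · simp only [Mem.record, List.length_cons] at hlt ⊢; omega
    · have : fuel n (M.record (rawWord v) (A.out v)) = (boundR n - M.R.length) * (boundW n + 3) +
        missingCount (M.record (rawWord v) (A.out v)) := rfl
      omega
  | none =>
    have hlook : ∀ w ∈ required M.cs.length M.R M.S, look M.F w = A.acc w := by
      intro w hw
      refine look_eq_of_known (fun e he => (hI.F_spec e he).1) ?_
      simpa using List.find?_eq_none.1 h1 w hw
    have hsim : ∀ u ∈ extensions M.cs.length M.R, ∀ r ∈ M.R,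
        similar M.cs M.S (look M.F) u r = similar M.cs M.S A.acc u r := fun u hu r hr =>
      similar_congr (R := M.R) (fun u hu s hs => hlook _ (mem_required.2
        ⟨u, List.mem_append.1 hu, s, hs, rfl⟩)) (List.mem_append_right _ hu)
        (List.mem_append_left _ hr)
    dsimp only
    cases h2 : unclosed M.cs M.H M.R M.S (look M.F) with
    | some u =>
      have hu := List.mem_of_find?_eq_some h2
      have hu' := List.find?_some h2
      rw [Bool.and_eq_true, decide_eq_true_iff, Bool.not_eq_true', List.any_eq_false] at hu'
      obtain ⟨r, hr, a, ha, rfl⟩ := mem_extensions.1 hu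
      have hrs := hI.R_spec r hr
      have hva : Valid m (r ++ [a]) := hrs.1.append (.singleton (hm ▸ ha))
      have hI' : Inv c A n { M with R := M.R ++ [r ++ [a]], F := [] } :=
        { hI with
          F_spec := fun _ he => absurd he List.not_mem_nil
          F_le := Nat.zero_le _
          table :=
            { head := ?_
              nil_mem := hI.table.nil_mem
              height_le := ?_
              pairwise := ?_ }
          R_spec := ?_ }
      -- The enlarged table still satisfies the bound on representatives, so there was room for one
      -- more.
      · have hb := hI'.length_R_le hA
        have hb' := Inv.boundR_mono (show Fintype.card Q ≤ n by omega)
        simp only [List.length_append, List.length_singleton] at hb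
        obtain ⟨d, hd⟩ := Nat.exists_eq_add_of_le (show M.R.length + 1 ≤ boundR n by omega)
        have hN' : fuel n M = (boundR n - M.R.length) * (boundW n + 3) + missingCount M := rfl
        rw [hd, show M.R.length + 1 + d - M.R.length = d + 1 by omega, Nat.add_mul] at hN'
        have h3 : (required M.cs.length (M.R ++ [r ++ [a]]) M.S).length ≤ boundW n :=
          hI'.length_required_le hA hn
        have hmis : missingCount (Mem.record { M with R := M.R ++ [r ++ [a]], F := [] }
            (rawWord (m := m) []) (A.out [])) ≤ boundW n := le_trans (missingCount_le _) h3
        -- The query for the empty word serves to start another round; its answer is the first fact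
        -- recorded for the new table.
        refine (Res.membership (w := []) (M := x + (N - 1)) ?_).mono (by omega) le_rfl le_rfl
        refine hp _ { M with phase := 0, w := rawWord (m := m) [], R := M.R ++ [r ++ [a]], F := [] } _ _ _
          ((hI'.ask ⟨[], rfl⟩ (Nat.zero_le _)).sz_le hA hn (hans _)) ?_
        rw [show Mem.round (_, { M with phase := 0, w := rawWord (m := m) [], R := _, F := _ }) = _ from
          Mem.round_ask { M with R := M.R ++ [r ++ [a]], F := [] } _ _, isSome_boolAnswer]
        refine ih (N - 1) (by omega) _ (hI'.record (DROCA.acc_rawWord A []) ⟨[], rfl⟩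
          (Nat.zero_le _) (Nat.zero_le _)) ?_ ?_ fun M' hM' => h M' ⟨hM'.inv, hM'.k_eq, hM'.l_eq,
            hM'.D_eq, hM'.S_eq, (List.prefix_append _ _).trans hM'.R_prefix, hM'.complete,
            hM'.closed, hM'.missingCount_eq⟩
        · simp only [Mem.record, List.length_singleton] at hmis ⊢; omega
        · rw [fuel]
          have : (Mem.record { M with R := M.R ++ [r ++ [a]], F := [] }
            (rawWord (m := m) []) (A.out [])).R.length = M.R.length + 1 := by simp [Mem.record]
          rw [this, hd, show M.R.length + 1 + d - (M.R.length + 1) = d by omega]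
          omega
      · have := hI.table.head
        show (M.R ++ _).head? = _
        rw [List.head?_append, this]; rfl
      · intro w hw
        rcases List.mem_append.1 hw with hw | hw
        · exact hI.table.height_le w hw
        · rw [List.mem_singleton.1 hw, ← hI.cs_eq]; exact hu'.1
      · refine List.pairwise_append.2 ⟨hI.table.pairwise, List.pairwise_singleton _ _, ?_⟩
        intro w hw w' hw'
        rw [List.mem_singleton.1 hw', ← hI.cs_eq]
        have := hu'.2 w hw
        rw [hsim _ hu w hw] at this
        simpa using this
      · intro w hw
        simp only [List.length_append, List.length_singleton]
        rcases List.mem_append.1 hw with hw | hw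
        · have := hI.R_spec w hw
          exact ⟨this.1, by omega⟩
        · rw [List.mem_singleton.1 hw]
          exact ⟨hva, by simpa using hrs.2⟩
    | none =>
      refine (h M ⟨hI, rfl, rfl, rfl, rfl, List.prefix_refl _, hm ▸ hlook, ?_,
        List.countP_eq_zero.2 (List.find?_eq_none.1 h1)⟩).mono (Nat.le_add_right _ _) le_rfl le_rfl
      intro u hu hh
      rw [length_rawAlphabet, ← hm] at hu
      rw [← hI.cs_eq] at hh ⊢
      have h3 := List.find?_eq_none.1 h2 u hu
      rw [decide_eq_true hh, Bool.true_and, Bool.not_eq_true, Bool.not_eq_false',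
        List.any_eq_true] at h3
      obtain ⟨r, hr, h4⟩ := h3
      exact ⟨r, hr, by rw [← hsim u hu r hr]; exact h4⟩

end Learner

/-! ## Progress of the learner -/

/-- Heights are fixed by the alphabet, so the counter-values can never be what differs. -/
theorem DROCA.IsMinimalCounterexample.spec {Q Q' : Type} {m : ℕ} {c : VisibleAlphabet (Fin m)}
    {A : DROCA Q (Fin m)} {C : DROCA Q' (Fin m)} (hA : A.IsVOCA c) (hC : C.IsVOCA c)
    {z : List (Fin m)} (h : A.IsMinimalCounterexample C z) :
    A.out z ≠ C.out z ∧ ∀ w, w.length < z.length → A.out w = C.out w := by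
  have key : ∀ w, A.IsCounterexample C w ↔ A.out w ≠ C.out w := by
    intro w
    rw [DROCA.IsCounterexample, hA.ce_eq, hC.ce_eq, DROCA.mem_language, DROCA.mem_language,
      ← Bool.eq_iff_iff]
    simp [eq_comm]
  refine ⟨(key z).1 h.1, fun w hw => ?_⟩
  by_contra hne
  exact absurd (h.2 w ((key w).2 hne)) (by omega)

namespace Learner

/-- The potential, which grows with every call of the SAT solver. -/
def potential (M : Mem) : ℕ := M.k + M.R.length + M.l

/-! ### Changes of the memory that preserve the invariants. -/

section Updates

variable {Q : Type} {m : ℕ} {c : VisibleAlphabet (Fin m)} {A : DROCA Q (Fin m)} {n : ℕ} {M : Mem}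

namespace Inv

/-- Old facts remain true. They are dropped only to keep the list short. -/
theorem clear (hI : Inv c A n M) : Inv c A n { M with F := [] } :=
  { hI with
    F_spec := fun _ he => absurd he List.not_mem_nil
    F_le := Nat.zero_le _ }

theorem succ_k (hI : Inv c A n M)
    (hno : ∀ B : DROCA (Fin M.k) (Fin m), B.IsVOCA c → ¬B.Equivalent A) :
    Inv c A n { M with k := M.k + 1 } :=
  { hI with
    k_pos := Nat.succ_pos _
    k_le := fun n B hB hBA => by
      rcases (hI.k_le n B hB hBA).eq_or_lt with h | h
      · subst h; exact absurd hBA (hno B hB)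
      · exact h
    table := hI.table.mono (Nat.mul_le_mul (Nat.mul_le_mul_left _ (Nat.le_succ _)) (Nat.le_succ _))
      fun _ h => h }

theorem succ_l (hI : Inv c A n M) (hl : M.l + 1 ≤ boundL n) {N : ℕ} (hN : N ≤ boundE n)
    {D : DROCA (Fin N) (Fin m)} (hD : D.IsVOCA c)
    (hDA : ∀ w, w.length < M.l + 1 → D.out w = A.out w) :
    Inv c A n { M with D := D.raw, l := M.l + 1 } :=
  { hI with
    D_spec := ⟨N, hN, D, hD, rfl, hDA⟩
    l_le := hl }

theorem add_tails (hI : Inv c A n M) {z : Word} (hz : Valid m z) (hl : z.length ≤ boundZ n)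
    (hS : M.S.length + (boundZ n + 1) ≤ boundS n) {i : ℕ} (hi : i ≤ 3) :
    Inv c A n { M with phase := i, S := M.S ++ z.tails } :=
  { hI with
    phase_le := hi
    table := hI.table.mono le_rfl fun _ => List.mem_append_left _
    S_spec := by
      intro s hs
      rcases List.mem_append.1 hs with hs | hs
      · exact hI.S_spec s hs
      · rw [List.mem_tails] at hs
        exact ⟨hz.of_suffix hs, hs.length_le.trans hl⟩
    S_le := by
      simp only [List.length_append, List.length_tails]; omega }

theorem ask_automaton (hI : Inv c A n M) {N N' : ℕ} (hN : N ≤ boundE n) (hN' : N' ≤ boundE n)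
    (C : DROCA (Fin N) (Fin m)) (E : DROCA (Fin N') (Fin m)) {i : ℕ} (hi : i ≤ 3) :
    Inv c A n { M with phase := i, C := C.raw, E := E.raw } :=
  { hI with
    phase_le := hi
    C_spec := ⟨N, hN, C, rfl⟩
    E_spec := ⟨N', hN', E, rfl⟩ }

theorem phase (hI : Inv c A n M) {i : ℕ} (hi : i ≤ 3) : Inv c A n { M with phase := i } :=
  { hI with phase_le := hi }

end Inv

theorem Filled.length_le {M M' : Mem} (h : Filled c A n M M') : M.R.length ≤ M'.R.length :=
  h.R_prefix.length_le

theorem Filled.R_eq {M M' : Mem} (h : Filled c A n M M') (h' : ¬M.R.length < M'.R.length) :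
    M'.R = M.R := (h.R_prefix.eq_of_length (le_antisymm h.length_le (not_lt.1 h'))).symm

/-- A counterexample to an automaton with `k` states that exceeds the bound rules out that the
target has `k` states. -/
theorem not_equivalent_of_high {k : ℕ} {C : DROCA (Fin k) (Fin m)} (hC : C.IsVOCA c)
    {z : List (Fin m)} (hz : A.out z ≠ C.out z)
    (hmin : ∀ w, w.length < z.length → A.out w = C.out w)
    (hhigh : high (rawAlphabet c) (2 * k * k) (rawWord z) = true) :
    ∀ B : DROCA (Fin k) (Fin m), B.IsVOCA c → ¬B.Equivalent A := by
  intro B hB hBA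
  rw [DROCA.language_eq_iff] at hBA
  -- If `B` recognised the language, `z` would be a shortest word separating `B` from `C`, both with
  -- `k` states, so it would stay within `k² + k²`.
  have h : C.Low (2 * k * k) z := by
    rw [hC.low_iff]
    intro t ht
    have := DROCA.height_le_of_minimal hB hC (by rwa [hBA]) (fun w hw => by rw [hBA, hmin w hw]) ht
    rw [Fintype.card_fin] at this
    rw [Nat.mul_assoc, Nat.two_mul]; exact this
  rw [(high_rawWord c hC _ _).2 h] at hhigh
  simp at hhigh

/-- If there is an automaton with `k` states for the language, then there is one whose initial
state is the first one. -/
theorem exists_init_eq_zero {k : ℕ} {B : DROCA (Fin k) (Fin m)} (hB : B.IsVOCA c)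
    (hBA : B.Equivalent A) : ∃ B : DROCA (Fin k) (Fin m), B.IsVOCA c ∧ B.Equivalent A ∧
      (B.init : ℕ) = 0 := by
  have hk : 0 < k := B.init.pos
  refine ⟨B.rename (Equiv.swap B.init ⟨0, hk⟩), DROCA.rename_isVOCA _ hB, ?_, ?_⟩
  · rw [DROCA.language_eq_iff] at hBA ⊢
    intro w
    rw [DROCA.rename_out, hBA]
  · show ((Equiv.swap B.init ⟨0, hk⟩ B.init : Fin k) : ℕ) = 0
    rw [Equiv.swap_apply_left]

theorem inv_start (A : DROCA Q (Fin m)) :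
    Inv c A n (Mem.start (rawAlphabet c)) := by
  obtain ⟨B, hB, hraw, -⟩ := DROCA.exists_raw_eq_mk c Nat.zero_lt_one (fun _ => false)
    (fun _ _ _ => 0) fun _ _ _ _ _ _ => Nat.zero_lt_one
  have h1 : 1 ≤ boundE n := Nat.le_add_left _ _
  exact
    { cs_eq := rfl
      phase_le := Nat.zero_le _
      k_pos := Nat.zero_lt_one
      k_le := fun n B _ _ => B.init.pos
      D_spec := ⟨1, h1, B, hB, hraw, fun w hw => absurd hw (Nat.not_lt_zero _)⟩
      l_le := Nat.zero_le _
      table :=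
        { head := rfl
          nil_mem := List.mem_singleton_self _
          height_le := fun r hr => by rw [List.mem_singleton.1 hr]; exact Nat.zero_le _
          pairwise := List.pairwise_singleton _ _ }
      R_spec := fun r hr => by rw [List.mem_singleton.1 hr]; exact ⟨⟨[], rfl⟩, Nat.zero_le _⟩
      S_spec := fun r hr => by rw [List.mem_singleton.1 hr]; exact ⟨⟨[], rfl⟩, Nat.zero_le _⟩
      S_le := Nat.le_add_right _ _
      F_spec := fun _ he => absurd he List.not_mem_nil
      F_le := Nat.zero_le _
      C_spec := ⟨1, h1, B, hraw⟩
      E_spec := ⟨1, h1, B, hraw⟩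
      w_spec := ⟨⟨[], rfl⟩, Nat.zero_le _⟩ }

end Updates

variable {Q : Type} [Fintype Q] {m : ℕ} {p : Prog} {c : VisibleAlphabet (Fin m)}
  {A : DROCA Q (Fin m)} {n τ : ℕ} {M : Mem}

/-- The table is filled and closed, and the learner is about to call the SAT solver. -/
structure Ready (c : VisibleAlphabet (Fin m)) (A : DROCA Q (Fin m)) (n : ℕ) (M : Mem) : Prop where
  inv : Inv c A n M
  complete : ∀ w ∈ required m M.R M.S, look M.F w = A.acc w
  closed : Closed (rawAlphabet c) M.H A.acc M.R M.S
  missingCount_eq : missingCount M = 0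
  l_le : M.l ≤ boundR (Fintype.card Q) + 2 + M.R.length
  S_le : M.S.length ≤ 1 + 2 * (boundZ n + 1) * potential M

/-- The learner succeeds if it goes on by filling a table that leads to progress over `M`. -/
def Resumes (p : Prog) (c : VisibleAlphabet (Fin m)) (A : DROCA Q (Fin m)) (n τ : ℕ) (M : Mem)
    (x y z : ℕ) : Prop :=
  ∀ M₁, Inv c A n M₁ → M₁.F.length + missingCount M₁ ≤ boundW n + 1 →
    M₁.S.length ≤ M.S.length + 2 * (boundZ n + 1) →
    (∀ M', Filled c A n M₁ M' → potential M < potential M' ∧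
      M'.l ≤ boundR (Fintype.card Q) + 2 + M'.R.length) → Res p c A τ M₁.fill x y z

/-- `C` is a candidate for the target, and `E` combines the table with `C`. -/
structure Candidate (c : VisibleAlphabet (Fin m)) (A : DROCA Q (Fin m)) (M : Mem)
    (C : DROCA (Fin M.k) (Fin m)) (E : DROCA (Fin ((M.R.length + 1) * M.k)) (Fin m)) : Prop where
  isVOCA : C.IsVOCA c
  out_eq : ∀ w, w.length < M.l → C.out w = A.out w
  isVOCA' : E.IsVOCA c
  out_eq' : ∀ w, E.out w = if cls (rawAlphabet c) M.R M.S A.acc (rawWord w) < M.R.length then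
    A.acc (M.R.getD (cls (rawAlphabet c) M.R M.S A.acc (rawWord w)) []) else C.out w

namespace Ready

theorem length_R_le (hA : A.IsVOCA c) (hM : Ready c A n M) :
    M.R.length ≤ boundR (Fintype.card Q) := hM.inv.length_R_le hA

theorem potential_le (hA : A.IsVOCA c) (hM : Ready c A n M) :
    potential M ≤ boundΦ (Fintype.card Q) := by
  have := hM.length_R_le hA
  have := hM.inv.k_le_card hA
  have := hM.l_le
  rw [potential, boundΦ]; omega

end Ready

theorem boundΦ_mono {a b : ℕ} (h : a ≤ b) : boundΦ a ≤ boundΦ b := by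
  have := Inv.boundR_mono h
  rw [boundΦ, boundΦ]; omega

theorem Ready.S_le' (hM : Ready c A n M) (hA : A.IsVOCA c) (hn : n = Fintype.card Q + m) :
    M.S.length + 2 * (boundZ n + 1) ≤ boundS n := by
  have h1 := hM.S_le
  have h2 := (hM.potential_le hA).trans (boundΦ_mono (show _ ≤ n by omega))
  have h3 := Nat.mul_le_mul_left (2 * (boundZ n + 1)) h2
  rw [boundS, Nat.mul_add _ (boundΦ n)]
  omega

theorem length_F_add_le (hI : Inv c A n M) (hA : A.IsVOCA c) (hn : n = Fintype.card Q + m)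
    (hF : M.F = []) : M.F.length + missingCount M ≤ boundW n + 1 := by
  have := (missingCount_le M).trans (hI.length_required_le hA hn)
  rw [hF, List.length_nil]; omega

theorem length_le_boundZ (hA : A.IsVOCA c) (hn : n = Fintype.card Q + m) {N : ℕ}
    (hN : N ≤ boundE n) {C : DROCA (Fin N) (Fin m)} (hC : C.IsVOCA c) {z : List (Fin m)}
    (hz : A.out z ≠ C.out z) (hmin : ∀ w, w.length < z.length → A.out w = C.out w) :
    z.length ≤ boundZ n := by
  have h := DROCA.length_le_of_minimal hA hC hz hmin
  rw [Fintype.card_fin] at h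
  have hq : Fintype.card Q ≤ n := by omega
  exact h.trans (Nat.add_le_add_right (Nat.mul_le_mul (Nat.add_le_add hq hN) (Nat.add_le_add_right
    (Nat.add_le_add (Nat.mul_le_mul hq hq) (Nat.mul_le_mul hN hN)) 1)) 1)

theorem sz_some_le (hn : n = Fintype.card Q + m) {z : List (Fin m)} (hz : z.length ≤ boundZ n) :
    sz (some (rawWord z)) ≤ boundAnswer n := by
  have := sz_valid (n := n) (by omega) (valid_rawWord z) (by simpa using hz)
  rw [boundAnswer, sz_some]; omega

theorem sz_none_le : sz (none : Option Word) ≤ boundAnswer n := by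
  rw [boundAnswer, sz_none]; omega

/-! ### Each outcome of an iteration raises the potential. -/

section Progress

variable {x y t : ℕ}

theorem Resumes.succ_k (hr : Resumes p c A n τ M x y t) (hM : Ready c A n M) {M₁ : Mem}
    (hI : Inv c A n M₁) (hk : M₁.k = M.k) (hR : M₁.R = M.R) (hl : M₁.l = M.l)
    (hF : M₁.F.length + missingCount M₁ ≤ boundW n + 1)
    (hS : M₁.S.length ≤ M.S.length + 2 * (boundZ n + 1))
    (hno : ∀ B : DROCA (Fin M.k) (Fin m), B.IsVOCA c → ¬B.Equivalent A) :
    Res p c A τ (Mem.fill { M₁ with k := M₁.k + 1 }) x y t := by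
  refine hr _ (hI.succ_k (by rw [hk]; exact hno)) hF hS fun M' hM' => ?_
  have h1 := hM'.length_le
  have h2 := hM'.k_eq
  have h3 := hM'.l_eq
  have h4 := hM.l_le
  dsimp only at h1 h2 h3
  rw [hR] at h1
  rw [potential, potential]
  omega

variable {C : DROCA (Fin M.k) (Fin m)} {E : DROCA (Fin ((M.R.length + 1) * M.k)) (Fin m)}

theorem Candidate.out_eq_of_high (hc : Candidate c A M C E) (hM : Ready c A n M)
    {w : List (Fin m)} (hw : high (rawAlphabet c) M.H (rawWord w) = true) :
    E.out w = C.out w := by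
  have h := (hM.inv.table.cls_spec hM.closed (w := rawWord w)
    (by rw [length_rawAlphabet]; exact valid_rawWord w)).2 hw
  rw [hc.out_eq' w, if_neg (by omega)]

theorem Candidate.out_eq_of_low (hc : Candidate c A M C E) (hM : Ready c A n M)
    {w : List (Fin m)} (hw : high (rawAlphabet c) M.H (rawWord w) = false) :
    E.out w = A.acc (M.R.getD (cls (rawAlphabet c) M.R M.S A.acc (rawWord w)) []) := by
  have h := (hM.inv.table.cls_spec hM.closed (w := rawWord w)
    (by rw [length_rawAlphabet]; exact valid_rawWord w)).1 hw
  rw [hc.out_eq' w, if_pos h.1]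

/-- If the table does not grow by the suffixes of a word, it has classified the word correctly. -/
theorem Ready.out_eq_of_filled (hM : Ready c A n M) {M₁ M' : Mem}
    (hM' : Filled c A n M₁ M') (hk : M₁.k = M.k) (hR : M₁.R = M.R) {w : List (Fin m)}
    (hS : ∀ s ∈ M.S, s ∈ M₁.S) (hw : ∀ s, s <:+ rawWord w → s ∈ M₁.S)
    (hlow : high (rawAlphabet c) M.H (rawWord w) = false) (h : ¬M.R.length < M'.R.length) :
    A.acc (M.R.getD (cls (rawAlphabet c) M.R M.S A.acc (rawWord w)) []) = A.out w := by
  have hR' : M'.R = M.R := by rw [← hR]; exact hM'.R_eq (by rwa [hR])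
  have hH : M'.H = M.H := by rw [Mem.H, Mem.H, hM'.k_eq, hk]
  have hT := hM'.inv.table
  have hC := hM'.closed
  rw [hR', hH, hM'.S_eq] at hT hC
  have hv : Valid (rawAlphabet c).length (rawWord w) := by
    rw [length_rawAlphabet]; exact valid_rawWord w
  rw [hM.inv.table.cls_eq hM.closed hT hC hS hv hlow, hT.apply_cls hC hv hlow hw,
    DROCA.acc_rawWord]

theorem Ready.succ_l_le (hM : Ready c A n M) (hA : A.IsVOCA c) (hn : n = Fintype.card Q + m) :
    M.l + 1 ≤ boundL n := by
  have h1 := hM.l_le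
  have h2 := hM.length_R_le hA
  have h3 := Inv.boundR_mono (show Fintype.card Q ≤ n by omega)
  rw [boundL]; omega

theorem Ready.le_boundE (hM : Ready c A n M) (hA : A.IsVOCA c) (hn : n = Fintype.card Q + m) :
    M.k ≤ boundE n ∧ (M.R.length + 1) * M.k ≤ boundE n := by
  have h1 := hM.inv.k_le_card hA
  have h2 := hM.length_R_le hA
  have h3 := Inv.boundR_mono (show Fintype.card Q ≤ n by omega)
  have h4 : (M.R.length + 1) * M.k ≤ (boundR n + 1) * n := Nat.mul_le_mul (by omega) (by omega)
  have h5 : 1 * M.k ≤ (M.R.length + 1) * M.k := Nat.mul_le_mul_right _ (by omega)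
  rw [boundE]; omega

/-- After both counterexamples were of no avail against the number of states, the target of the
first phase is extended. -/
theorem Resumes.succ_l (hr : Resumes p c A n τ M x y t) (hM : Ready c A n M) (hA : A.IsVOCA c)
    (hn : n = Fintype.card Q + m) (hc : Candidate c A M C E) {z : List (Fin m)}
    (hz : A.out z ≠ C.out z) (hlow : high (rawAlphabet c) M.H (rawWord z) = false) {M₁ : Mem}
    (hI : Inv c A n M₁) (hk : M₁.k = M.k) (hR : M₁.R = M.R) (hl : M₁.l = M.l)
    (hF : M₁.F = []) (hS : M₁.S = M.S ++ (rawWord z).tails) (hlz : z.length ≤ boundZ n)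
    (hEA : ∀ w, w.length < M.l + 1 → E.out w = A.out w) :
    Res p c A τ (Mem.fill { M₁ with D := E.raw, l := M₁.l + 1 }) x y t := by
  have hI' := hI.succ_l (D := E) (by rw [hl]; exact hM.succ_l_le hA hn) (hM.le_boundE hA hn).2
    hc.isVOCA' (by rw [hl]; exact hEA)
  refine hr _ hI' ?_ ?_ fun M' hM' => ?_
  · exact length_F_add_le hI' hA hn hF
  · show M₁.S.length ≤ _
    rw [hS, List.length_append, List.length_tails, length_rawWord]; omega
  · have h1 := hM'.length_le
    have h2 := hM'.k_eq
    have h3 := hM'.l_eq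
    have h4 := hM.l_le
    dsimp only at h1 h2 h3
    rw [hR] at h1
    refine ⟨by rw [potential, potential]; omega, ?_⟩
    by_cases hlt : M.R.length < M'.R.length
    · omega
    -- The table has received all suffixes of `z` without growing, so it was right about `z`. As `C`
    -- was not, they differ on a low word.
    have h5 := hM.out_eq_of_filled hM' hk hR (w := z)
      (fun s hs => by show s ∈ M₁.S; rw [hS]; exact List.mem_append_left _ hs)
      (fun s hs => by show s ∈ M₁.S; rw [hS]; exact List.mem_append_right _ ((List.mem_tails _ _).2 hs))
      hlow hlt
    obtain ⟨w, hw, hw', hne⟩ := exists_short_of_ne hc.isVOCA hM.inv.table hM.closed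
      ((high_rawWord c hc.isVOCA _ _).1 hlow) (by rw [h5]; exact hz)
    -- On low words `E` is the table. Both `E` and `C` are right on words shorter than `l`, so a
    -- word on which they differ has length at least `l`; its upper bound therefore bounds `l`.
    have h6 : ¬w.length < M.l := fun h => by
      rw [← hc.out_eq_of_low hM ((high_rawWord c hc.isVOCA _ _).2 hw), hEA w (by omega),
        hc.out_eq w h] at hne
      exact hne rfl
    have h7 : M.k * (M.H + 1) ≤ boundR (Fintype.card Q) := by
      have := hM.inv.k_le_card hA
      exact Nat.mul_le_mul this (Nat.add_le_add_right (Nat.mul_le_mul (Nat.mul_le_mul_left _ this)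
        this) 1)
    omega

end Progress

end Learner

namespace Learner

/-! ### One iteration: a solver call and up to two equivalence queries. -/

section Iteration

variable {Q : Type} [Fintype Q] {m : ℕ} {p : Prog} {c : VisibleAlphabet (Fin m)}
  {A : DROCA Q (Fin m)} {n τ : ℕ} {M : Mem} {x y t : ℕ}
  {C : DROCA (Fin M.k) (Fin m)} {E : DROCA (Fin ((M.R.length + 1) * M.k)) (Fin m)}

/-- The memory while the learner asks whether `C` is correct. -/
def Mem.first (M : Mem) (C E : RawAut) : Mem := { M with phase := 2, C := C, E := E }

/-- The memory while the learner asks whether `E` is correct. -/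
def Mem.second (M : Mem) (C E : RawAut) (z : Word) : Mem :=
  { M with phase := 3, C := C, E := E, S := M.S ++ z.tails }

theorem Candidate.inv_first (hM : Ready c A n M) (hA : A.IsVOCA c) (hn : n = Fintype.card Q + m) :
    Inv c A n (M.first C.raw E.raw) :=
  hM.inv.ask_automaton (hM.le_boundE hA hn).1 (hM.le_boundE hA hn).2 C E (by omega)

theorem Candidate.inv_second (hM : Ready c A n M) (hA : A.IsVOCA c)
    (hn : n = Fintype.card Q + m) {z : List (Fin m)} (hlz : z.length ≤ boundZ n) :
    Inv c A n (M.second C.raw E.raw (rawWord z)) := by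
  have h := hM.S_le' hA hn
  exact (inv_first hM hA hn).add_tails (valid_rawWord z) (by simpa using hlz)
    (by show M.S.length + _ ≤ _; omega) (by omega)

/-- The second query makes progress. -/
theorem Candidate.res_second (hc : Candidate c A M C E) (hM : Ready c A n M)
    (hp : Rounds p c A n τ) (hA : A.IsVOCA c) (hn : n = Fintype.card Q + m)
    (hr : Resumes p c A n τ M x y t) {z : List (Fin m)} (hz : A.out z ≠ C.out z)
    (hlow : high (rawAlphabet c) M.H (rawWord z) = false) (hlz : z.length ≤ boundZ n) :
    Res p c A τ (enc ((1, E.raw), M.second C.raw E.raw (rawWord z))) x (y + 1) t := by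
  have hI : Inv c A n (M.second C.raw E.raw (rawWord z)) := inv_second hM hA hn hlz
  have hSz : (M.S ++ (rawWord z).tails).length ≤ M.S.length + (boundZ n + 1) := by
    rw [List.length_append, List.length_tails, length_rawWord]; omega
  refine Res.equivalence (fun _ h2 => ?_) (fun z' hz' => ?_)
  · rw [DROCA.language_eq_iff] at h2
    refine hp _ _ _ _ _ (hI.sz_le hA hn sz_none_le) ?_
    exact hr.succ_l hM hA hn hc hz hlow hI.clear rfl rfl rfl rfl rfl hlz fun w _ => h2 w
  · obtain ⟨hne, hmin⟩ := hz'.spec hA hc.isVOCA'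
    have hlz' := length_le_boundZ hA hn (hM.le_boundE hA hn).2 hc.isVOCA' hne hmin
    refine hp _ _ _ _ _ (hI.sz_le hA hn (sz_some_le hn hlz')) ?_
    cases hh : high (rawAlphabet c) M.H (rawWord z') with
    | false =>
      have hh' : high M.cs M.H (rawWord z') = false := by rw [hM.inv.cs_eq]; exact hh
      have hround : Mem.round (some (rawWord z'), M.second C.raw E.raw (rawWord z)) =
          Mem.fill { M.second C.raw E.raw (rawWord z) with
            S := (M.S ++ (rawWord z).tails) ++ (rawWord z').tails, F := [] } := by
        show (bif high M.cs M.H (rawWord z') then _ else _) = _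
        rw [hh']; rfl
      rw [hround]
      have hI' := hI.clear.add_tails (valid_rawWord z') (by simpa using hlz')
        (by have := hM.S_le' hA hn; show (M.S ++ (rawWord z).tails).length + _ ≤ _; omega) le_rfl
      refine hr _ hI' ?_ ?_ fun M' hM' => ?_
      · exact length_F_add_le hI' hA hn rfl
      · show ((M.S ++ (rawWord z).tails) ++ (rawWord z').tails).length ≤ _
        rw [List.length_append, List.length_tails, length_rawWord]; omega
      -- Without a new representative the old table would already have been right about `z'`, where
      -- `E` copies it.
      · have h1 : M.R.length < M'.R.length := by
          by_contra hlt
          refine hne ?_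
          rw [hc.out_eq_of_low hM hh]
          exact (hM.out_eq_of_filled hM' rfl rfl
            (fun s hs => List.mem_append_left _ (List.mem_append_left _ hs))
            (fun s hs => List.mem_append_right _ ((List.mem_tails _ _).2 hs)) hh hlt).symm
        have h2 : M'.k = M.k := hM'.k_eq
        have h3 : M'.l = M.l := hM'.l_eq
        have h4 := hM.l_le
        rw [potential, potential]
        omega
    | true =>
      have hh' : high M.cs M.H (rawWord z') = true := by rw [hM.inv.cs_eq]; exact hh
      -- On high words `E` answers as `C` does. Since `C` is right below the length `l`, a word `z'`
      -- of length at most `l` is also a shortest counterexample to `C`. A longer one leaves `E`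
      -- right up to the length `l`.
      by_cases hl : z'.length ≤ M.l
      · have hround : Mem.round (some (rawWord z'), M.second C.raw E.raw (rawWord z)) =
            Mem.fill { M.second C.raw E.raw (rawWord z) with k := M.k + 1, F := [] } := by
          show (bif high M.cs M.H (rawWord z') then if (rawWord z').length ≤ M.l then _ else _
            else _) = _
          rw [hh', if_pos (by simpa using hl)]; rfl
        rw [hround]
        rw [hc.out_eq_of_high hM hh] at hne
        refine hr.succ_k hM hI.clear rfl rfl rfl ?_ ?_ (not_equivalent_of_high hc.isVOCA hne
          (fun w hw => (hc.out_eq w (by omega)).symm) hh)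
        · exact length_F_add_le hI.clear hA hn rfl
        · show (M.S ++ (rawWord z).tails).length ≤ _
          omega
      · have hround : Mem.round (some (rawWord z'), M.second C.raw E.raw (rawWord z)) =
            Mem.fill { M.second C.raw E.raw (rawWord z) with
              D := E.raw, l := M.l + 1, F := [] } := by
          show (bif high M.cs M.H (rawWord z') then if (rawWord z').length ≤ M.l then _ else _
            else _) = _
          rw [hh', if_neg (by simpa using hl)]; rfl
        rw [hround]
        exact hr.succ_l hM hA hn hc hz hlow hI.clear rfl rfl rfl rfl rfl hlz fun w hw =>
          (hmin w (by omega)).symm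

/-- The first query ends the learning process or leads to the second one. -/
theorem Candidate.res_first (hc : Candidate c A M C E) (hM : Ready c A n M)
    (hp : Rounds p c A n τ) (hA : A.IsVOCA c) (hn : n = Fintype.card Q + m)
    (hr : Resumes p c A n τ M x y t) :
    Res p c A τ (enc ((1, C.raw), M.first C.raw E.raw)) x (y + 2) t := by
  have hI : Inv c A n (M.first C.raw E.raw) := inv_first hM hA hn
  refine Res.equivalence (fun _ h2 => ?_) (fun z hz => ?_)
  · refine hp _ _ _ _ _ (hI.sz_le hA hn sz_none_le) ?_
    refine Res.halt (B := C) ⟨hc.isVOCA, h2, fun n B hB hBA => ?_⟩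
    rw [Fintype.card_fin]
    exact hM.inv.k_le n B hB hBA
  · obtain ⟨hne, hmin⟩ := hz.spec hA hc.isVOCA
    have hlz := length_le_boundZ hA hn (hM.le_boundE hA hn).1 hc.isVOCA hne hmin
    refine hp _ _ _ _ _ (hI.sz_le hA hn (sz_some_le hn hlz)) ?_
    cases hh : high (rawAlphabet c) M.H (rawWord z) with
    | false =>
      have hh' : high M.cs M.H (rawWord z) = false := by rw [hM.inv.cs_eq]; exact hh
      have hround : Mem.round (some (rawWord z), M.first C.raw E.raw) =
          enc ((1, E.raw), M.second C.raw E.raw (rawWord z)) := by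
        show (bif high M.cs M.H (rawWord z) then _ else _) = _
        rw [hh']; rfl
      rw [hround]
      exact hc.res_second hM hp hA hn hr hne hh hlz
    | true =>
      have hh' : high M.cs M.H (rawWord z) = true := by rw [hM.inv.cs_eq]; exact hh
      have hround : Mem.round (some (rawWord z), M.first C.raw E.raw) =
          Mem.fill { M.first C.raw E.raw with k := M.k + 1 } := by
        show (bif high M.cs M.H (rawWord z) then _ else _) = _
        rw [hh']; rfl
      rw [hround]
      refine (hr.succ_k hM hI rfl rfl rfl ?_ ?_ (not_equivalent_of_high hc.isVOCA hne hmin hh)).mono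
        le_rfl (by omega) le_rfl
      · have h1 : missingCount (M.first C.raw E.raw) = 0 := hM.missingCount_eq
        rw [h1]
        exact hM.inv.F_le
      · exact Nat.le_add_right _ _

/-- A call of the SAT solver and two queries make progress. -/
theorem Ready.res_solve (hM : Ready c A n M) (hp : Rounds p c A n τ) (hA : A.IsVOCA c)
    (hn : n = Fintype.card Q + m) (hr : Resumes p c A n τ M x y t) :
    Res p c A τ M.solve x (y + 2) (t + 1) := by
  obtain ⟨N, hN, D, hD, hDM, hDA⟩ := hM.inv.D_spec
  have hcs := hM.inv.cs_eq
  have hB : M.B = m + M.k + M.l + N + 3 := by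
    rw [Mem.B, radix, hcs, ← hDM, length_rawAlphabet, DROCA.length_raw]
  have hcl : clauses M.cs M.k M.l M.D M.B = clauses (rawAlphabet c) M.k M.l D.raw M.B := by
    rw [hcs, hDM]
  have hI : Inv c A n { M with phase := 1 } := hM.inv.phase (by omega)
  refine Res.sat ?_ (fun hno => ?_) (fun bits g hlen hbits hg hbg => ?_)
  · rw [hcl]
    exact clauses_lt c D hB.ge
  · refine hp _ _ _ _ _ (hI.sz_le hA hn sz_none_le) ?_
    refine (hr.succ_k hM hI rfl rfl rfl ?_ ?_ fun B hB' hBA => ?_).mono le_rfl (by omega) le_rfl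
    · have h1 : missingCount { M with phase := 1 } = 0 := hM.missingCount_eq
      rw [h1]
      exact hM.inv.F_le
    · exact Nat.le_add_right _ _
    -- The formula fixes the initial state to be 0, so the hypothetical automaton is renumbered
    -- before it is turned into an assignment.
    · obtain ⟨B, hB', hBA, hBi⟩ := exists_init_eq_zero hB' hBA
      rw [DROCA.language_eq_iff] at hBA
      obtain ⟨g, hg⟩ := exists_assignment hD hB' hBi hB.ge fun w hw => by rw [hBA, hDA w hw]
      rw [← hcl] at hg
      exact hno g hg
  · rw [hcl] at hg
    obtain ⟨C, hC, hCraw, hCD⟩ := exists_decode hD hM.inv.k_pos hB.ge hg hbg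
    obtain ⟨E, hE, hEraw, hEout⟩ := exists_combine (R := M.R) (S := M.S) c hC A.acc
    have hc : Candidate c A M C E :=
      { isVOCA := hC
        out_eq := fun w hw => by rw [hCD w hw, hDA w hw]
        isVOCA' := hE
        out_eq' := hEout }
    have hsz : sz (some bits) ≤ boundAnswer n := by
      have h1 := sz_le_of_forall (l := bits) (b := 3) fun b hb => by
        have := hbits b hb
        rw [sz_nat]; omega
      have h2 : M.B ≤ boundB n := by
        have h3 := hM.inv.k_le_card hA
        have h4 := hM.inv.l_le
        rw [hB, boundB]; omega
      have h3 : numVars M.B ≤ numVars (boundB n) :=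
        Nat.mul_le_mul (Nat.mul_le_mul (Nat.mul_le_mul (Nat.mul_le_mul_left _ h2) h2) h2) h2
      rw [boundAnswer, sz_some]
      omega
    refine hp _ _ _ _ _ (hI.sz_le hA hn hsz) ?_
    have hround : Mem.round (some bits, { M with phase := 1 }) =
        enc ((1, C.raw), M.first C.raw E.raw) := by
      have h1 : decode M.cs M.k M.B bits = C.raw := by rw [hcs, hCraw]
      have h2 : combine M.cs M.k C.raw M.R M.S (look M.F) = E.raw := by
        rw [hcs, hEraw]
        refine combine_congr (fun u hu s hs => ?_) hM.inv.table.nil_mem _ _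
        rw [length_rawAlphabet] at hu
        exact hM.complete _ (mem_required.2 ⟨u, List.mem_append.1 hu, s, hs, rfl⟩)
      show enc ((1, decode M.cs M.k M.B bits), { M with
        phase := 2
        C := decode M.cs M.k M.B bits
        E := combine M.cs M.k (decode M.cs M.k M.B bits) M.R M.S (look M.F) }) = _
      rw [h1, h2]; rfl
    rw [hround]
    exact hc.res_first hM hp hA hn hr

end Iteration

end Learner

namespace Learner

/-! ### The whole run and its final bounds. -/

section Learning

variable {Q : Type} [Fintype Q] {m : ℕ} {p : Prog} {c : VisibleAlphabet (Fin m)}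
  {A : DROCA Q (Fin m)} {n τ : ℕ}

/-- A bound on the number of membership queries between two calls of the SAT solver. -/
def boundFill (n : ℕ) : ℕ := boundR n * (boundW n + 3) + boundW n

theorem fuel_le {M : Mem} (hI : Inv c A n M) (hA : A.IsVOCA c) (hn : n = Fintype.card Q + m) :
    fuel n M ≤ boundFill n :=
  Nat.add_le_add (Nat.mul_le_mul_right _ (Nat.sub_le _ _))
    ((missingCount_le M).trans (hI.length_required_le hA hn))

/-- Here `j` bounds the iterations that remain. Each raises the potential, which the invariants keep
at or below `boundΦ`, so `j = 0` is contradictory. -/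
theorem res_solve (hp : Rounds p c A n τ) (hA : A.IsVOCA c) (hn : n = Fintype.card Q + m) (j : ℕ) :
    ∀ M, Ready c A n M → boundΦ (Fintype.card Q) < potential M + j →
      Res p c A τ M.solve (j * boundFill n) (2 * j) j := by
  induction j with
  | zero =>
    intro M hM hj
    have := hM.potential_le hA
    omega
  | succ j ih =>
    intro M hM hj
    refine hM.res_solve hp hA hn fun M₁ hI hF hS h => ?_
    rw [Nat.succ_mul]
    refine res_fill hp hA hn _ M₁ hI hF (fuel_le hI hA hn) fun M' hM' => ?_
    obtain ⟨h1, h2⟩ := h M' hM'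
    refine ih M' ⟨hM'.inv, hM'.complete, hM'.closed, hM'.missingCount_eq, h2, ?_⟩ (by omega)
    have h3 := Nat.mul_le_mul_left (2 * (boundZ n + 1)) (show potential M + 1 ≤ potential M' from h1)
    have h4 := hM.S_le
    rw [Nat.mul_add, Nat.mul_one] at h3
    rw [hM'.S_eq]
    omega

theorem res_start (hp : Rounds p c A n τ) (hA : A.IsVOCA c) (hn : n = Fintype.card Q + m) :
    Res p c A τ (Mem.start (rawAlphabet c)).fill
      ((boundΦ (Fintype.card Q) + 1) * boundFill n + boundFill n)
      (2 * (boundΦ (Fintype.card Q) + 1)) (boundΦ (Fintype.card Q) + 1) := by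
  have hI : Inv c A n (Mem.start (rawAlphabet c)) := inv_start A
  refine res_fill hp hA hn _ _ hI (length_F_add_le hI hA hn rfl) (fuel_le hI hA hn) fun M' hM' =>
    res_solve hp hA hn _ M' ⟨hM'.inv, hM'.complete, hM'.closed, hM'.missingCount_eq, ?_, ?_⟩
      (by omega)
  · rw [hM'.l_eq]; exact Nat.zero_le _
  · rw [hM'.S_eq]; exact Nat.le_add_right _ _

/-- The left side is `6q³ + 4q + 3`, and positivity of `q` absorbs the lower terms. -/
theorem boundΦ_le {q : ℕ} (hq : 0 < q) : boundΦ q + 1 ≤ 13 * q ^ 3 := by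
  have h1 : q ≤ q ^ 3 := Nat.le_self_pow (by omega) q
  have h2 : boundR q = 2 * q ^ 3 + q := by rw [boundR]; ring
  rw [boundΦ, h2]
  omega

end Learning

/-- One number serves as coefficient and exponent, and so does every larger one, so that thresholds
for several functions can be added. -/
theorem polyLE_id_le {f : ℕ → ℕ} (hf : PolyLE (fun n => n) f) :
    ∃ d, ∀ d' ≥ d, ∀ n > 0, f n ≤ d' * n ^ d' := by
  obtain ⟨k, hk⟩ := hf
  refine ⟨3 ^ k, fun d hd n hn => ?_⟩
  have h1 : k ≤ d := (Nat.lt_pow_self (by omega)).le.trans hd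
  calc f n ≤ (n + 2) ^ k := hk n
    _ ≤ (3 * n) ^ k := Nat.pow_le_pow_left (by omega) k
    _ = 3 ^ k * n ^ k := Nat.mul_pow ..
    _ ≤ d * n ^ d := Nat.mul_le_mul hd (Nat.pow_le_pow_right hn h1)

theorem polyLE_boundFill : PolyLE (fun n => n) boundFill :=
  .add (.mul (polyLE_boundR .self) (.add (polyLE_boundW .self) (.const 3))) (polyLE_boundW .self)

end Learner

open Learner in
/-- A single learner, which is a polynomial-time program apart from its queries, learns a minimal
VOCA for the language of every VOCA `A` with `O(|A|³)` calls of the SAT solver, `O(|A|³)` minimal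
synchronous-equivalence queries and polynomially many membership queries. -/
theorem mainTheorem4 :
    ∃ (p : Prog) (K d : ℕ), ∀ (m : ℕ) (c : VisibleAlphabet (Fin m)) (Q : Type) [Fintype Q]
      (A : DROCA Q (Fin m)), A.IsVOCA c →
        p.Learns c A
          (d * (Fintype.card Q + m) ^ d)
          (K * Fintype.card Q ^ 3)
          (K * Fintype.card Q ^ 3)
          (d * (Fintype.card Q + m) ^ d) := by
  obtain ⟨p, j, hstart, hround⟩ := exists_learner
  have hM : PolyLE (fun n => n) fun n => (boundΦ n + 1) * boundFill n + boundFill n :=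
    .add (.mul (.add (polyLE_boundΦ .self) (.const 1)) polyLE_boundFill) polyLE_boundFill
  have hT : PolyLE (fun n => n) fun n =>
      ((boundΦ n + 1) * boundFill n + boundFill n + 2 * (boundΦ n + 1) + (boundΦ n + 1) + 1) *
        (boundX n + 2) ^ j :=
    .mul (.add (.add (.add hM (.mul (.const 2) (.add (polyLE_boundΦ .self) (.const 1))))
      (.add (polyLE_boundΦ .self) (.const 1))) (.const 1))
      (.pow (.add (polyLE_boundX .self) (.const 2)) j)
  obtain ⟨d₁, h₁⟩ := polyLE_id_le hM
  obtain ⟨d₂, h₂⟩ := polyLE_id_le hT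
  -- The factor 26 is twice the 13 of `boundΦ_le`: at most two equivalence queries are asked for
  -- each solver call.
  refine ⟨p, 26, d₁ + d₂, fun m c Q _ A hA => ?_⟩
  have hQ : 0 < Fintype.card Q := Fintype.card_pos_iff.2 ⟨A.init⟩
  generalize hn : Fintype.card Q + m = n
  have hp : Rounds p c A n ((boundX n + 2) ^ j) := by
    intro a μ M E S hsz h
    obtain ⟨t, ht, hr⟩ := hround a μ
    exact h _ ⟨t, ht.trans (Nat.pow_le_pow_left (by omega) j), hr⟩
  have hΦ := boundΦ_mono (show Fintype.card Q ≤ n by omega)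
  have hΦ' := boundΦ_le hQ
  have h := res_start hp hA hn.symm (.cons (.ofAlphabet c) .nil) (by
    obtain ⟨t, ht, hr⟩ := hstart (rawAlphabet c)
    rw [enc_rawAlphabet] at hr
    refine ⟨t, ht.trans (Nat.pow_le_pow_left ?_ j), hr⟩
    have := sz_rawAlphabet (show m ≤ n by omega) c
    rw [boundX]; omega)
  have hM' : (boundΦ (Fintype.card Q) + 1) * boundFill n + boundFill n ≤
      (boundΦ n + 1) * boundFill n + boundFill n :=
    Nat.add_le_add_right (Nat.mul_le_mul_right _ (by omega)) _
  exact Prog.LearnsFrom.mono h (hM'.trans (h₁ _ (by omega) n (by omega))) (by omega) (by omega)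
    ((Nat.mul_le_mul_right _ (by omega)).trans (h₂ _ (by omega) n (by omega)))
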